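/- **Setting.** Let $l_1<l_2$, $T>0$, $r>0$, $\Omega=(l_1,l_2)^3$, $I=[0,T]$, and let $\kappa>0,\alpha,\beta,\gamma,\lambda,\phi$ be smooth functions of $(x,y,z,t)\in\overline\Omega\times I$. Consider $u_t-\nabla\cdot(\kappa\nabla u)+\alpha u_x+\beta u_y+\gamma u_z+\lambda u=\phi$, discretized in time with step $\tau$, $t_{n+i}=(n+i)\tau$, by Crank–Nicolson (CN, $i=\frac12$), BDF3 ($i=3$) or BDF4 ($i=4$). A superscript $n+i$ denotes the value at $t=t_{n+i}$. With $\tau=rh$, where $h$ is the spatial mesh size, the time-discrete equation for $\mathsf u=u^{n+i}$ is $$\Delta\mathsf u+\mathsf a\mathsf u_x+\mathsf b\mathsf u_y+\mathsf c\mathsf u_z+\tfrac1{rh}\mathsf d_1\mathsf u+\mathsf d_2\mathsf u=\mathsf f,\qquad \mathsf f=\mathsf f_1+\tfrac1{rh}\mathsf f_2,\tag{1}$$ where, all at time $t_{n+i}$, $\mathsf a=\frac{\kappa_x-\alpha}{\kappa}$, $\mathsf b=\frac{\kappa_y-\beta}{\kappa}$, $\mathsf c=\frac{\kappa_z-\gamma}{\kappa}$,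 $\mathsf d_2=-\frac{\lambda}{\kappa}$, $\mathsf f_1=-\frac{\phi}{\kappa}$, and - CN: $\mathsf d_1=-\frac{2}{\kappa}$, $\mathsf f_2=-\frac{2u^n}{\kappa}$; - BDF3: $\mathsf d_1=-\frac{11}{6\kappa}$, $\mathsf f_2=-\frac{18u^{n+2}-9u^{n+1}+2u^n}{6\kappa}$; - BDF4: $\mathsf d_1=-\frac{25}{12\kappa}$, $\mathsf f_2=-\frac{48u^{n+3}-36u^{n+2}+16u^{n+1}-3u^n}{12\kappa}$. **The polynomials $G$, $H$.** Write $g^{(m,n,q)}=\partial_x^m\partial_y^n\partial_z^q g$ at a base point. Let $\Lambda_5^1=\{(m,n,q)\in\mathbb N^3: m\le1,\ m+n+q\le5\}$ and $\Lambda_3=\{(m,n,q)\in\mathbb N^3: m+n+q\le3\}$. Put $d=\frac1{rh}\mathsf d_1+\mathsf d_2$, with $rh$ constant in space. Differentiating $\mathsf u_{xx}=\mathsf f-\mathsf u_{yy}-\mathsf u_{zz}-\mathsf a\mathsf u_x-\mathsf b\mathsf u_y-\mathsf c\mathsf u_z-d\,\mathsf u$ and substituting repeatedly expresses every $\mathsf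 u^{(m,n,q)}$ with $m+n+q\le5$ as a linear combination of $\{\mathsf u^{(m',n',q')}\}_{\Lambda_5^1}$ and $\{\mathsf f^{(m',n',q')}\}_{\Lambda_3}$. Substituting this into the Taylor polynomial of degree $5$ of $\mathsf u$ at the base point gives $\sum_{\Lambda_5^1}\mathsf u^{(m,n,q)}G_{5,m,n,q}(X,Y,Z)+\sum_{\Lambda_3}\mathsf f^{(m,n,q)}H_{5,m,n,q}(X,Y,Z)$, $(X,Y,Z)$ being the displacement from the base point. This defines $G$ and $H$: polynomials in $X,Y,Z$ whose coefficients are polynomials in $h^{-1}$. **(i) Existence and uniqueness.** For each of CN, BDF3, BDF4, at every time in $I$ and every base point in $\Omega$, there is exactly one family of real numbers $c_{\rho,\ell,s,p}$ ($\rho,\ell,s\in\{-1,0,1\}$, $0\le p\le5$) such that $C_{\rho,\ell,s}=\sum_{p=0}^5c_{\rho,\ell,s,p}h^p$ satisfies, as (Laurent) polynomials in $h$ with the coefficient derivatives at the base point and time held fixed: - $I_{5,m,n,q}:=\sum_{\rho,\ell,s}C_{\rho,\ell,s}\,G_{5,m,n,q}(\rho h,\ell h,sh)=\mathcal O(h^6)$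 for all $(m,n,q)\in\Lambda_5^1$; - the term of lowest degree in $h$ of $h^{-2}\sum_{\Lambda_3}\mathsf f^{(m,n,q)}J_{3,m,n,q}$, with $J_{3,m,n,q}=\sum_{\rho,\ell,s}C_{\rho,\ell,s}H_{5,m,n,q}(\rho h,\ell h,sh)$ and the $\mathsf f^{(m,n,q)}$ regarded as symbols, is the $h^0$ term, and it equals $\mathsf f$; - $C_{\rho,\ell,s}=0$ whenever $\rho,\ell,s$ are all nonzero (a 19-point stencil), and $c_{0,0,0,0}=-4$; - $c_{-1,0,-1,5}$, $c_{-1,0,0,5}$, $c_{-1,0,1,p_1}$, $c_{-1,1,0,p_1}$, $c_{0,-1,-1,5}$, $c_{0,-1,0,p_1}$, $c_{0,-1,1,p_2}$, $c_{0,0,-1,p_1}$, $c_{0,0,0,p_1}$, $c_{0,0,1,p_2}$, $c_{0,1,-1,p_2}$, $c_{0,1,0,p_2}$, $c_{0,1,1,p_3}$, $c_{1,-1,0,p_2}$, $c_{1,0,-1,p_2}$, $c_{1,0,0,p_3}$, $c_{1,0,1,p_3}$, $c_{1,1,0,p_4}$ vanish for $p_1=4,5$; $p_2=3,4,5$; $p_3=2,\dots,5$;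 $p_4=1,\dots,5$. **(ii) Fourth-order consistency.** With these $C_{\rho,\ell,s}$, and with $\mathsf f^{(m,n,q)}=\mathsf f_1^{(m,n,q)}+\frac1{rh}\mathsf f_2^{(m,n,q)}$ inserted, let $F$ be the sum of the terms of degree $\le3$ in $h$ of $h^{-2}\sum_{\Lambda_3}\mathsf f^{(m,n,q)}J_{3,m,n,q}$ (the derivatives of $\mathsf f_1,\mathsf f_2$ counting as degree $0$). The scheme $$\frac1{h^2}\sum_{\rho,\ell,s=-1}^1C_{\rho,\ell,s}\,(u_h)_{i+\rho,j+\ell,k+s}=F_{i,j,k}$$ on the grid $x_i=l_1+ih$, $y_j=l_1+jh$, $z_k=l_1+kh$, $h=(l_2-l_1)/N_1$, is consistent of order four with (1). That is, for every $M$ there is a constant $K$ (which may also depend on $l_1,l_2,T,r$, the method and $\kappa,\alpha,\beta,\gamma,\lambda,\phi$) such that for all $N_1$, all interior grid points, all time levels $t_{n+i}\le T$, and all smooth known levels $u^n,u^{n+1},\dots$ and smooth solutions $\mathsf u$ of (1) on $\overline\Omega$ whose partial derivatives of order $\le6$ are bounded by $M$ in $\Omega$, $$\Big|\frac1{h^2}\sum_{\rho,\ell,s=-1}^1C_{\rho,\ell,s}\,\mathsf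 u(x_i+\rho h,y_j+\ell h,z_k+sh)-F_{i,j,k}\Big|\le K h^4 .$$ -/

import Mathlib

open scoped ContDiff

noncomputable section

namespace CompactFDM

/-- Points `(x, y, z)` of space. -/
abbrev Space := ℝ × ℝ × ℝ

/-- The cube `Ω = (l₁, l₂)³`. -/
def openBox (l₁ l₂ : ℝ) : Set Space :=
  Set.Ioo l₁ l₂ ×ˢ Set.Ioo l₁ l₂ ×ˢ Set.Ioo l₁ l₂

/-- The closed cube `[l₁, l₂]³`. -/
def closedBox (l₁ l₂ : ℝ) : Set Space :=
  Set.Icc l₁ l₂ ×ˢ Set.Icc l₁ l₂ ×ˢ Set.Icc l₁ l₂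

/-- The partial derivative `∂^{m+n+q} g / ∂x^m ∂y^n ∂z^q` at `p`. -/
def pd (m n q : ℕ) (g : Space → ℝ) (p : Space) : ℝ :=
  iteratedDeriv m (fun x => iteratedDeriv n (fun y => iteratedDeriv q (fun z =>
    g (x, y, z)) p.2.2) p.2.1) p.1

/-! ### The parabolic equation and its time discretizations -/

/-- The coefficients and the source (functions of time and space) of the equation
`u_t - ∇·(κ∇u) + α u_x + β u_y + γ u_z + lam u = φ`. -/
structure Data where
  κ : ℝ → Space → ℝ
  α : ℝ → Space → ℝ
  β : ℝ → Space → ℝ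
  γ : ℝ → Space → ℝ
  lam : ℝ → Space → ℝ
  φ : ℝ → Space → ℝ

/-- Smoothness of a function of time and space on `[0, T] × [l₁, l₂]³`. -/
def SmoothOn (l₁ l₂ T : ℝ) (g : ℝ → Space → ℝ) : Prop :=
  ContDiffOn ℝ ∞ (fun p : ℝ × Space => g p.1 p.2) (Set.Icc 0 T ×ˢ closedBox l₁ l₂)

/-- The coefficients and the source are smooth and `κ > 0` on `[0, T] × [l₁, l₂]³`. -/
structure Data.Regular (D : Data) (l₁ l₂ T : ℝ) : Prop where
  smooth_κ : SmoothOn l₁ l₂ T D.κ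
  smooth_α : SmoothOn l₁ l₂ T D.α
  smooth_β : SmoothOn l₁ l₂ T D.β
  smooth_γ : SmoothOn l₁ l₂ T D.γ
  smooth_lam : SmoothOn l₁ l₂ T D.lam
  smooth_φ : SmoothOn l₁ l₂ T D.φ
  κ_pos : ∀ t ∈ Set.Icc 0 T, ∀ p ∈ closedBox l₁ l₂, 0 < D.κ t p

/-- The three time discretizations: Crank-Nicolson (its implicit half step), and the backward
differentiation formulas of orders three and four. -/
inductive TimeMethod
  | CN
  | BDF3
  | BDF4

/-- The index `i` of the new time level `t_{n+i}`. -/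
def TimeMethod.level : TimeMethod → ℝ
  | .CN => 1 / 2
  | .BDF3 => 3
  | .BDF4 => 4

/-- The factor of the new level in the difference quotient:
`2 / τ`, `11 / (6 τ)`, `25 / (12 τ)`. -/
def TimeMethod.lead : TimeMethod → ℝ
  | .CN => 2
  | .BDF3 => 11 / 6
  | .BDF4 => 25 / 12

/-- The combination of the known levels in the difference quotient, so that the latter is
`(lead * u^{n+i} - history w p) / τ`, where `w j = u^{n+j}`. -/
def TimeMethod.history (w : ℕ → Space → ℝ) (p : Space) : TimeMethod → ℝ
  | .CN => 2 * w 0 p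
  | .BDF3 => (18 * w 2 p - 9 * w 1 p + 2 * w 0 p) / 6
  | .BDF4 => (48 * w 3 p - 36 * w 2 p + 16 * w 1 p - 3 * w 0 p) / 12

/-- `a = (κ_x - α) / κ` at time `t`. -/
def Data.a (D : Data) (t : ℝ) (p : Space) : ℝ := (pd 1 0 0 (D.κ t) p - D.α t p) / D.κ t p

/-- `b = (κ_y - β) / κ` at time `t`. -/
def Data.b (D : Data) (t : ℝ) (p : Space) : ℝ := (pd 0 1 0 (D.κ t) p - D.β t p) / D.κ t p

/-- `c = (κ_z - γ) / κ` at time `t`. -/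
def Data.c (D : Data) (t : ℝ) (p : Space) : ℝ := (pd 0 0 1 (D.κ t) p - D.γ t p) / D.κ t p

/-- `d₁ = -2/κ`, `-11/(6κ)`, `-25/(12κ)`. -/
def Data.d₁ (D : Data) (meth : TimeMethod) (t : ℝ) (p : Space) : ℝ := -meth.lead / D.κ t p

/-- `d₂ = -lam / κ`. -/
def Data.d₂ (D : Data) (t : ℝ) (p : Space) : ℝ := -D.lam t p / D.κ t p

/-- `f₁ = -φ / κ`. -/
def Data.f₁ (D : Data) (t : ℝ) (p : Space) : ℝ := -D.φ t p / D.κ t p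

/-- `f₂ = -2uⁿ/κ` for CN, `(18u^{n+2} - 9u^{n+1} + 2uⁿ)/(-6κ)` for BDF3,
`(48u^{n+3} - 36u^{n+2} + 16u^{n+1} - 3uⁿ)/(-12κ)` for BDF4. -/
def Data.f₂ (D : Data) (meth : TimeMethod) (t : ℝ) (w : ℕ → Space → ℝ) (p : Space) : ℝ :=
  -meth.history w p / D.κ t p

/-- The function `v`, at the new time level `t`, solves on `Ω` the semi-discrete equation
`Δv + a v_x + b v_y + c v_z + (1/τ) d₁ v + d₂ v = f₁ + (1/τ) f₂`, in which `w j = u^{n+j}`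
are the known levels. -/
def SolvesSemidiscrete (D : Data) (meth : TimeMethod) (l₁ l₂ τ t : ℝ)
    (v : Space → ℝ) (w : ℕ → Space → ℝ) : Prop :=
  ∀ p ∈ openBox l₁ l₂,
    pd 2 0 0 v p + pd 0 2 0 v p + pd 0 0 2 v p
      + D.a t p * pd 1 0 0 v p + D.b t p * pd 0 1 0 v p + D.c t p * pd 0 0 1 v p
      + 1 / τ * D.d₁ meth t p * v p + D.d₂ t p * v p
    = D.f₁ t p + 1 / τ * D.f₂ meth t w p

/-! ### Elimination of the derivatives `u^{(m,n,q)}` with `m ≥ 2`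

Quantities that depend on the mesh size `h` are Laurent polynomials over `ℝ` in the
indeterminate `h = T 1`. -/

/-- Laurent polynomials in the mesh size `h`. -/
abbrev HPoly := LaurentPolynomial ℝ

/-- The values `∂^{i+j+k}` of the coefficients of `Δu + a u_x + b u_y + c u_z + d u = f`
at one point of space. -/
structure Jets where
  a : ℕ → ℕ → ℕ → HPoly
  b : ℕ → ℕ → ℕ → HPoly
  c : ℕ → ℕ → ℕ → HPoly
  d : ℕ → ℕ → ℕ → HPoly

/-- The jets at `p`, at time `t`, of the coefficients of the semi-discrete equation with
`τ = r h`; the coefficient of `u` is `d = d₁ / (r h) + d₂`. -/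
def Data.jets (D : Data) (meth : TimeMethod) (r t : ℝ) (p : Space) : Jets where
  a i j k := LaurentPolynomial.C (pd i j k (D.a t) p)
  b i j k := LaurentPolynomial.C (pd i j k (D.b t) p)
  c i j k := LaurentPolynomial.C (pd i j k (D.c t) p)
  d i j k := LaurentPolynomial.C (pd i j k (D.d₁ meth t) p / r) * LaurentPolynomial.T (-1)
    + LaurentPolynomial.C (pd i j k (D.d₂ t) p)

/-- `reduce J U F m n q` is the expression of `u^{(m,n,q)}` through the derivatives
`u^{(m',n',q')}`, `m' ≤ 1`, whose values are `U m' n' q'`, and through the derivatives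
`f^{(m',n',q')}`, whose values are `F m' n' q'`. It is obtained by applying `∂^{(m,n,q)}` to
`u_xx = f - u_yy - u_zz - a u_x - b u_y - c u_z - d u` with the Leibniz rule, repeatedly. -/
def reduce (J : Jets) (U F : ℕ → ℕ → ℕ → HPoly) : ℕ → ℕ → ℕ → HPoly
  | 0, n, q => U 0 n q
  | 1, n, q => U 1 n q
  | m + 2, n, q =>
      F m n q - reduce J U F m (n + 2) q - reduce J U F m n (q + 2)
      - ∑ i ∈ Finset.range (m + 1), ∑ j ∈ Finset.range (n + 1), ∑ k ∈ Finset.range (q + 1),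
          ((m.choose i * n.choose j * q.choose k : ℕ) : HPoly) *
            (J.a i j k * reduce J U F (m - i + 1) (n - j) (q - k)
              + J.b i j k * reduce J U F (m - i) (n - j + 1) (q - k)
              + J.c i j k * reduce J U F (m - i) (n - j) (q - k + 1)
              + J.d i j k * reduce J U F (m - i) (n - j) (q - k))
termination_by m _ _ => m

/-- The family that is `1` at the index `(m, n, q)` and `0` elsewhere. -/
def unitAt (m n q : ℕ) : ℕ → ℕ → ℕ → HPoly :=
  fun m' n' q' => if m' = m ∧ n' = n ∧ q' = q then 1 else 0

/-- The indices `(m, n, q)` with `m + n + q ≤ k`. -/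
def degLE (k : ℕ) : Finset (ℕ × ℕ × ℕ) :=
  (Finset.range (k + 1) ×ˢ Finset.range (k + 1) ×ˢ Finset.range (k + 1)).filter
    (fun e => e.1 + e.2.1 + e.2.2 ≤ k)

/-- The index set `Λ₅¹` of the `(m, n, q)` with `m ≤ 1` and `m + n + q ≤ 5`. -/
def Lam51 : Finset (ℕ × ℕ × ℕ) := (degLE 5).filter (fun e => e.1 ≤ 1)

/-- The Taylor polynomial of degree `5` at `(X, Y, Z)` of the reduced expression of `u`. -/
def taylor5 (J : Jets) (U F : ℕ → ℕ → ℕ → HPoly) (X Y Z : HPoly) : HPoly :=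
  ∑ e ∈ degLE 5,
    LaurentPolynomial.C (1 / ((e.1.factorial * e.2.1.factorial * e.2.2.factorial : ℕ) : ℝ))
      * reduce J U F e.1 e.2.1 e.2.2 * (X ^ e.1 * Y ^ e.2.1 * Z ^ e.2.2)

/-- `G_{5,m,n,q}(X, Y, Z)`: the factor of `u^{(m,n,q)}`, `(m, n, q) ∈ Λ₅¹`, in the expansion of
`u` at the point `(X, Y, Z)` relative to the base point. -/
def G (J : Jets) (m n q : ℕ) (X Y Z : HPoly) : HPoly :=
  taylor5 J (unitAt m n q) (fun _ _ _ => 0) X Y Z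

/-- `H_{5,m,n,q}(X, Y, Z)`: the factor of `f^{(m,n,q)}`, `m + n + q ≤ 3`, in that expansion. -/
def H (J : Jets) (m n q : ℕ) (X Y Z : HPoly) : HPoly :=
  taylor5 J (fun _ _ _ => 0) (unitAt m n q) X Y Z

/-! ### Stencils -/

/-- The coefficients `c_{i,j,k,p}` with `i, j, k ∈ {-1, 0, 1}` and `p = 0, …, 5`. -/
abbrev Stencil := SignType → SignType → SignType → Fin 6 → ℝ

/-- `C_{i,j,k} = ∑_p c_{i,j,k,p} h^p`. -/
def Stencil.poly (c : Stencil) (i j k : SignType) : HPoly :=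
  ∑ p : Fin 6, LaurentPolynomial.C (c i j k p) * LaurentPolynomial.T ((p : ℕ) : ℤ)

/-- The displacement `s h` with `s ∈ {-1, 0, 1}`. -/
def shift (s : SignType) : HPoly := LaurentPolynomial.C (s : ℝ) * LaurentPolynomial.T 1

/-- `I_{5,m,n,q} = ∑ C_{i,j,k} G_{5,m,n,q}(ih, jh, kh)`. -/
def Stencil.I (c : Stencil) (J : Jets) (m n q : ℕ) : HPoly :=
  ∑ i : SignType, ∑ j : SignType, ∑ k : SignType,
    c.poly i j k * G J m n q (shift i) (shift j) (shift k)

/-- `J_{3,m,n,q} = ∑ C_{i,j,k} H_{5,m,n,q}(ih, jh, kh)`. -/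
def Stencil.rhs (c : Stencil) (J : Jets) (m n q : ℕ) : HPoly :=
  ∑ i : SignType, ∑ j : SignType, ∑ k : SignType,
    c.poly i j k * H J m n q (shift i) (shift j) (shift k)

/-- The conditions that single out the stencil at a point with coefficient jets `J`. -/
structure Stencil.Admissible (c : Stencil) (J : Jets) : Prop where
  /-- `I_{5,m,n,q} = O(h⁶)` for all `(m, n, q) ∈ Λ₅¹`. -/
  order : ∀ e ∈ Lam51, ∀ k : ℤ, k < 6 → (c.I J e.1 e.2.1 e.2.2).coeff k = 0
  /-- In `h⁻² ∑ f^{(m,n,q)} J_{3,m,n,q}`, as an expression in the symbols `f^{(m,n,q)}`, the term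
  of lowest degree in `h` is the `h⁰` term, and it is `f`. -/
  lowest : ∀ e ∈ degLE 3, ∀ k : ℤ, k ≤ 0 →
    (LaurentPolynomial.T (-2) * c.rhs J e.1 e.2.1 e.2.2).coeff k =
      if k = 0 ∧ e = (0, 0, 0) then 1 else 0
  /-- `C_{i,j,k} = 0` at the eight vertices, which leaves `19` points. -/
  corner : ∀ i j k : SignType, i ≠ 0 → j ≠ 0 → k ≠ 0 → ∀ p, c i j k p = 0
  center : c 0 0 0 0 = -4
  zero_n0n : ∀ p : Fin 6, 5 ≤ p → c (-1) 0 (-1) p = 0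
  zero_n00 : ∀ p : Fin 6, 5 ≤ p → c (-1) 0 0 p = 0
  zero_n01 : ∀ p : Fin 6, 4 ≤ p → c (-1) 0 1 p = 0
  zero_n10 : ∀ p : Fin 6, 4 ≤ p → c (-1) 1 0 p = 0
  zero_0nn : ∀ p : Fin 6, 5 ≤ p → c 0 (-1) (-1) p = 0
  zero_0n0 : ∀ p : Fin 6, 4 ≤ p → c 0 (-1) 0 p = 0
  zero_0n1 : ∀ p : Fin 6, 3 ≤ p → c 0 (-1) 1 p = 0
  zero_00n : ∀ p : Fin 6, 4 ≤ p → c 0 0 (-1) p = 0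
  zero_000 : ∀ p : Fin 6, 4 ≤ p → c 0 0 0 p = 0
  zero_001 : ∀ p : Fin 6, 3 ≤ p → c 0 0 1 p = 0
  zero_01n : ∀ p : Fin 6, 3 ≤ p → c 0 1 (-1) p = 0
  zero_010 : ∀ p : Fin 6, 3 ≤ p → c 0 1 0 p = 0
  zero_011 : ∀ p : Fin 6, 2 ≤ p → c 0 1 1 p = 0
  zero_1n0 : ∀ p : Fin 6, 3 ≤ p → c 1 (-1) 0 p = 0
  zero_10n : ∀ p : Fin 6, 3 ≤ p → c 1 0 (-1) p = 0
  zero_100 : ∀ p : Fin 6, 2 ≤ p → c 1 0 0 p = 0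
  zero_101 : ∀ p : Fin 6, 2 ≤ p → c 1 0 1 p = 0
  zero_110 : ∀ p : Fin 6, 1 ≤ p → c 1 1 0 p = 0

/-- The left-hand side `L_h v = h⁻² ∑ C_{i,j,k} v(x + ih, y + jh, z + kh)` at `p = (x, y, z)`. -/
def Stencil.lhsValue (c : Stencil) (h : ℝ) (v : Space → ℝ) (p : Space) : ℝ :=
  1 / h ^ 2 * ∑ i : SignType, ∑ j : SignType, ∑ k : SignType,
    (∑ e : Fin 6, c i j k e * h ^ (e : ℕ)) * v (p + ((i : ℝ) * h, (j : ℝ) * h, (k : ℝ) * h))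

/-- `h⁻² ∑ f^{(m,n,q)} J_{3,m,n,q}` over `m + n + q ≤ 3`, where `f = f₁ + f₂ / (r h)`. -/
def Stencil.sourcePoly (c : Stencil) (J : Jets) (r : ℝ) (f₁ f₂ : Space → ℝ) (p : Space) : HPoly :=
  LaurentPolynomial.T (-2) * ∑ e ∈ degLE 3,
    (LaurentPolynomial.C (pd e.1 e.2.1 e.2.2 f₁ p)
      + LaurentPolynomial.C (pd e.1 e.2.1 e.2.2 f₂ p / r) * LaurentPolynomial.T (-1))
    * c.rhs J e.1 e.2.1 e.2.2

/-- The value at the real number `h` of the terms of degree at most `3` of a Laurent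
polynomial in `h`. -/
def valueTrunc3 (P : HPoly) (h : ℝ) : ℝ :=
  (P.coeff.filter (fun e : ℤ => e ≤ 3)).sum (fun e x => x * h ^ e)

/-- The right-hand side `F` of the scheme at `p`: the terms of degree at most `3` in `h` of
`h⁻² ∑ f^{(m,n,q)} J_{3,m,n,q}`. -/
def Stencil.F (c : Stencil) (J : Jets) (r h : ℝ) (f₁ f₂ : Space → ℝ) (p : Space) : ℝ :=
  valueTrunc3 (c.sourcePoly J r f₁ f₂ p) h

/-- The grid point `(x_i, y_j, z_k)` of the mesh of size `h`. -/
def gridPoint (l₁ h : ℝ) (i j k : ℕ) : Space := (l₁ + i * h, l₁ + j * h, l₁ + k * h)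

end CompactFDM

end

noncomputable section

namespace CompactFDM

/-! ### Elimination over an arbitrary commutative ring -/

section Elimination

variable {S R : Type*} [CommRing S] [CommRing R]

/-! Measure space in units of `h`. A derivative of order `l` of a coefficient is then multiplied by
at least `h ^ (l + 1)`; even `d₁ / (r h)` becomes `h d₁ / r`. The eliminated derivatives turn into
genuine polynomials in `h` (`fundamentalU`, `fundamentalF`), and at `h = 0` the equation is
Poisson's. The requirement `I = O(h⁶)` says that, for each index `e` of degree `|e|`, the
coefficients of `h ^ s` with `s + |e| < 6` vanish (`admissible_iff`). This is a block triangular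
linear system for the layers `c_{·,p}`: layer `s` enters the coefficient of `h ^ s` only through its
pairing with the harmonic polynomial of index `e`, and everything else comes from earlier layers.

Layer zero is the 19-point Laplacian, the only stencil up to a factor that annihilates the harmonic
polynomials in question; the prescribed centre fixes the factor. In each layer `p = 1, …, 5` the
prescribed zeros leave exactly as many unknowns as there are harmonic polynomials of degree at most
`5 - p` that are independent on the 19 points, and the square system is invertible
(`eq_zero_of_level`, `levelMap_surjective`). This gives uniqueness. For existence the remaining,
dependent, conditions must be compatible. Parity makes them so: each change of parity of an exponent
costs a factor `h` (`pow_parityDist_dvd`), and layer zero is even in every coordinate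
(`exists_scaledAdmissible`).

For consistency, the Taylor polynomial of a solution is a combination of fundamental jets
(`eq_sum_fundamental`). The stencil sends the part carried by derivatives of `u` to `O(h⁶)`, and the
part carried by `f` to the right-hand side, up to a truncation that is again `O(h⁶)` before division
by `h²` (`exists_truncation_error`). To obtain one constant for all grid points, times and
solutions, the algebra is carried out once over the ring of bounded functions on the set of all such
configurations; hence the construction works over an arbitrary `ℝ`-algebra. The error is `h⁴` times
an element of that ring (`exists_error_function`). The derivatives of `f₂` are polynomial
expressions in `h` and the jets of the coefficients, of `f₁` and of the solution, by the equation
itself, so they lie in the ring too. -/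

/-- The jets of the coefficients `a, b, c, d`, with values in a commutative ring. -/
structure CoeffJets (S : Type*) where
  a : ℕ → ℕ → ℕ → S
  b : ℕ → ℕ → ℕ → S
  c : ℕ → ℕ → ℕ → S
  d : ℕ → ℕ → ℕ → S

/-- The jet of a product, by the Leibniz rule. -/
def leibniz (w g : ℕ → ℕ → ℕ → S) (m n q : ℕ) : S :=
  ∑ i ∈ Finset.range (m + 1), ∑ j ∈ Finset.range (n + 1), ∑ k ∈ Finset.range (q + 1),
    ((m.choose i * n.choose j * q.choose k : ℕ) : S) * (w i j k * g (m - i) (n - j) (q - k))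

/-- The jet of `a v_x + b v_y + c v_z + d v`. -/
def lowerOrder (K : CoeffJets S) (V : ℕ → ℕ → ℕ → S) (m n q : ℕ) : S :=
  leibniz K.a (fun i j k => V (i + 1) j k) m n q + leibniz K.b (fun i j k => V i (j + 1) k) m n q
    + leibniz K.c (fun i j k => V i j (k + 1)) m n q + leibniz K.d V m n q

/-- The jet `V` satisfies the equation `Δv + a v_x + b v_y + c v_z + d v = f` differentiated
`(m, n, q)` times. -/
def SolvesJet (K : CoeffJets S) (V F : ℕ → ℕ → ℕ → S) (m n q : ℕ) : Prop :=
  V (m + 2) n q + V m (n + 2) q + V m n (q + 2) + lowerOrder K V m n q = F m n q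

/-- The jet of the solution with prescribed right-hand side `F` and prescribed derivatives `U` of
order at most one in `x`. -/
def eliminate (K : CoeffJets S) (U F : ℕ → ℕ → ℕ → S) : ℕ → ℕ → ℕ → S
  | 0, n, q => U 0 n q
  | 1, n, q => U 1 n q
  | m + 2, n, q =>
      F m n q - eliminate K U F m (n + 2) q - eliminate K U F m n (q + 2)
      - ∑ i ∈ Finset.range (m + 1), ∑ j ∈ Finset.range (n + 1), ∑ k ∈ Finset.range (q + 1),
          ((m.choose i * n.choose j * q.choose k : ℕ) : S) *
            (K.a i j k * eliminate K U F (m - i + 1) (n - j) (q - k)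
              + K.b i j k * eliminate K U F (m - i) (n - j + 1) (q - k)
              + K.c i j k * eliminate K U F (m - i) (n - j) (q - k + 1)
              + K.d i j k * eliminate K U F (m - i) (n - j) (q - k))
termination_by m _ _ => m

lemma eliminate_zero (K : CoeffJets S) (U F : ℕ → ℕ → ℕ → S) (n q : ℕ) :
    eliminate K U F 0 n q = U 0 n q := by rw [eliminate]

lemma eliminate_one (K : CoeffJets S) (U F : ℕ → ℕ → ℕ → S) (n q : ℕ) :
    eliminate K U F 1 n q = U 1 n q := by rw [eliminate]

lemma eliminate_add_two (K : CoeffJets S) (U F : ℕ → ℕ → ℕ → S) (m n q : ℕ) :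
    eliminate K U F (m + 2) n q =
      F m n q - eliminate K U F m (n + 2) q - eliminate K U F m n (q + 2)
        - lowerOrder K (eliminate K U F) m n q := by
  rw [eliminate]
  simp only [lowerOrder, leibniz, ← Finset.sum_add_distrib, ← mul_add]

lemma solvesJet_eliminate (K : CoeffJets S) (U F : ℕ → ℕ → ℕ → S) (m n q : ℕ) :
    SolvesJet K (eliminate K U F) F m n q := by
  unfold SolvesJet
  rw [eliminate_add_two]
  ring

lemma leibniz_congr {w g g' : ℕ → ℕ → ℕ → S} {m n q : ℕ}
    (h : ∀ i j k, i ≤ m → j ≤ n → k ≤ q → g i j k = g' i j k) :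
    leibniz w g m n q = leibniz w g' m n q := by
  unfold leibniz
  refine Finset.sum_congr rfl fun i _ => Finset.sum_congr rfl fun j _ =>
    Finset.sum_congr rfl fun k _ => ?_
  rw [h _ _ _ (Nat.sub_le _ _) (Nat.sub_le _ _) (Nat.sub_le _ _)]

lemma lowerOrder_congr {K : CoeffJets S} {V V' : ℕ → ℕ → ℕ → S} {m n q : ℕ}
    (h : ∀ i j k, i ≤ m + 1 → i + j + k ≤ m + n + q + 1 → V i j k = V' i j k) :
    lowerOrder K V m n q = lowerOrder K V' m n q := by
  unfold lowerOrder
  congr 1; congr 1; congr 1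
  all_goals
    refine leibniz_congr fun i j k hi hj hk => h _ _ _ (by omega) (by omega)

/-- The equation determines all derivatives of order at most `N` from those of order at most one
in `x`. -/
lemma eq_eliminate {K : CoeffJets S} {U F V : ℕ → ℕ → ℕ → S} (N : ℕ)
    (hV : ∀ m n q, m + n + q + 2 ≤ N → SolvesJet K V F m n q)
    (hU : ∀ m n q, m ≤ 1 → m + n + q ≤ N → V m n q = U m n q) (m n q : ℕ)
    (hN : m + n + q ≤ N) : V m n q = eliminate K U F m n q := by
  induction m using Nat.strong_induction_on generalizing n q with
  | _ m ih =>
    match m, ih, hN with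
    | 0, _, hN => rw [eliminate_zero, hU _ _ _ (by omega) hN]
    | 1, _, hN => rw [eliminate_one, hU _ _ _ le_rfl hN]
    | m + 2, ih, hN =>
      have h := hV m n q (by omega)
      unfold SolvesJet at h
      rw [eliminate_add_two, ← ih m (by omega) (n + 2) q (by omega),
        ← ih m (by omega) n (q + 2) (by omega), ← h,
        lowerOrder_congr (V' := V) fun i j k hi hs => (ih i (by omega) j k (by omega)).symm]
      ring

/-- The image of the coefficient jets under a map. -/
def CoeffJets.map (φ : S → R) (K : CoeffJets S) : CoeffJets R where
  a i j k := φ (K.a i j k)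
  b i j k := φ (K.b i j k)
  c i j k := φ (K.c i j k)
  d i j k := φ (K.d i j k)

lemma map_leibniz (φ : S →+* R) (w g : ℕ → ℕ → ℕ → S) (m n q : ℕ) :
    φ (leibniz w g m n q) =
      leibniz (fun i j k => φ (w i j k)) (fun i j k => φ (g i j k)) m n q := by
  simp only [leibniz, map_sum, map_mul, map_natCast]

lemma map_lowerOrder (φ : S →+* R) (K : CoeffJets S) (V : ℕ → ℕ → ℕ → S) (m n q : ℕ) :
    φ (lowerOrder K V m n q) = lowerOrder (K.map φ) (fun i j k => φ (V i j k)) m n q := by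
  simp only [lowerOrder, map_add, map_leibniz, CoeffJets.map]

/-- The image of the eliminated jet solves the image equation with the image data, so the uniqueness
in `eq_eliminate` identifies it. Linearity and scaling below follow the same pattern. -/
lemma map_eliminate (φ : S →+* R) (K : CoeffJets S) (U F : ℕ → ℕ → ℕ → S) (m n q : ℕ) :
    φ (eliminate K U F m n q) =
      eliminate (K.map φ) (fun i j k => φ (U i j k)) (fun i j k => φ (F i j k)) m n q := by
  refine eq_eliminate (V := fun i j k => φ (eliminate K U F i j k)) (m + n + q)
    (fun i j k _ => ?_) (fun i j k hi _ => ?_) m n q le_rfl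
  · have h := congrArg φ (solvesJet_eliminate K U F i j k)
    simp only [map_add, map_lowerOrder] at h
    exact h
  · interval_cases i
    · simp only [eliminate_zero]
    · simp only [eliminate_one]

lemma leibniz_sum {ι : Type*} (s : Finset ι) (w : ℕ → ℕ → ℕ → S) (x : ι → S)
    (g : ι → ℕ → ℕ → ℕ → S) (m n q : ℕ) :
    leibniz w (fun i j k => ∑ e ∈ s, x e * g e i j k) m n q =
      ∑ e ∈ s, x e * leibniz w (g e) m n q := by
  simp only [leibniz, Finset.mul_sum]
  conv_rhs => rw [Finset.sum_comm]
  refine Finset.sum_congr rfl fun i _ => ?_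
  conv_rhs => rw [Finset.sum_comm]
  refine Finset.sum_congr rfl fun j _ => ?_
  conv_rhs => rw [Finset.sum_comm]
  refine Finset.sum_congr rfl fun k _ => Finset.sum_congr rfl fun e _ => ?_
  ring

lemma leibniz_add (w g g' : ℕ → ℕ → ℕ → S) (m n q : ℕ) :
    leibniz w (fun i j k => g i j k + g' i j k) m n q =
      leibniz w g m n q + leibniz w g' m n q := by
  simp only [leibniz, mul_add, Finset.sum_add_distrib]

lemma lowerOrder_sum {ι : Type*} (s : Finset ι) (K : CoeffJets S) (x : ι → S)
    (V : ι → ℕ → ℕ → ℕ → S) (m n q : ℕ) :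
    lowerOrder K (fun i j k => ∑ e ∈ s, x e * V e i j k) m n q =
      ∑ e ∈ s, x e * lowerOrder K (V e) m n q := by
  simp only [lowerOrder, mul_add, Finset.sum_add_distrib]
  rw [leibniz_sum s K.a x (fun e i j k => V e (i + 1) j k),
    leibniz_sum s K.b x (fun e i j k => V e i (j + 1) k),
    leibniz_sum s K.c x (fun e i j k => V e i j (k + 1)), leibniz_sum s K.d x V]

lemma lowerOrder_add (K : CoeffJets S) (V V' : ℕ → ℕ → ℕ → S) (m n q : ℕ) :
    lowerOrder K (fun i j k => V i j k + V' i j k) m n q =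
      lowerOrder K V m n q + lowerOrder K V' m n q := by
  simp only [lowerOrder]
  rw [leibniz_add K.a (fun i j k => V (i + 1) j k), leibniz_add K.b (fun i j k => V i (j + 1) k),
    leibniz_add K.c (fun i j k => V i j (k + 1)), leibniz_add K.d V]
  ring

/-- The jet that is `1` at the index `e` and `0` elsewhere. -/
def single (e : ℕ × ℕ × ℕ) : ℕ → ℕ → ℕ → S :=
  fun m n q => if m = e.1 ∧ n = e.2.1 ∧ q = e.2.2 then 1 else 0

lemma sum_mul_single (s : Finset (ℕ × ℕ × ℕ)) (x : ℕ × ℕ × ℕ → S) (m n q : ℕ) :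
    ∑ e ∈ s, x e * single e m n q = if (m, n, q) ∈ s then x (m, n, q) else 0 := by
  have : ∀ e : ℕ × ℕ × ℕ, x e * single e m n q = if (m, n, q) = e then x e else 0 := by
    rintro ⟨i, j, k⟩
    simp only [single, Prod.mk.injEq, mul_ite, mul_one, mul_zero]
  simp only [this, Finset.sum_ite_eq]

lemma map_single (φ : S →+* R) (e : ℕ × ℕ × ℕ) (m n q : ℕ) :
    φ (single e m n q) = single e m n q := by
  unfold single
  split_ifs <;> simp

/-- The fundamental jet that equals `1` at the index `e` among those of order at most one in
`x`, for the homogeneous equation. -/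
def fundamentalU (K : CoeffJets S) (e : ℕ × ℕ × ℕ) : ℕ → ℕ → ℕ → S :=
  eliminate K (single e) (fun _ _ _ => 0)

/-- The fundamental jet for a right-hand side whose only nonzero derivative is that of index
`e`. -/
def fundamentalF (K : CoeffJets S) (e : ℕ × ℕ × ℕ) : ℕ → ℕ → ℕ → S :=
  eliminate K (fun _ _ _ => 0) (single e)

lemma mem_degLE {N : ℕ} {e : ℕ × ℕ × ℕ} : e ∈ degLE N ↔ e.1 + e.2.1 + e.2.2 ≤ N := by
  simp only [degLE, Finset.mem_filter, Finset.mem_product, Finset.mem_range]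
  omega

lemma mem_Lam51 {e : ℕ × ℕ × ℕ} : e ∈ Lam51 ↔ e.1 ≤ 1 ∧ e.1 + e.2.1 + e.2.2 ≤ 5 := by
  simp only [Lam51, Finset.mem_filter, mem_degLE, and_comm]

/-- Every jet that satisfies the equation to order five is a combination of the fundamental
ones. -/
lemma eq_sum_fundamental {K : CoeffJets S} {V F : ℕ → ℕ → ℕ → S}
    (hV : ∀ m n q, m + n + q ≤ 3 → SolvesJet K V F m n q) (m n q : ℕ) (h5 : m + n + q ≤ 5) :
    V m n q = ∑ e ∈ Lam51, V e.1 e.2.1 e.2.2 * fundamentalU K e m n q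
      + ∑ e ∈ degLE 3, F e.1 e.2.1 e.2.2 * fundamentalF K e m n q := by
  rw [eq_eliminate (U := V) (F := F) 5 (fun i j k h => hV i j k (by omega))
    (fun _ _ _ _ _ => rfl) m n q h5]
  symm
  -- The combination is itself a solution with right-hand side `F` up to order three and with the
  -- same free derivatives, so uniqueness applies.
  refine eq_eliminate (V := fun m n q => ∑ e ∈ Lam51, V e.1 e.2.1 e.2.2 * fundamentalU K e m n q
      + ∑ e ∈ degLE 3, F e.1 e.2.1 e.2.2 * fundamentalF K e m n q) 5 (fun i j k h => ?_)
      (fun i j k hi h => ?_) m n q h5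
  · unfold SolvesJet
    rw [lowerOrder_add K (fun i j k => ∑ e ∈ Lam51, V e.1 e.2.1 e.2.2 * fundamentalU K e i j k),
      lowerOrder_sum Lam51 K (fun e => V e.1 e.2.1 e.2.2) (fundamentalU K),
      lowerOrder_sum (degLE 3) K (fun e => F e.1 e.2.1 e.2.2) (fundamentalF K)]
    have h1 : ∀ e, fundamentalU K e (i + 2) j k + fundamentalU K e i (j + 2) k
        + fundamentalU K e i j (k + 2) + lowerOrder K (fundamentalU K e) i j k = 0 :=
      fun e => solvesJet_eliminate K (single e) (fun _ _ _ => 0) i j k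
    have h2 : ∀ e, fundamentalF K e (i + 2) j k + fundamentalF K e i (j + 2) k
        + fundamentalF K e i j (k + 2) + lowerOrder K (fundamentalF K e) i j k = single e i j k :=
      fun e => solvesJet_eliminate K (fun _ _ _ => 0) (single e) i j k
    have h3 := sum_mul_single (degLE 3) (fun e => F e.1 e.2.1 e.2.2) i j k
    rw [if_pos (mem_degLE.2 (by show i + j + k ≤ 3; omega))] at h3
    calc _ = ∑ e ∈ Lam51, V e.1 e.2.1 e.2.2 * (fundamentalU K e (i + 2) j k
              + fundamentalU K e i (j + 2) k + fundamentalU K e i j (k + 2)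
              + lowerOrder K (fundamentalU K e) i j k)
            + ∑ e ∈ degLE 3, F e.1 e.2.1 e.2.2 * (fundamentalF K e (i + 2) j k
              + fundamentalF K e i (j + 2) k + fundamentalF K e i j (k + 2)
              + lowerOrder K (fundamentalF K e) i j k) := by
          simp only [mul_add, Finset.sum_add_distrib]
          ring
      _ = _ := by
          simp only [h1, h2, mul_zero, Finset.sum_const_zero, zero_add]
          exact h3
  · have h1 : ∀ e, fundamentalU K e i j k = single e i j k := by
      intro e
      interval_cases i
      · exact eliminate_zero _ _ _ _ _
      · exact eliminate_one _ _ _ _ _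
    have h2 : ∀ e, fundamentalF K e i j k = 0 := by
      intro e
      interval_cases i
      · exact eliminate_zero _ _ _ _ _
      · exact eliminate_one _ _ _ _ _
    have h3 := sum_mul_single Lam51 (fun e => V e.1 e.2.1 e.2.2) i j k
    rw [if_pos (mem_Lam51.2 ⟨hi, h⟩)] at h3
    simp only [h1, h2, mul_zero, Finset.sum_const_zero, add_zero]
    exact h3

lemma eliminate_linear (K : CoeffJets S) (x : S) (U F : ℕ → ℕ → ℕ → S) (m n q : ℕ) :
    eliminate K (fun i j k => x * U i j k) (fun i j k => x * F i j k) m n q =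
      x * eliminate K U F m n q := by
  symm
  refine eq_eliminate (V := fun i j k => x * eliminate K U F i j k) (m + n + q)
    (fun i j k _ => ?_) (fun i j k hi _ => ?_) m n q le_rfl
  · have h := lowerOrder_sum {()} K (fun _ => x) (fun _ => eliminate K U F) i j k
    simp only [Finset.sum_singleton] at h
    have h2 := solvesJet_eliminate K U F i j k
    unfold SolvesJet at h2 ⊢
    rw [h]
    linear_combination x * h2
  · interval_cases i
    · simp only [eliminate_zero]
    · simp only [eliminate_one]

/-! ### Stretching of space, parity, and the Poisson limit -/

/-- The coefficient jets after the change of variables that stretches space by `h⁻¹`. -/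
def CoeffJets.scale (h : S) (K : CoeffJets S) : CoeffJets S where
  a i j k := h ^ (i + j + k + 1) * K.a i j k
  b i j k := h ^ (i + j + k + 1) * K.b i j k
  c i j k := h ^ (i + j + k + 1) * K.c i j k
  d i j k := h ^ (i + j + k + 2) * K.d i j k

lemma leibniz_scale (h : S) (w g : ℕ → ℕ → ℕ → S) (s t m n q : ℕ) :
    leibniz (fun i j k => h ^ (i + j + k + s) * w i j k)
      (fun i j k => h ^ (i + j + k + t) * g i j k) m n q =
      h ^ (m + n + q + s + t) * leibniz w g m n q := by
  simp only [leibniz, Finset.mul_sum]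
  refine Finset.sum_congr rfl fun i hi => Finset.sum_congr rfl fun j hj =>
    Finset.sum_congr rfl fun k hk => ?_
  simp only [Finset.mem_range] at hi hj hk
  have : m + n + q + s + t = (i + j + k + s) + (m - i + (n - j) + (q - k) + t) := by omega
  rw [this, pow_add]
  ring

lemma lowerOrder_scale (h : S) (K : CoeffJets S) (V : ℕ → ℕ → ℕ → S) (m n q : ℕ) :
    lowerOrder (K.scale h) (fun i j k => h ^ (i + j + k) * V i j k) m n q =
      h ^ (m + n + q + 2) * lowerOrder K V m n q := by
  have h1 := leibniz_scale h K.a (fun i j k => V (i + 1) j k) 1 1 m n q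
  have h2 := leibniz_scale h K.b (fun i j k => V i (j + 1) k) 1 1 m n q
  have h3 := leibniz_scale h K.c (fun i j k => V i j (k + 1)) 1 1 m n q
  have h4 := leibniz_scale h K.d V 2 0 m n q
  have e1 : (fun i j k => h ^ (i + 1 + j + k) * V (i + 1) j k) =
      fun i j k => h ^ (i + j + k + 1) * V (i + 1) j k := by
    funext i j k; congr 2; omega
  have e2 : (fun i j k => h ^ (i + (j + 1) + k) * V i (j + 1) k) =
      fun i j k => h ^ (i + j + k + 1) * V i (j + 1) k := by
    funext i j k; congr 2; omega
  simp only [add_zero] at h4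
  simp only [lowerOrder, CoeffJets.scale, mul_add]
  rw [e1, e2]
  exact congrArg₂ _ (congrArg₂ _ (congrArg₂ _ h1 h2) h3) h4

lemma SolvesJet.scale {K : CoeffJets S} {V F : ℕ → ℕ → ℕ → S} {m n q : ℕ} (h : S)
    (hV : SolvesJet K V F m n q) :
    SolvesJet (K.scale h) (fun i j k => h ^ (i + j + k) * V i j k)
      (fun i j k => h ^ (i + j + k + 2) * F i j k) m n q := by
  unfold SolvesJet at hV ⊢
  rw [lowerOrder_scale]
  linear_combination h ^ (m + n + q + 2) * hV

lemma eliminate_scale (h : S) (K : CoeffJets S) (U F : ℕ → ℕ → ℕ → S) (m n q : ℕ) :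
    eliminate (K.scale h) (fun i j k => h ^ (i + j + k) * U i j k)
      (fun i j k => h ^ (i + j + k + 2) * F i j k) m n q =
      h ^ (m + n + q) * eliminate K U F m n q := by
  symm
  refine eq_eliminate (V := fun i j k => h ^ (i + j + k) * eliminate K U F i j k) (m + n + q)
    (fun i j k _ => (solvesJet_eliminate K U F i j k).scale h) (fun i j k hi _ => ?_) m n q le_rfl
  interval_cases i
  · simp only [eliminate_zero]
  · simp only [eliminate_one]

/-- Both sides are eliminations for the stretched equation with the same data. The powers of `h`
stand on both sides because `h` need not be invertible in `S`. -/
lemma fundamentalU_scale (h : S) (K : CoeffJets S) (e : ℕ × ℕ × ℕ) (m n q : ℕ) :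
    h ^ (e.1 + e.2.1 + e.2.2) * fundamentalU (K.scale h) e m n q =
      h ^ (m + n + q) * fundamentalU K e m n q := by
  unfold fundamentalU
  rw [← eliminate_scale, ← eliminate_linear]
  congr 1
  · funext i j k
    unfold single
    split_ifs with H
    · obtain ⟨rfl, rfl, rfl⟩ := H; rfl
    · simp
  · funext i j k
    simp

lemma fundamentalF_scale (h : S) (K : CoeffJets S) (e : ℕ × ℕ × ℕ) (m n q : ℕ) :
    h ^ (e.1 + e.2.1 + e.2.2 + 2) * fundamentalF (K.scale h) e m n q =
      h ^ (m + n + q) * fundamentalF K e m n q := by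
  unfold fundamentalF
  rw [← eliminate_scale, ← eliminate_linear]
  congr 1
  · funext i j k
    simp
  · funext i j k
    unfold single
    split_ifs with H
    · obtain ⟨rfl, rfl, rfl⟩ := H; rfl
    · simp

/-- The number of coordinates in which two indices differ in parity. -/
def parityDist (e : ℕ × ℕ × ℕ) (m n q : ℕ) : ℕ :=
  (m + e.1) % 2 + (n + e.2.1) % 2 + (q + e.2.2) % 2

lemma dvd_leibniz {h : S} {w g : ℕ → ℕ → ℕ → S} {m n q N : ℕ} {s t : ℕ → ℕ → ℕ → ℕ}
    (hw : ∀ i j k, h ^ s i j k ∣ w i j k)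
    (hg : ∀ i j k, i ≤ m → h ^ t i j k ∣ g i j k)
    (hN : ∀ i j k, i ≤ m → j ≤ n → k ≤ q → N ≤ s i j k + t (m - i) (n - j) (q - k)) :
    h ^ N ∣ leibniz w g m n q := by
  unfold leibniz
  refine Finset.dvd_sum fun i hi => Finset.dvd_sum fun j hj => Finset.dvd_sum fun k hk => ?_
  simp only [Finset.mem_range] at hi hj hk
  refine Dvd.dvd.mul_left ?_ _
  refine (pow_dvd_pow h (hN i j k (by omega) (by omega) (by omega))).trans ?_
  rw [pow_add]
  exact mul_dvd_mul (hw _ _ _) (hg _ _ _ (Nat.sub_le _ _))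

/-- Every change of parity costs one power of the mesh size. -/
lemma pow_parityDist_dvd {h : S} {K : CoeffJets S}
    (ha : ∀ i j k, h ^ (i + j + k + 1) ∣ K.a i j k) (hb : ∀ i j k, h ^ (i + j + k + 1) ∣ K.b i j k)
    (hc : ∀ i j k, h ^ (i + j + k + 1) ∣ K.c i j k) (hd : ∀ i j k, h ^ (i + j + k + 1) ∣ K.d i j k)
    (e : ℕ × ℕ × ℕ) (m n q : ℕ) : h ^ parityDist e m n q ∣ fundamentalU K e m n q := by
  have hs : ∀ m n q, h ^ parityDist e m n q ∣ single e m n q := by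
    intro m n q
    unfold single
    split_ifs with H
    · obtain ⟨rfl, rfl, rfl⟩ := H
      have : parityDist e e.1 e.2.1 e.2.2 = 0 := by unfold parityDist; omega
      simp [this]
    · exact dvd_zero _
  induction m using Nat.strong_induction_on generalizing n q with
  | _ m ih =>
    match m, ih with
    | 0, _ =>
      have := hs 0 n q
      rwa [← eliminate_zero K (single e) (fun _ _ _ => 0) n q] at this
    | 1, _ =>
      have := hs 1 n q
      rwa [← eliminate_one K (single e) (fun _ _ _ => 0) n q] at this
    | m + 2, ih =>
      -- The two Laplacian terms shift exponents by two and change no parity. In a lower-order term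
      -- at most one parity changes through the first derivative, and at most `i + j + k` more
      -- through the derivatives that fall on the coefficient; the factor `h ^ (i + j + k + 1)` pays
      -- for all of them.
      have e1 : parityDist e (m + 2) n q = parityDist e m (n + 2) q := by
        unfold parityDist; omega
      have e2 : parityDist e (m + 2) n q = parityDist e m n (q + 2) := by
        unfold parityDist; omega
      unfold fundamentalU at ih ⊢
      rw [eliminate_add_two]
      refine dvd_sub (dvd_sub (dvd_sub (dvd_zero _) ?_) ?_) ?_
      · rw [e1]; exact ih m (by omega) _ _
      · rw [e2]; exact ih m (by omega) _ _
      · unfold lowerOrder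
        refine dvd_add (dvd_add (dvd_add ?_ ?_) ?_) ?_
        · exact dvd_leibniz ha (t := fun i j k => parityDist e (i + 1) j k)
            (fun i j k hi => ih _ (by omega) _ _)
            (fun i j k hi hj hk => by unfold parityDist; omega)
        · exact dvd_leibniz hb (t := fun i j k => parityDist e i (j + 1) k)
            (fun i j k hi => ih _ (by omega) _ _)
            (fun i j k hi hj hk => by unfold parityDist; omega)
        · exact dvd_leibniz hc (t := fun i j k => parityDist e i j (k + 1))
            (fun i j k hi => ih _ (by omega) _ _)
            (fun i j k hi hj hk => by unfold parityDist; omega)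
        · exact dvd_leibniz hd (t := fun i j k => parityDist e i j k)
            (fun i j k hi => ih _ (by omega) _ _)
            (fun i j k hi hj hk => by unfold parityDist; omega)

/-- The elimination for the Poisson equation `Δv = f`. -/
def poisson (U F : ℕ → ℕ → ℕ → S) : ℕ → ℕ → ℕ → S
  | 0, n, q => U 0 n q
  | 1, n, q => U 1 n q
  | m + 2, n, q => F m n q - poisson U F m (n + 2) q - poisson U F m n (q + 2)

lemma eliminate_eq_poisson {K : CoeffJets S} (ha : ∀ i j k, K.a i j k = 0)
    (hb : ∀ i j k, K.b i j k = 0) (hc : ∀ i j k, K.c i j k = 0) (hd : ∀ i j k, K.d i j k = 0)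
    (U F : ℕ → ℕ → ℕ → S) (m n q : ℕ) : eliminate K U F m n q = poisson U F m n q := by
  symm
  refine eq_eliminate (m + n + q) (fun i j k _ => ?_) (fun i j k hi _ => ?_) m n q le_rfl
  · have : lowerOrder K (poisson U F) i j k = 0 := by
      simp [lowerOrder, leibniz, ha, hb, hc, hd]
    unfold SolvesJet
    rw [this, poisson]
    ring
  · interval_cases i
    · rw [poisson]
    · rw [poisson]

lemma map_poisson (φ : S →+* R) (U F : ℕ → ℕ → ℕ → S) (m n q : ℕ) :
    φ (poisson U F m n q) =
      poisson (fun i j k => φ (U i j k)) (fun i j k => φ (F i j k)) m n q := by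
  induction m using Nat.strong_induction_on generalizing n q with
  | _ m ih =>
    match m, ih with
    | 0, _ => simp only [poisson]
    | 1, _ => simp only [poisson]
    | m + 2, ih => simp only [poisson, map_sub, ih m (by omega)]

end Elimination

/-! ### Linear functionals on stencils -/

lemma sum_sign {M : Type*} [AddCommMonoid M] (φ : SignType → M) :
    ∑ i : SignType, φ i = φ (-1) + φ 0 + φ 1 := by
  have : (Finset.univ : Finset SignType) = {-1, 0, 1} := by decide
  rw [this, Finset.sum_insert (by decide), Finset.sum_insert (by decide), Finset.sum_singleton,
    add_assoc]

lemma sum_degLE_five {M : Type*} [AddCommMonoid M] (φ : ℕ × ℕ × ℕ → M) :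
    ∑ f ∈ degLE 5, φ f = ∑ a ∈ Finset.range 6, ∑ b ∈ Finset.range (6 - a),
      ∑ c ∈ Finset.range (6 - a - b), φ (a, b, c) := by
  simp [degLE, Finset.sum_filter, Finset.sum_product, Finset.sum_range_succ]

/-- The Taylor weight of the derivative of index `f` at the stencil point `(i, j, k)`. -/
def taylorWeight (f : ℕ × ℕ × ℕ) (i j k : SignType) : ℝ :=
  (i : ℝ) ^ f.1 * (j : ℝ) ^ f.2.1 * (k : ℝ) ^ f.2.2
    / ((f.1.factorial * f.2.1.factorial * f.2.2.factorial : ℕ) : ℝ)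

/-- The harmonic polynomial whose derivatives of order at most one in `x` vanish at the origin,
but for that of index `e`, which is `1`. -/
def harmonic (e : ℕ × ℕ × ℕ) (i j k : SignType) : ℝ :=
  ∑ f ∈ degLE 5, taylorWeight f i j k * poisson (single e) (fun _ _ _ => 0) f.1 f.2.1 f.2.2

set_option maxHeartbeats 4000000 in
-- These are all the indices of `Lam51` of degree at most four. Those of degree five constrain only
-- the coefficient of `h ^ 0`, where parity settles them without explicit formulas.
lemma harmonic_eq (i j k : SignType) :
    harmonic (0, 0, 0) i j k = 1 ∧
    harmonic (0, 0, 1) i j k = (k : ℝ) ∧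
    harmonic (0, 0, 2) i j k = -(i : ℝ) ^ 2 / 2 + (k : ℝ) ^ 2 / 2 ∧
    harmonic (0, 0, 3) i j k = -(i : ℝ) ^ 2 * (k : ℝ) / 2 + (k : ℝ) ^ 3 / 6 ∧
    harmonic (0, 0, 4) i j k = (i : ℝ) ^ 4 / 24 - (i : ℝ) ^ 2 * (k : ℝ) ^ 2 / 4 + (k : ℝ) ^ 4 / 24 ∧
    harmonic (0, 1, 0) i j k = (j : ℝ) ∧
    harmonic (0, 1, 1) i j k = (j : ℝ) * (k : ℝ) ∧
    harmonic (0, 1, 2) i j k = -(i : ℝ) ^ 2 * (j : ℝ) / 2 + (j : ℝ) * (k : ℝ) ^ 2 / 2 ∧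
    harmonic (0, 1, 3) i j k = -(i : ℝ) ^ 2 * (j : ℝ) * (k : ℝ) / 2 + (j : ℝ) * (k : ℝ) ^ 3 / 6 ∧
    harmonic (0, 2, 0) i j k = -(i : ℝ) ^ 2 / 2 + (j : ℝ) ^ 2 / 2 ∧
    harmonic (0, 2, 1) i j k = -(i : ℝ) ^ 2 * (k : ℝ) / 2 + (j : ℝ) ^ 2 * (k : ℝ) / 2 ∧
    harmonic (0, 2, 2) i j k = 2 * (i : ℝ) ^ 4 / 24 - (i : ℝ) ^ 2 * (j : ℝ) ^ 2 / 4 - (i : ℝ) ^ 2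
      * (k : ℝ) ^ 2 / 4 + (j : ℝ) ^ 2 * (k : ℝ) ^ 2 / 4 ∧
    harmonic (0, 3, 0) i j k = -(i : ℝ) ^ 2 * (j : ℝ) / 2 + (j : ℝ) ^ 3 / 6 ∧
    harmonic (0, 3, 1) i j k = -(i : ℝ) ^ 2 * (j : ℝ) * (k : ℝ) / 2 + (j : ℝ) ^ 3 * (k : ℝ) / 6 ∧
    harmonic (0, 4, 0) i j k = (i : ℝ) ^ 4 / 24 - (i : ℝ) ^ 2 * (j : ℝ) ^ 2 / 4 + (j : ℝ) ^ 4 / 24 ∧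
    harmonic (1, 0, 0) i j k = (i : ℝ) ∧
    harmonic (1, 0, 1) i j k = (i : ℝ) * (k : ℝ) ∧
    harmonic (1, 0, 2) i j k = -(i : ℝ) ^ 3 / 6 + (i : ℝ) * (k : ℝ) ^ 2 / 2 ∧
    harmonic (1, 0, 3) i j k = -(i : ℝ) ^ 3 * (k : ℝ) / 6 + (i : ℝ) * (k : ℝ) ^ 3 / 6 ∧
    harmonic (1, 1, 0) i j k = (i : ℝ) * (j : ℝ) ∧
    harmonic (1, 1, 1) i j k = (i : ℝ) * (j : ℝ) * (k : ℝ) ∧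
    harmonic (1, 1, 2) i j k = -(i : ℝ) ^ 3 * (j : ℝ) / 6 + (i : ℝ) * (j : ℝ) * (k : ℝ) ^ 2 / 2 ∧
    harmonic (1, 2, 0) i j k = -(i : ℝ) ^ 3 / 6 + (i : ℝ) * (j : ℝ) ^ 2 / 2 ∧
    harmonic (1, 2, 1) i j k = -(i : ℝ) ^ 3 * (k : ℝ) / 6 + (i : ℝ) * (j : ℝ) ^ 2 * (k : ℝ) / 2 ∧
    harmonic (1, 3, 0) i j k = -(i : ℝ) ^ 3 * (j : ℝ) / 6 + (i : ℝ) * (j : ℝ) ^ 3 / 6 := by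
  refine ⟨?_, ?_, ?_, ?_, ?_, ?_, ?_, ?_, ?_, ?_, ?_, ?_, ?_, ?_, ?_, ?_, ?_, ?_, ?_, ?_, ?_, ?_, ?_,
    ?_, ?_⟩
  all_goals
    simp [harmonic, sum_degLE_five, Finset.sum_range_succ, poisson, single, taylorWeight,
      Nat.factorial]
  all_goals ring

/-- The value of a weight on a stencil with coefficients in an `ℝ`-module. -/
def pairing {A : Type*} [AddCommGroup A] [Module ℝ A] (w : SignType → SignType → SignType → ℝ)
    (x : SignType → SignType → SignType → A) : A :=
  ∑ i, ∑ j, ∑ k, w i j k • x i j k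

/-- The least power of the mesh size that is absent from the stencil coefficient. -/
def threshold : SignType → SignType → SignType → ℕ
  | .neg, .neg, .zero => 6
  | .neg, .zero, .neg => 5
  | .neg, .zero, .zero => 5
  | .neg, .zero, .pos => 4
  | .neg, .pos, .zero => 4
  | .zero, .neg, .neg => 5
  | .zero, .neg, .zero => 4
  | .zero, .neg, .pos => 3
  | .zero, .zero, .neg => 4
  | .zero, .zero, .zero => 4
  | .zero, .zero, .pos => 3
  | .zero, .pos, .neg => 3
  | .zero, .pos, .zero => 3
  | .zero, .pos, .pos => 2
  | .pos, .neg, .zero => 3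
  | .pos, .zero, .neg => 3
  | .pos, .zero, .zero => 2
  | .pos, .zero, .pos => 2
  | .pos, .pos, .zero => 1
  | _, _, _ => 0

/-- Indices of harmonic polynomials that are independent on the stencil. -/
def independentIndices : Finset (ℕ × ℕ × ℕ) :=
  {(0, 0, 0), (0, 0, 1), (0, 0, 2), (0, 0, 3), (0, 0, 4), (0, 1, 0), (0, 1, 1), (0, 1, 2),
    (0, 2, 0), (0, 2, 1), (0, 2, 2), (0, 3, 0), (0, 4, 0), (1, 0, 0), (1, 0, 1), (1, 0, 2),
    (1, 1, 0), (1, 2, 0)}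

/-- The independent indices of degree at most `N`. -/
def indicesLE (N : ℕ) : Finset (ℕ × ℕ × ℕ) :=
  independentIndices.filter (fun e => e.1 + e.2.1 + e.2.2 ≤ N)

lemma corner_eq_zero {A : Type*} [Zero A] {x : SignType → SignType → SignType → A} {p : ℕ}
    (hx : ∀ i j k, threshold i j k ≤ p → x i j k = 0) :
    x (-1) (-1) (-1) = 0 ∧ x (-1) (-1) 1 = 0 ∧ x (-1) 1 (-1) = 0 ∧ x (-1) 1 1 = 0 ∧
      x 1 (-1) (-1) = 0 ∧ x 1 (-1) 1 = 0 ∧ x 1 1 (-1) = 0 ∧ x 1 1 1 = 0 := by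
  refine ⟨?_, ?_, ?_, ?_, ?_, ?_, ?_, ?_⟩ <;>
    exact hx _ _ _ ((by decide : _ ≤ 0).trans p.zero_le)


/-- Without corners and centre, eighteen unknowns face eighteen independent harmonic polynomials. If
the centre were free, the multiples of the 19-point Laplacian would survive. -/
lemma eq_zero_of_level_0 {x : SignType → SignType → SignType → ℝ}
    (hx : ∀ i j k, threshold i j k ≤ 0 → x i j k = 0) (h0 : x 0 0 0 = 0)
    (h : ∀ e ∈ indicesLE 5, pairing (harmonic e) x = 0) (i j k : SignType) : x i j k = 0 := by
  have hc := corner_eq_zero hx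
  have e000 := h (0, 0, 0) (by decide)
  have e001 := h (0, 0, 1) (by decide)
  have e002 := h (0, 0, 2) (by decide)
  have e003 := h (0, 0, 3) (by decide)
  have e004 := h (0, 0, 4) (by decide)
  have e010 := h (0, 1, 0) (by decide)
  have e011 := h (0, 1, 1) (by decide)
  have e012 := h (0, 1, 2) (by decide)
  have e020 := h (0, 2, 0) (by decide)
  have e021 := h (0, 2, 1) (by decide)
  have e022 := h (0, 2, 2) (by decide)
  have e030 := h (0, 3, 0) (by decide)
  have e040 := h (0, 4, 0) (by decide)
  have e100 := h (1, 0, 0) (by decide)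
  have e101 := h (1, 0, 1) (by decide)
  have e102 := h (1, 0, 2) (by decide)
  have e110 := h (1, 1, 0) (by decide)
  have e120 := h (1, 2, 0) (by decide)
  simp [pairing, harmonic_eq, sum_sign, hc, h0]
    at e000 e001 e002 e003 e004 e010 e011 e012 e020 e021 e022 e030 e040 e100 e101 e102 e110 e120
  cases i <;> cases j <;> cases k
  all_goals first | (exact hx _ _ _ (by decide)) | skip
  all_goals simp only [SignType.neg_eq_neg_one, SignType.zero_eq_zero, SignType.pos_eq_one]
  · exact h0
  -- The coefficients are the rows of the inverse of the square matrix of the system; likewise at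
  -- the next two levels.
  · linear_combination 1/12 * e000 - 1/6 * e001 + 5/9 * e002 - 2 * e003 + 10/3 * e004 - 5/18 *
      e020 + e021 - 5/3 * e022 + 4/3 * e040
  · linear_combination 1/12 * e000 + 1/6 * e001 + 5/9 * e002 + 2 * e003 + 10/3 * e004 - 5/18 *
      e020 - e021 - 5/3 * e022 + 4/3 * e040
  · linear_combination 1/12 * e000 - 5/18 * e002 + 4/3 * e004 - 1/6 * e010 + e012 + 5/9 * e020 -
      5/3 * e022 - 2 * e030 + 10/3 * e040
  · linear_combination 1/24 * e000 - 1/12 * e001 + 1/36 * e002 + 1/2 * e003 - 4/3 * e004 - 1/12 *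
      e010 + 1/4 * e011 - 1/2 * e012 + 1/36 * e020 - 1/2 * e021 + 7/6 * e022 + 1/2 * e030 - 4/3 *
      e040
  · linear_combination 1/24 * e000 + 1/12 * e001 + 1/36 * e002 - 1/2 * e003 - 4/3 * e004 - 1/12 *
      e010 - 1/4 * e011 - 1/2 * e012 + 1/36 * e020 + 1/2 * e021 + 7/6 * e022 + 1/2 * e030 - 4/3 *
      e040
  · linear_combination 1/12 * e000 - 5/18 * e002 + 4/3 * e004 + 1/6 * e010 - e012 + 5/9 * e020 -
      5/3 * e022 + 2 * e030 + 10/3 * e040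
  · linear_combination 1/24 * e000 - 1/12 * e001 + 1/36 * e002 + 1/2 * e003 - 4/3 * e004 + 1/12 *
      e010 - 1/4 * e011 + 1/2 * e012 + 1/36 * e020 - 1/2 * e021 + 7/6 * e022 - 1/2 * e030 - 4/3 *
      e040
  · linear_combination 1/24 * e000 + 1/12 * e001 + 1/36 * e002 - 1/2 * e003 - 4/3 * e004 + 1/12 *
      e010 + 1/4 * e011 + 1/2 * e012 + 1/36 * e020 + 1/2 * e021 + 7/6 * e022 - 1/2 * e030 - 4/3 *
      e040
  · linear_combination 1/12 * e000 - 5/18 * e002 + 4/3 * e004 - 5/18 * e020 + 1/3 * e022 + 4/3 *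
      e040 - 1/6 * e100 + e102 + e120
  · linear_combination 1/24 * e000 - 1/12 * e001 + 1/36 * e002 + 1/2 * e003 - 4/3 * e004 - 1/18 *
      e020 + 1/6 * e022 - 1/3 * e040 - 1/12 * e100 + 1/4 * e101 - 1/2 * e102
  · linear_combination 1/24 * e000 + 1/12 * e001 + 1/36 * e002 - 1/2 * e003 - 4/3 * e004 - 1/18 *
      e020 + 1/6 * e022 - 1/3 * e040 - 1/12 * e100 - 1/4 * e101 - 1/2 * e102
  · linear_combination 1/24 * e000 - 1/18 * e002 - 1/3 * e004 - 1/12 * e010 + 1/36 * e020 + 1/6 *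
      e022 + 1/2 * e030 - 4/3 * e040 - 1/12 * e100 + 1/4 * e110 - 1/2 * e120
  · linear_combination 1/24 * e000 - 1/18 * e002 - 1/3 * e004 + 1/12 * e010 + 1/36 * e020 + 1/6 *
      e022 - 1/2 * e030 - 4/3 * e040 - 1/12 * e100 - 1/4 * e110 - 1/2 * e120
  · linear_combination 1/12 * e000 - 5/18 * e002 + 4/3 * e004 - 5/18 * e020 + 1/3 * e022 + 4/3 *
      e040 + 1/6 * e100 - e102 - e120
  · linear_combination 1/24 * e000 - 1/12 * e001 + 1/36 * e002 + 1/2 * e003 - 4/3 * e004 - 1/18 *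
      e020 + 1/6 * e022 - 1/3 * e040 + 1/12 * e100 - 1/4 * e101 + 1/2 * e102
  · linear_combination 1/24 * e000 + 1/12 * e001 + 1/36 * e002 - 1/2 * e003 - 4/3 * e004 - 1/18 *
      e020 + 1/6 * e022 - 1/3 * e040 + 1/12 * e100 + 1/4 * e101 + 1/2 * e102
  · linear_combination 1/24 * e000 - 1/18 * e002 - 1/3 * e004 - 1/12 * e010 + 1/36 * e020 + 1/6 *
      e022 + 1/2 * e030 - 4/3 * e040 + 1/12 * e100 - 1/4 * e110 + 1/2 * e120
  · linear_combination 1/24 * e000 - 1/18 * e002 - 1/3 * e004 + 1/12 * e010 + 1/36 * e020 + 1/6 *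
      e022 - 1/2 * e030 - 4/3 * e040 + 1/12 * e100 + 1/4 * e110 + 1/2 * e120

/-- At levels `1` to `5` there remain `18, 15, 9, 4, 1` unknowns, which are the numbers of
independent indices of degree at most `4, 3, 2, 1, 0`. The prescribed zeros are chosen to make each
system square and invertible; unlike at level zero, the centre needs no separate condition. -/
lemma eq_zero_of_level_1 {x : SignType → SignType → SignType → ℝ}
    (hx : ∀ i j k, threshold i j k ≤ 1 → x i j k = 0)
    (h : ∀ e ∈ indicesLE 4, pairing (harmonic e) x = 0) (i j k : SignType) : x i j k = 0 := by
  have hc := corner_eq_zero hx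
  have z221 := hx 1 1 0 (by decide)
  have e000 := h (0, 0, 0) (by decide)
  have e001 := h (0, 0, 1) (by decide)
  have e002 := h (0, 0, 2) (by decide)
  have e003 := h (0, 0, 3) (by decide)
  have e004 := h (0, 0, 4) (by decide)
  have e010 := h (0, 1, 0) (by decide)
  have e011 := h (0, 1, 1) (by decide)
  have e012 := h (0, 1, 2) (by decide)
  have e020 := h (0, 2, 0) (by decide)
  have e021 := h (0, 2, 1) (by decide)
  have e022 := h (0, 2, 2) (by decide)
  have e030 := h (0, 3, 0) (by decide)
  have e040 := h (0, 4, 0) (by decide)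
  have e100 := h (1, 0, 0) (by decide)
  have e101 := h (1, 0, 1) (by decide)
  have e102 := h (1, 0, 2) (by decide)
  have e110 := h (1, 1, 0) (by decide)
  have e120 := h (1, 2, 0) (by decide)
  simp [pairing, harmonic_eq, sum_sign, hc, z221]
    at e000 e001 e002 e003 e004 e010 e011 e012 e020 e021 e022 e030 e040 e100 e101 e102 e110 e120
  cases i <;> cases j <;> cases k
  all_goals first | (exact hx _ _ _ (by decide)) | skip
  all_goals simp only [SignType.neg_eq_neg_one, SignType.zero_eq_zero, SignType.pos_eq_one]
  · linear_combination e000 - 4/3 * e002 - 8 * e004 + 2 * e010 + 2/3 * e020 + 4 * e022 - 12 * e030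
      - 32 * e040 + 2 * e100 + 6 * e110 + 12 * e120
  · linear_combination -1/6 * e001 + 2/3 * e002 - 2 * e003 + 4 * e004 - 1/6 * e010 - 1/3 * e020 +
      e021 - 2 * e022 + e030 + 4 * e040 - 1/6 * e100 - 1/2 * e110 - e120
  · linear_combination 1/6 * e001 + 2/3 * e002 + 2 * e003 + 4 * e004 - 1/6 * e010 - 1/3 * e020 -
      e021 - 2 * e022 + e030 + 4 * e040 - 1/6 * e100 - 1/2 * e110 - e120
  · linear_combination -1/6 * e002 + 2 * e004 - 1/3 * e010 + e012 + 1/2 * e020 - 2 * e022 - e030 +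
      6 * e040 - 1/6 * e100 - 1/2 * e110 - e120
  · linear_combination -1/12 * e001 + 1/12 * e002 + 1/2 * e003 - e004 - 1/6 * e010 + 1/4 * e011 -
      1/2 * e012 - 1/2 * e021 + e022 + e030 - 1/12 * e100 - 1/4 * e110 - 1/2 * e120
  · linear_combination 1/12 * e001 + 1/12 * e002 - 1/2 * e003 - e004 - 1/6 * e010 - 1/4 * e011 -
      1/2 * e012 + 1/2 * e021 + e022 + e030 - 1/12 * e100 - 1/4 * e110 - 1/2 * e120
  · linear_combination -1/6 * e002 + 2 * e004 - e012 + 1/2 * e020 - 2 * e022 + 3 * e030 + 6 * e040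
      - 1/6 * e100 - 1/2 * e110 - e120
  · linear_combination -1/12 * e001 + 1/12 * e002 + 1/2 * e003 - e004 - 1/4 * e011 + 1/2 * e012 -
      1/2 * e021 + e022 - 1/12 * e100 - 1/4 * e110 - 1/2 * e120
  · linear_combination 1/12 * e001 + 1/12 * e002 - 1/2 * e003 - e004 + 1/4 * e011 + 1/2 * e012 +
      1/2 * e021 + e022 - 1/12 * e100 - 1/4 * e110 - 1/2 * e120
  · linear_combination -1/6 * e002 + 2 * e004 - 1/6 * e010 - 1/3 * e020 + e030 + 4 * e040 - 1/3 *
      e100 + e102 - 1/2 * e110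
  · linear_combination -1/12 * e001 + 1/12 * e002 + 1/2 * e003 - e004 - 1/12 * e010 - 1/12 * e020
      + 1/2 * e030 + e040 - 1/6 * e100 + 1/4 * e101 - 1/2 * e102 - 1/4 * e110 - 1/2 * e120
  · linear_combination 1/12 * e001 + 1/12 * e002 - 1/2 * e003 - e004 - 1/12 * e010 - 1/12 * e020 +
      1/2 * e030 + e040 - 1/6 * e100 - 1/4 * e101 - 1/2 * e102 - 1/4 * e110 - 1/2 * e120
  · linear_combination -1/6 * e010 + e030 - 1/6 * e100 - e120
  · linear_combination -1/6 * e100 - 1/2 * e110 - e120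
  · linear_combination -1/6 * e002 + 2 * e004 - 1/6 * e010 - 1/3 * e020 + e030 + 4 * e040 - e102 -
      1/2 * e110 - 2 * e120
  · linear_combination -1/12 * e001 + 1/12 * e002 + 1/2 * e003 - e004 - 1/12 * e010 - 1/12 * e020
      + 1/2 * e030 + e040 - 1/4 * e101 + 1/2 * e102 - 1/4 * e110 - 1/2 * e120
  · linear_combination 1/12 * e001 + 1/12 * e002 - 1/2 * e003 - e004 - 1/12 * e010 - 1/12 * e020 +
      1/2 * e030 + e040 + 1/4 * e101 + 1/2 * e102 - 1/4 * e110 - 1/2 * e120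
  · linear_combination -1/6 * e010 + e030 - 1/2 * e110

lemma eq_zero_of_level_2 {x : SignType → SignType → SignType → ℝ}
    (hx : ∀ i j k, threshold i j k ≤ 2 → x i j k = 0)
    (h : ∀ e ∈ indicesLE 3, pairing (harmonic e) x = 0) (i j k : SignType) : x i j k = 0 := by
  have hc := corner_eq_zero hx
  have z122 := hx 0 1 1 (by decide)
  have z211 := hx 1 0 0 (by decide)
  have z212 := hx 1 0 1 (by decide)
  have z221 := hx 1 1 0 (by decide)
  have e000 := h (0, 0, 0) (by decide)
  have e001 := h (0, 0, 1) (by decide)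
  have e002 := h (0, 0, 2) (by decide)
  have e003 := h (0, 0, 3) (by decide)
  have e010 := h (0, 1, 0) (by decide)
  have e011 := h (0, 1, 1) (by decide)
  have e012 := h (0, 1, 2) (by decide)
  have e020 := h (0, 2, 0) (by decide)
  have e021 := h (0, 2, 1) (by decide)
  have e030 := h (0, 3, 0) (by decide)
  have e100 := h (1, 0, 0) (by decide)
  have e101 := h (1, 0, 1) (by decide)
  have e102 := h (1, 0, 2) (by decide)
  have e110 := h (1, 1, 0) (by decide)
  have e120 := h (1, 2, 0) (by decide)
  simp [pairing, harmonic_eq, sum_sign, hc, z122, z211, z212, z221]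
    at e000 e001 e002 e003 e010 e011 e012 e020 e021 e030 e100 e101 e102 e110 e120
  cases i <;> cases j <;> cases k
  all_goals first | (exact hx _ _ _ (by decide)) | skip
  all_goals simp only [SignType.neg_eq_neg_one, SignType.zero_eq_zero, SignType.pos_eq_one]
  · linear_combination e000 + 1/3 * e001 - 2 * e002 - 2 * e003 + 1/3 * e010 - e011 - 2 * e012 - 2
      * e020 - 2 * e021 - 2 * e030 + 7/3 * e100 + 2 * e101 - 2 * e102 + 2 * e110 - 2 * e120
  · linear_combination e002 - 3 * e003 + 1/2 * e011 + e012 + 2 * e021 - 1/3 * e100 + e102 - 1/2 *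
      e110
  · linear_combination 1/3 * e001 + e002 + e003 + 1/2 * e011 + e012 - 1/3 * e100 + e102 - 1/2 *
      e110
  · linear_combination 1/2 * e011 + 2 * e012 + e020 + e021 - 3 * e030 - 1/3 * e100 - 1/2 * e101 +
      e120
  · linear_combination -1/6 * e001 + e003 - 1/6 * e010 - e012 - e021 + e030
  · linear_combination -1/6 * e010 - 1/2 * e011 - e012 + e030
  · linear_combination 1/3 * e010 + 1/2 * e011 + e020 + e021 + e030 - 1/3 * e100 - 1/2 * e101 +
      e120
  · linear_combination -1/6 * e001 + e003 - 1/2 * e011 - e021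
  · linear_combination -1/3 * e100 + 2 * e102 + 2 * e120
  · linear_combination -1/6 * e001 + e003 - 1/6 * e100 - e102
  · linear_combination -1/6 * e100 - 1/2 * e101 - e102
  · linear_combination -1/6 * e010 + e030 - 1/6 * e100 - e120
  · linear_combination -1/6 * e100 - 1/2 * e110 - e120
  · linear_combination -1/6 * e001 + e003 - 1/2 * e101
  · linear_combination -1/6 * e010 + e030 - 1/2 * e110

lemma eq_zero_of_level_3 {x : SignType → SignType → SignType → ℝ}
    (hx : ∀ i j k, threshold i j k ≤ 3 → x i j k = 0)
    (h : ∀ e ∈ indicesLE 2, pairing (harmonic e) x = 0) (i j k : SignType) : x i j k = 0 := by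
  have hc := corner_eq_zero hx
  have z102 := hx 0 (-1) 1 (by decide)
  have z112 := hx 0 0 1 (by decide)
  have z120 := hx 0 1 (-1) (by decide)
  have z121 := hx 0 1 0 (by decide)
  have z122 := hx 0 1 1 (by decide)
  have z201 := hx 1 (-1) 0 (by decide)
  have z210 := hx 1 0 (-1) (by decide)
  have z211 := hx 1 0 0 (by decide)
  have z212 := hx 1 0 1 (by decide)
  have z221 := hx 1 1 0 (by decide)
  have e000 := h (0, 0, 0) (by decide)
  have e001 := h (0, 0, 1) (by decide)
  have e002 := h (0, 0, 2) (by decide)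
  have e010 := h (0, 1, 0) (by decide)
  have e011 := h (0, 1, 1) (by decide)
  have e020 := h (0, 2, 0) (by decide)
  have e100 := h (1, 0, 0) (by decide)
  have e101 := h (1, 0, 1) (by decide)
  have e110 := h (1, 1, 0) (by decide)
  simp [pairing, harmonic_eq, sum_sign, hc, z102, z112, z120, z121, z122, z201, z210, z211, z212,
    z221]
    at e000 e001 e002 e010 e011 e020 e100 e101 e110
  cases i <;> cases j <;> cases k
  all_goals first | (exact hx _ _ _ (by decide)) | skip
  all_goals simp only [SignType.neg_eq_neg_one, SignType.zero_eq_zero, SignType.pos_eq_one]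
  all_goals linarith

lemma eq_zero_of_level_4 {x : SignType → SignType → SignType → ℝ}
    (hx : ∀ i j k, threshold i j k ≤ 4 → x i j k = 0)
    (h : ∀ e ∈ indicesLE 1, pairing (harmonic e) x = 0) (i j k : SignType) : x i j k = 0 := by
  have hc := corner_eq_zero hx
  have z012 := hx (-1) 0 1 (by decide)
  have z021 := hx (-1) 1 0 (by decide)
  have z101 := hx 0 (-1) 0 (by decide)
  have z102 := hx 0 (-1) 1 (by decide)
  have z110 := hx 0 0 (-1) (by decide)
  have z111 := hx 0 0 0 (by decide)
  have z112 := hx 0 0 1 (by decide)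
  have z120 := hx 0 1 (-1) (by decide)
  have z121 := hx 0 1 0 (by decide)
  have z122 := hx 0 1 1 (by decide)
  have z201 := hx 1 (-1) 0 (by decide)
  have z210 := hx 1 0 (-1) (by decide)
  have z211 := hx 1 0 0 (by decide)
  have z212 := hx 1 0 1 (by decide)
  have z221 := hx 1 1 0 (by decide)
  have e000 := h (0, 0, 0) (by decide)
  have e001 := h (0, 0, 1) (by decide)
  have e010 := h (0, 1, 0) (by decide)
  have e100 := h (1, 0, 0) (by decide)
  simp [pairing, harmonic_eq, sum_sign, hc, z012, z021, z101, z102, z110, z111, z112, z120, z121,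
    z122, z201, z210, z211, z212, z221]
    at e000 e001 e010 e100
  cases i <;> cases j <;> cases k
  all_goals first | (exact hx _ _ _ (by decide)) | skip
  all_goals simp only [SignType.neg_eq_neg_one, SignType.zero_eq_zero]
  all_goals linarith

lemma eq_zero_of_level_5 {x : SignType → SignType → SignType → ℝ}
    (hx : ∀ i j k, threshold i j k ≤ 5 → x i j k = 0)
    (h : ∀ e ∈ indicesLE 0, pairing (harmonic e) x = 0) (i j k : SignType) : x i j k = 0 := by
  have hc := corner_eq_zero hx
  have z010 := hx (-1) 0 (-1) (by decide)
  have z011 := hx (-1) 0 0 (by decide)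
  have z012 := hx (-1) 0 1 (by decide)
  have z021 := hx (-1) 1 0 (by decide)
  have z100 := hx 0 (-1) (-1) (by decide)
  have z101 := hx 0 (-1) 0 (by decide)
  have z102 := hx 0 (-1) 1 (by decide)
  have z110 := hx 0 0 (-1) (by decide)
  have z111 := hx 0 0 0 (by decide)
  have z112 := hx 0 0 1 (by decide)
  have z120 := hx 0 1 (-1) (by decide)
  have z121 := hx 0 1 0 (by decide)
  have z122 := hx 0 1 1 (by decide)
  have z201 := hx 1 (-1) 0 (by decide)
  have z210 := hx 1 0 (-1) (by decide)
  have z211 := hx 1 0 0 (by decide)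
  have z212 := hx 1 0 1 (by decide)
  have z221 := hx 1 1 0 (by decide)
  have e000 := h (0, 0, 0) (by decide)
  simp [pairing, harmonic_eq, sum_sign, hc, z010, z011, z012, z021, z100, z101, z102, z110, z111,
    z112, z120, z121, z122, z201, z210, z211, z212, z221]
    at e000
  cases i <;> cases j <;> cases k
  all_goals first | (exact hx _ _ _ (by decide)) | skip
  all_goals simp only [SignType.neg_eq_neg_one, SignType.zero_eq_zero]
  all_goals linarith

/-! ### Solvability of a single layer -/

section Solve

variable {A B : Type*} [AddCommGroup A] [Module ℝ A] [AddCommGroup B] [Module ℝ B]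

lemma map_pairing (φ : A →ₗ[ℝ] B) (w : SignType → SignType → SignType → ℝ)
    (x : SignType → SignType → SignType → A) :
    φ (pairing w x) = pairing w (fun i j k => φ (x i j k)) := by
  simp only [pairing, map_sum, map_smul]

lemma eq_zero_of_level {p : ℕ} (h1 : 1 ≤ p) (h5 : p ≤ 5)
    {x : SignType → SignType → SignType → ℝ} (hx : ∀ i j k, threshold i j k ≤ p → x i j k = 0)
    (h : ∀ e ∈ indicesLE (5 - p), pairing (harmonic e) x = 0) (i j k : SignType) :
    x i j k = 0 := by
  interval_cases p
  · exact eq_zero_of_level_1 hx h i j k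
  · exact eq_zero_of_level_2 hx h i j k
  · exact eq_zero_of_level_3 hx h i j k
  · exact eq_zero_of_level_4 hx h i j k
  · exact eq_zero_of_level_5 hx h i j k

/-- The values of the functionals and of the coefficients that are required to vanish. -/
def levelMap (p : ℕ) : (SignType → SignType → SignType → ℝ) →ₗ[ℝ]
    ({s : SignType × SignType × SignType // threshold s.1 s.2.1 s.2.2 ≤ p} ⊕
      indicesLE (5 - p) → ℝ) where
  toFun x := Sum.elim (fun s => x s.1.1 s.1.2.1 s.1.2.2) (fun e => pairing (harmonic e.1) x)
  map_add' x y := by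
    funext s
    rcases s with s | e
    · rfl
    · simp [pairing, mul_add, Finset.sum_add_distrib]
  map_smul' r x := by
    funext s
    rcases s with s | e
    · rfl
    · simp [pairing, Finset.mul_sum, mul_left_comm]

/-- Both spaces have dimension 27, so injectivity suffices. At `p = 0` the target would have
dimension 26 only, which is why that level is treated by hand. -/
lemma levelMap_surjective {p : ℕ} (h1 : 1 ≤ p) (h5 : p ≤ 5) :
    Function.Surjective (levelMap p) := by
  rw [← LinearMap.injective_iff_surjective_of_finrank_eq_finrank]
  · rw [← LinearMap.ker_eq_bot, LinearMap.ker_eq_bot']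
    intro x hx
    funext i j k
    refine eq_zero_of_level h1 h5 (fun i j k h => ?_) (fun e he => ?_) i j k
    · exact congrFun hx (Sum.inl ⟨(i, j, k), h⟩)
    · exact congrFun hx (Sum.inr ⟨e, he⟩)
  · simp only [Module.finrank_pi_fintype, Module.finrank_self, Finset.sum_const, smul_eq_mul,
      mul_one, Finset.card_univ]
    interval_cases p <;> decide

/-- A dual family of real stencils solves the system for unit right-hand sides; combining it with
coefficients in `A` solves it for values in any `ℝ`-module. In particular, bounded data yield
bounded solutions. -/
lemma exists_level_solution {p : ℕ} (h1 : 1 ≤ p) (h5 : p ≤ 5) (R : ℕ × ℕ × ℕ → A) :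
    ∃ x : SignType → SignType → SignType → A, (∀ i j k, threshold i j k ≤ p → x i j k = 0) ∧
      ∀ e ∈ indicesLE (5 - p), pairing (harmonic e) x = R e := by
  choose y hy using fun e : indicesLE (5 - p) =>
    levelMap_surjective h1 h5 (Sum.elim (fun _ => 0) (fun e' => if e' = e then 1 else 0))
  refine ⟨fun i j k => ∑ e, y e i j k • R e.1, fun i j k h => ?_, fun e he => ?_⟩
  · refine Finset.sum_eq_zero fun e _ => ?_
    have := congrFun (hy e) (Sum.inl ⟨(i, j, k), h⟩)
    have h0 : y e i j k = 0 := this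
    rw [h0, zero_smul]
  · have h0 : ∀ e', pairing (harmonic e) (y e') = if ⟨e, he⟩ = e' then 1 else 0 :=
      fun e' => congrFun (hy e') (Sum.inr ⟨e, he⟩)
    have : pairing (harmonic e) (fun i j k => ∑ e', y e' i j k • R e'.1) =
        ∑ e', pairing (harmonic e) (y e') • R e'.1 := by
      simp only [pairing, Finset.smul_sum, Finset.sum_smul, smul_eq_mul, mul_smul]
      conv_rhs => rw [Finset.sum_comm]
      refine Finset.sum_congr rfl fun i _ => ?_
      conv_rhs => rw [Finset.sum_comm]
      refine Finset.sum_congr rfl fun j _ => ?_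
      conv_rhs => rw [Finset.sum_comm]
    rw [this]
    simp [h0]

end Solve

/-! ### The stencil conditions after rescaling, over an arbitrary `ℝ`-algebra -/

section Scaled

open Polynomial

variable {A B : Type*} [CommRing A] [Algebra ℝ A] [CommRing B] [Algebra ℝ B]

/-- The jets of the coefficients `a, b, c` and `d = d₁ / h + d₂`. -/
structure SplitJets (A : Type*) where
  a : ℕ → ℕ → ℕ → A
  b : ℕ → ℕ → ℕ → A
  c : ℕ → ℕ → ℕ → A
  d₁ : ℕ → ℕ → ℕ → A
  d₂ : ℕ → ℕ → ℕ → A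

/-- The jets of the coefficients of the equation in the variables stretched by `h⁻¹`, as
polynomials in `h`. -/
def SplitJets.scaled (Θ : SplitJets A) : CoeffJets A[X] where
  a i j k := X ^ (i + j + k + 1) * C (Θ.a i j k)
  b i j k := X ^ (i + j + k + 1) * C (Θ.b i j k)
  c i j k := X ^ (i + j + k + 1) * C (Θ.c i j k)
  d i j k := X ^ (i + j + k + 1) * (C (Θ.d₁ i j k) + X * C (Θ.d₂ i j k))

/-- The value at a stencil point of the Taylor polynomial with the given derivatives. -/
def expansion {S : Type*} [CommRing S] [Algebra ℝ S] (V : ℕ → ℕ → ℕ → S) (i j k : SignType) : S :=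
  ∑ f ∈ degLE 5, taylorWeight f i j k • V f.1 f.2.1 f.2.2

/-- The polynomial in `h` with the coefficients of a stencil. -/
def stencilPoly (c : SignType → SignType → SignType → Fin 6 → A) (i j k : SignType) : A[X] :=
  ∑ p : Fin 6, C (c i j k p) * X ^ (p : ℕ)

/-- The stencil applied to the Taylor polynomial with the given derivatives. -/
def stencilSum (c : SignType → SignType → SignType → Fin 6 → A) (V : ℕ → ℕ → ℕ → A[X]) : A[X] :=
  ∑ i, ∑ j, ∑ k, stencilPoly c i j k * expansion V i j k

/-- The contribution to the coefficient of `h ^ (s + t)` of the layer `x` of a stencil, that of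
`h ^ s`. -/
def layerCoeff (x : SignType → SignType → SignType → A) (V : ℕ → ℕ → ℕ → A[X]) (t : ℕ) : A :=
  ∑ f ∈ degLE 5, (V f.1 f.2.1 f.2.2).coeff t * pairing (taylorWeight f) x

lemma coeff_stencilSum (c : SignType → SignType → SignType → Fin 6 → A)
    (V : ℕ → ℕ → ℕ → A[X]) (s : ℕ) :
    (stencilSum c V).coeff s =
      ∑ p : Fin 6, if (p : ℕ) ≤ s then layerCoeff (fun i j k => c i j k p) V (s - p) else 0 := by
  have h1 : ∀ i j k, (stencilPoly c i j k * expansion V i j k).coeff s =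
      ∑ p : Fin 6, if (p : ℕ) ≤ s then c i j k p * (expansion V i j k).coeff (s - p) else 0 := by
    intro i j k
    simp only [stencilPoly, Finset.sum_mul, finsetSum_coeff, mul_assoc, coeff_C_mul,
      coeff_X_pow_mul', mul_ite, mul_zero]
  simp only [stencilSum, finsetSum_coeff, h1]
  have h2 : ∀ p : Fin 6, (if (p : ℕ) ≤ s then layerCoeff (fun i j k => c i j k p) V (s - p) else 0)
      = ∑ i, ∑ j, ∑ k,
        if (p : ℕ) ≤ s then c i j k p * (expansion V i j k).coeff (s - p) else 0 := by
    intro p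
    split_ifs
    · simp only [layerCoeff, pairing, expansion, finsetSum_coeff, coeff_smul, Finset.mul_sum]
      rw [Finset.sum_comm]
      refine Finset.sum_congr rfl fun i _ => ?_
      rw [Finset.sum_comm]
      refine Finset.sum_congr rfl fun j _ => ?_
      rw [Finset.sum_comm]
      refine Finset.sum_congr rfl fun k _ => Finset.sum_congr rfl fun f _ => ?_
      rw [mul_smul_comm, mul_smul_comm, mul_comm]
    · simp
  simp only [h2]
  conv_rhs => rw [Finset.sum_comm]
  refine Finset.sum_congr rfl fun i _ => ?_
  conv_rhs => rw [Finset.sum_comm]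
  refine Finset.sum_congr rfl fun j _ => ?_
  conv_rhs => rw [Finset.sum_comm]

/-- Every stretched coefficient is divisible by `h`, so setting `h = 0` leaves Poisson's equation.
-/
lemma coeff_zero_fundamentalU (Θ : SplitJets A) (e : ℕ × ℕ × ℕ) (m n q : ℕ) :
    (fundamentalU Θ.scaled e m n q).coeff 0 =
      algebraMap ℝ A (poisson (single e) (fun _ _ _ => 0) m n q) := by
  rw [← constantCoeff_apply, fundamentalU, map_eliminate, eliminate_eq_poisson, map_poisson]
  · simp only [map_single, map_zero]
  all_goals simp [CoeffJets.map, SplitJets.scaled]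

lemma coeff_zero_fundamentalF (Θ : SplitJets A) (e : ℕ × ℕ × ℕ) (m n q : ℕ) :
    (fundamentalF Θ.scaled e m n q).coeff 0 =
      algebraMap ℝ A (poisson (fun _ _ _ => 0) (single e) m n q) := by
  rw [← constantCoeff_apply, fundamentalF, map_eliminate, eliminate_eq_poisson, map_poisson]
  · simp only [map_single, map_zero]
  all_goals simp [CoeffJets.map, SplitJets.scaled]

lemma sum_algebraMap_mul_pairing {ι : Type*} (s : Finset ι) (r : ι → ℝ)
    (w : ι → SignType → SignType → SignType → ℝ) (x : SignType → SignType → SignType → A) :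
    ∑ f ∈ s, algebraMap ℝ A (r f) * pairing (w f) x =
      pairing (fun i j k => ∑ f ∈ s, w f i j k * r f) x := by
  simp only [pairing, Finset.mul_sum, Finset.sum_smul]
  rw [Finset.sum_comm]
  refine Finset.sum_congr rfl fun i _ => ?_
  rw [Finset.sum_comm]
  refine Finset.sum_congr rfl fun j _ => ?_
  rw [Finset.sum_comm]
  refine Finset.sum_congr rfl fun k _ => Finset.sum_congr rfl fun f _ => ?_
  rw [← Algebra.smul_def, smul_smul, mul_comm]

/-- This is the diagonal block of the triangular system; it does not depend on the coefficients of
the equation. -/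
lemma layerCoeff_zero (Θ : SplitJets A) (e : ℕ × ℕ × ℕ)
    (x : SignType → SignType → SignType → A) :
    layerCoeff x (fundamentalU Θ.scaled e) 0 = pairing (harmonic e) x := by
  simp only [layerCoeff, coeff_zero_fundamentalU]
  exact sum_algebraMap_mul_pairing _ _ taylorWeight x

/-- Derivatives whose parities differ from those of `e` in more than `t` places contribute nothing
to `h ^ t`, so only the listed moments need to vanish. -/
lemma layerCoeff_eq_zero (Θ : SplitJets A) (e : ℕ × ℕ × ℕ) (t : ℕ)
    {x : SignType → SignType → SignType → A}
    (hx : ∀ f, parityDist e f.1 f.2.1 f.2.2 ≤ t → pairing (taylorWeight f) x = 0) :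
    layerCoeff x (fundamentalU Θ.scaled e) t = 0 := by
  refine Finset.sum_eq_zero fun f _ => ?_
  by_cases h : parityDist e f.1 f.2.1 f.2.2 ≤ t
  · rw [hx f h, mul_zero]
  · have hd : (X : A[X]) ^ parityDist e f.1 f.2.1 f.2.2 ∣
        fundamentalU Θ.scaled e f.1 f.2.1 f.2.2 :=
      pow_parityDist_dvd (fun _ _ _ => dvd_mul_right _ _) (fun _ _ _ => dvd_mul_right _ _)
        (fun _ _ _ => dvd_mul_right _ _) (fun _ _ _ => dvd_mul_right _ _) e _ _ _
    rw [X_pow_dvd_iff.1 hd t (by omega), zero_mul]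

/-- The coefficients of the standard 19-point discretization of the Laplacian. -/
def laplaceWeight : SignType → SignType → SignType → ℝ
  | .zero, .zero, .zero => -4
  | .zero, .zero, _ => 1 / 3
  | .zero, _, .zero => 1 / 3
  | _, .zero, .zero => 1 / 3
  | .zero, _, _ => 1 / 6
  | _, .zero, _ => 1 / 6
  | _, _, .zero => 1 / 6
  | _, _, _ => 0

/-- The layer of order zero of the stencil. -/
def laplaceLayer (i j k : SignType) : A := algebraMap ℝ A (laplaceWeight i j k)

lemma pairing_laplaceLayer (w : SignType → SignType → SignType → ℝ) :
    pairing w (laplaceLayer (A := A)) = algebraMap ℝ A (pairing w laplaceWeight) :=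
  (map_pairing (Algebra.linearMap ℝ A) w laplaceWeight).symm

lemma laplaceWeight_values :
    laplaceWeight (-1) (-1) (-1) = 0 ∧ laplaceWeight (-1) (-1) 0 = 1 / 6 ∧
    laplaceWeight (-1) (-1) 1 = 0 ∧ laplaceWeight (-1) 0 (-1) = 1 / 6 ∧
    laplaceWeight (-1) 0 0 = 1 / 3 ∧ laplaceWeight (-1) 0 1 = 1 / 6 ∧
    laplaceWeight (-1) 1 (-1) = 0 ∧ laplaceWeight (-1) 1 0 = 1 / 6 ∧
    laplaceWeight (-1) 1 1 = 0 ∧ laplaceWeight 0 (-1) (-1) = 1 / 6 ∧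
    laplaceWeight 0 (-1) 0 = 1 / 3 ∧ laplaceWeight 0 (-1) 1 = 1 / 6 ∧
    laplaceWeight 0 0 (-1) = 1 / 3 ∧ laplaceWeight 0 0 0 = -4 ∧
    laplaceWeight 0 0 1 = 1 / 3 ∧ laplaceWeight 0 1 (-1) = 1 / 6 ∧
    laplaceWeight 0 1 0 = 1 / 3 ∧ laplaceWeight 0 1 1 = 1 / 6 ∧
    laplaceWeight 1 (-1) (-1) = 0 ∧ laplaceWeight 1 (-1) 0 = 1 / 6 ∧
    laplaceWeight 1 (-1) 1 = 0 ∧ laplaceWeight 1 0 (-1) = 1 / 6 ∧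
    laplaceWeight 1 0 0 = 1 / 3 ∧ laplaceWeight 1 0 1 = 1 / 6 ∧
    laplaceWeight 1 1 (-1) = 0 ∧ laplaceWeight 1 1 0 = 1 / 6 ∧
    laplaceWeight 1 1 1 = 0 := by
  refine ⟨?_, ?_, ?_, ?_, ?_, ?_, ?_, ?_, ?_, ?_, ?_, ?_, ?_, ?_, ?_, ?_, ?_, ?_, ?_, ?_, ?_, ?_, ?_,
    ?_, ?_, ?_, ?_⟩ <;> rfl

/-- The weights are invariant under reversing the sign of each coordinate. -/
lemma pairing_taylorWeight_laplaceWeight {f : ℕ × ℕ × ℕ}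
    (hf : f.1 % 2 = 1 ∨ f.2.1 % 2 = 1 ∨ f.2.2 % 2 = 1) :
    pairing (taylorWeight f) laplaceWeight = 0 := by
  simp only [pairing, sum_sign, laplaceWeight_values, taylorWeight, smul_eq_mul]
  rcases hf with h | h | h <;>
  · have h1 := (Nat.odd_iff.2 h).neg_one_pow (α := ℝ)
    have h0 : (0 : ℝ) ^ _ = 0 := zero_pow (Nat.odd_iff.2 h).pos.ne'
    simp only [SignType.coe_neg_one, SignType.coe_zero, SignType.coe_one, h1, h0]
    ring

/-- An index with three even exponents is as far from `e` in parity as the origin, hence too far to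
contribute to `h ^ t`; the others have vanishing moments. -/
lemma layerCoeff_laplaceLayer_eq_zero (Θ : SplitJets A) {e : ℕ × ℕ × ℕ} {t : ℕ}
    (ht : t < parityDist e 0 0 0) :
    layerCoeff laplaceLayer (fundamentalU Θ.scaled e) t = 0 := by
  refine layerCoeff_eq_zero Θ e t fun f hf => ?_
  rw [pairing_laplaceLayer, pairing_taylorWeight_laplaceWeight, map_zero]
  unfold parityDist at ht hf
  omega

/-- These are the indices of `Lam51` with only even exponents, the ones that the symmetry does not
dispose of. -/
lemma pairing_harmonic_laplaceWeight {e : ℕ × ℕ × ℕ}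
    (he : e ∈ ({(0, 0, 0), (0, 0, 2), (0, 2, 0), (0, 0, 4), (0, 2, 2), (0, 4, 0)} :
      Finset (ℕ × ℕ × ℕ))) : pairing (harmonic e) laplaceWeight = 0 := by
  simp only [Finset.mem_insert, Finset.mem_singleton] at he
  rcases he with rfl | rfl | rfl | rfl | rfl | rfl <;>
    norm_num [pairing, sum_sign, laplaceWeight_values, harmonic_eq]

lemma layerCoeff_zero_laplaceLayer (Θ : SplitJets A) {e : ℕ × ℕ × ℕ} (he : e ∈ Lam51) :
    layerCoeff laplaceLayer (fundamentalU Θ.scaled e) 0 = 0 := by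
  by_cases h : 0 < parityDist e 0 0 0
  · exact layerCoeff_laplaceLayer_eq_zero Θ h
  · rw [layerCoeff_zero, pairing_laplaceLayer, pairing_harmonic_laplaceWeight, map_zero]
    obtain ⟨m, n, q⟩ := e
    simp only [mem_Lam51, parityDist] at he h
    have hm : m = 0 := by omega
    have hn : n = 0 ∨ n = 2 ∨ n = 4 := by omega
    have hq : q = 0 ∨ q = 2 ∨ q = 4 := by omega
    subst hm
    rcases hn with rfl | rfl | rfl <;> rcases hq with rfl | rfl | rfl <;> simp at he ⊢

/-- The solution of `Δv = 1` with vanishing data on `x = 0` is `x² / 2`. -/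
lemma expansion_poisson_source (i j k : SignType) :
    ∑ f ∈ degLE 5, taylorWeight f i j k *
      poisson (fun _ _ _ => 0) (single (0, 0, 0)) f.1 f.2.1 f.2.2 = (i : ℝ) ^ 2 / 2 := by
  simp [sum_degLE_five, Finset.sum_range_succ, poisson, single, taylorWeight, Nat.factorial]

lemma layerCoeff_source (Θ : SplitJets A) :
    layerCoeff laplaceLayer (fundamentalF Θ.scaled (0, 0, 0)) 0 = 1 := by
  simp only [layerCoeff, coeff_zero_fundamentalF]
  rw [sum_algebraMap_mul_pairing _ _ taylorWeight]
  simp only [expansion_poisson_source]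
  rw [pairing_laplaceLayer, ← map_one (algebraMap ℝ A)]
  congr 1
  -- Half the sum of the weights with `i ≠ 0` is `(2 · 1/3 + 8 · 1/6) / 2 = 1`.
  norm_num [pairing, sum_sign, laplaceWeight_values]

/-- The functionals at which a dependent harmonic polynomial can be evaluated instead. -/
lemma pairing_harmonic_dependent {x : SignType → SignType → SignType → A} {p : ℕ}
    (hx : ∀ i j k, threshold i j k ≤ p → x i j k = 0) :
    pairing (harmonic (1, 1, 1)) x = 0 ∧
    pairing (harmonic (1, 3, 0)) x = 0 ∧
    pairing (harmonic (1, 0, 3)) x = 0 ∧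
    pairing (harmonic (1, 1, 2)) x = (-1 / 6 : ℝ) • pairing (harmonic (1, 1, 0)) x ∧
    pairing (harmonic (1, 2, 1)) x = (-1 / 6 : ℝ) • pairing (harmonic (1, 0, 1)) x ∧
    pairing (harmonic (0, 1, 3)) x = (1 / 6 : ℝ) • pairing (harmonic (0, 1, 1)) x ∧
    pairing (harmonic (0, 3, 1)) x = (1 / 6 : ℝ) • pairing (harmonic (0, 1, 1)) x := by
  have hc := corner_eq_zero hx
  -- Away from the corners a product of three nonzero powers of the coordinates vanishes, and `s ^ 3
  -- = s` for a sign `s`.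
  refine ⟨?_, ?_, ?_, ?_, ?_, ?_, ?_⟩ <;> simp [pairing, sum_sign, harmonic_eq, hc] <;> module

lemma sign_pow_odd (i : SignType) {m : ℕ} (hm : m % 2 = 1) : (i : ℝ) ^ m = i := by
  have h := Nat.odd_iff.2 hm
  cases i
  · simp [h.pos.ne']
  · simp [h.neg_one_pow]
  · simp

lemma taylorWeight_eq_zero {f : ℕ × ℕ × ℕ} (h1 : f.1 ≠ 0) (h2 : f.2.1 ≠ 0) (h3 : f.2.2 ≠ 0)
    {i j k : SignType} (h : i = 0 ∨ j = 0 ∨ k = 0) : taylorWeight f i j k = 0 := by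
  unfold taylorWeight
  rcases h with rfl | rfl | rfl <;> simp [h1, h2, h3]

lemma threshold_corner {i j k : SignType} (h : ¬(i = 0 ∨ j = 0 ∨ k = 0)) :
    threshold i j k = 0 := by
  revert h
  cases i <;> cases j <;> cases k <;> decide

/-- The moments with two odd exponents are multiples of those of `xy`, `xz` and `yz`. -/
lemma pairing_taylorWeight_eq_zero {x : SignType → SignType → SignType → A} {p : ℕ}
    (hx : ∀ i j k, threshold i j k ≤ p → x i j k = 0)
    (hxy : pairing (harmonic (1, 1, 0)) x = 0) (hxz : pairing (harmonic (1, 0, 1)) x = 0)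
    (hyz : pairing (harmonic (0, 1, 1)) x = 0) {f : ℕ × ℕ × ℕ}
    (hf : parityDist (1, 1, 1) f.1 f.2.1 f.2.2 ≤ 1) : pairing (taylorWeight f) x = 0 := by
  have key : ∀ (w : SignType → SignType → SignType → ℝ) (r : ℝ), pairing w x = 0 →
      (∀ i j k, taylorWeight f i j k = r * w i j k) → pairing (taylorWeight f) x = 0 := by
    intro w r hw h
    have : pairing (taylorWeight f) x = r • pairing w x := by
      simp only [pairing, Finset.smul_sum, h, mul_smul]
    rw [this, hw, smul_zero]
  -- The hypothesis means that at least two exponents are odd. If none is zero, the monomial lives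
  -- on the corners; otherwise the zero exponent is the even one, and on signs the monomial equals
  -- `xy`, `xz` or `yz`.
  by_cases h : f.1 ≠ 0 ∧ f.2.1 ≠ 0 ∧ f.2.2 ≠ 0
  · refine Finset.sum_eq_zero fun i _ => Finset.sum_eq_zero fun j _ =>
      Finset.sum_eq_zero fun k _ => ?_
    by_cases h0 : i = 0 ∨ j = 0 ∨ k = 0
    · rw [taylorWeight_eq_zero h.1 h.2.1 h.2.2 h0, zero_smul]
    · rw [hx i j k (by rw [threshold_corner h0]; exact Nat.zero_le _), smul_zero]
  · unfold parityDist at hf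
    set r : ℝ := 1 / ((f.1.factorial * f.2.1.factorial * f.2.2.factorial : ℕ) : ℝ) with hr
    have hcases : (f.1 % 2 = 1 ∧ f.2.1 % 2 = 1 ∧ f.2.2 = 0) ∨
        (f.1 % 2 = 1 ∧ f.2.1 = 0 ∧ f.2.2 % 2 = 1) ∨ (f.1 = 0 ∧ f.2.1 % 2 = 1 ∧ f.2.2 % 2 = 1) := by
      simp only at hf
      omega
    rcases hcases with ⟨h1, h2, h3⟩ | ⟨h1, h2, h3⟩ | ⟨h1, h2, h3⟩
    · refine key _ r hxy fun i j k => ?_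
      simp only [harmonic_eq, taylorWeight, sign_pow_odd _ h1, sign_pow_odd _ h2, h3, pow_zero, hr]
      ring
    · refine key _ r hxz fun i j k => ?_
      simp only [harmonic_eq, taylorWeight, sign_pow_odd _ h1, sign_pow_odd _ h3, h2, pow_zero, hr]
      ring
    · refine key _ r hyz fun i j k => ?_
      simp only [harmonic_eq, taylorWeight, sign_pow_odd _ h2, sign_pow_odd _ h3, h1, pow_zero, hr]
      ring

end Scaled

/-! ### Existence and uniqueness of the stretched stencil -/

section Existence

open Polynomial

variable {A B : Type*} [CommRing A] [Algebra ℝ A] [CommRing B] [Algebra ℝ B]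

/-- The conditions on the stencil in the variables stretched by `h⁻¹`. -/
structure ScaledAdmissible (c : SignType → SignType → SignType → Fin 6 → A) (Θ : SplitJets A) :
    Prop where
  order : ∀ e ∈ Lam51, ∀ s, s + (e.1 + e.2.1 + e.2.2) < 6 →
    (stencilSum c (fundamentalU Θ.scaled e)).coeff s = 0
  source : (stencilSum c (fundamentalF Θ.scaled (0, 0, 0))).coeff 0 = 1
  center : c 0 0 0 0 = -4
  vanish : ∀ i j k (p : Fin 6), threshold i j k ≤ (p : ℕ) → c i j k p = 0

/-- Of the 25 conditions of degree at most four, 18 are solved for and seven are surplus. Each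
surplus index has at least two odd exponents, which is what makes the compatibility argument work.
-/
lemma mem_indicesLE_or {e : ℕ × ℕ × ℕ} {N : ℕ} (he : e ∈ Lam51) (h4 : N ≤ 4)
    (hN : e.1 + e.2.1 + e.2.2 ≤ N) : e ∈ indicesLE N ∨
      e ∈ ({(1, 1, 1), (1, 3, 0), (1, 0, 3), (1, 1, 2), (1, 2, 1), (0, 1, 3), (0, 3, 1)} :
        Finset (ℕ × ℕ × ℕ)) := by
  obtain ⟨m, n, q⟩ := e
  rw [mem_Lam51] at he
  simp only at he hN
  have hm : m ≤ 1 := he.1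
  have hn : n ≤ 4 := by omega
  have hq : q ≤ 4 := by omega
  simp only [indicesLE, Finset.mem_filter, hN, and_true]
  interval_cases m <;> interval_cases n <;> interval_cases q <;>
    first
    | (left; decide)
    | (right; decide)
    | omega

/-- The stencil with given layers. -/
def ofLayers (x₀ x₁ x₂ x₃ x₄ x₅ : SignType → SignType → SignType → A) (i j k : SignType) :
    Fin 6 → A :=
  ![x₀ i j k, x₁ i j k, x₂ i j k, x₃ i j k, x₄ i j k, x₅ i j k]

/-- The layers are found successively: each cancels, at the independent indices, what its
predecessors contribute to its power of `h`. What needs proof is that the surplus conditions then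
hold as well; they occur only for the powers `0`, `1` and `2`. -/
theorem exists_scaledAdmissible (Θ : SplitJets A) : ∃ c, ScaledAdmissible c Θ := by
  set V := fun e => fundamentalU Θ.scaled e with hV
  set x₀ : SignType → SignType → SignType → A := laplaceLayer with hx₀
  obtain ⟨x₁, z₁, h₁⟩ := exists_level_solution (p := 1) le_rfl (by norm_num)
    (fun e => -layerCoeff x₀ (V e) 1)
  obtain ⟨x₂, z₂, h₂⟩ := exists_level_solution (p := 2) (by norm_num) (by norm_num)
    (fun e => -(layerCoeff x₀ (V e) 2 + layerCoeff x₁ (V e) 1))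
  obtain ⟨x₃, z₃, h₃⟩ := exists_level_solution (p := 3) (by norm_num) (by norm_num)
    (fun e => -(layerCoeff x₀ (V e) 3 + layerCoeff x₁ (V e) 2 + layerCoeff x₂ (V e) 1))
  obtain ⟨x₄, z₄, h₄⟩ := exists_level_solution (p := 4) (by norm_num) (by norm_num)
    (fun e => -(layerCoeff x₀ (V e) 4 + layerCoeff x₁ (V e) 3 + layerCoeff x₂ (V e) 2
      + layerCoeff x₃ (V e) 1))
  obtain ⟨x₅, z₅, h₅⟩ := exists_level_solution (p := 5) (by norm_num) (by norm_num)
    (fun e => -(layerCoeff x₀ (V e) 5 + layerCoeff x₁ (V e) 4 + layerCoeff x₂ (V e) 3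
      + layerCoeff x₃ (V e) 2 + layerCoeff x₄ (V e) 1))
  have hzero : ∀ e ∈ Lam51, layerCoeff x₀ (V e) 0 = 0 :=
    fun e he => layerCoeff_zero_laplaceLayer Θ he
  have hodd : ∀ e t, t < parityDist e 0 0 0 → layerCoeff x₀ (V e) t = 0 :=
    fun e t h => layerCoeff_laplaceLayer_eq_zero Θ h
  -- `parityDist e 0 0 0` counts the odd exponents of `e`. With two or more of them, layer zero
  -- contributes nothing to `h ^ 1`, so the corresponding moment of layer one is zero.
  have hval : ∀ e ∈ indicesLE 4, 1 < parityDist e 0 0 0 → pairing (harmonic e) x₁ = 0 :=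
    fun e he h => by rw [h₁ e he, hodd e 1 h, neg_zero]
  have hxy := hval (1, 1, 0) (by decide) (by decide)
  have hxz := hval (1, 0, 1) (by decide) (by decide)
  have hyz := hval (0, 1, 1) (by decide) (by decide)
  have level₁ : ∀ e ∈ Lam51, e.1 + e.2.1 + e.2.2 ≤ 4 →
      layerCoeff x₀ (V e) 1 + pairing (harmonic e) x₁ = 0 := by
    intro e he h4
    rcases mem_indicesLE_or he le_rfl h4 with h | h
    · rw [h₁ e h]; ring
    -- At a surplus index the moment of layer one is zero or a multiple of that of `xy`, `xz` or
    -- `yz`, which vanishes too.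
    · obtain ⟨d1, d2, d3, d4, d5, d6, d7⟩ := pairing_harmonic_dependent z₁
      simp only [Finset.mem_insert, Finset.mem_singleton] at h
      rcases h with rfl | rfl | rfl | rfl | rfl | rfl | rfl <;>
        rw [hodd _ 1 (by decide), zero_add]
      · exact d1
      · exact d2
      · exact d3
      · rw [d4, hxy, smul_zero]
      · rw [d5, hxz, smul_zero]
      · rw [d6, hyz, smul_zero]
      · rw [d7, hyz, smul_zero]
  have level₂ : ∀ e ∈ Lam51, e.1 + e.2.1 + e.2.2 ≤ 3 →
      layerCoeff x₀ (V e) 2 + layerCoeff x₁ (V e) 1 + pairing (harmonic e) x₂ = 0 := by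
    intro e he h3
    rcases mem_indicesLE_or he (by norm_num) h3 with h | h
    · rw [h₂ e h]; ring
    -- The only surplus index of degree at most three. Layer zero drops out by its three odd
    -- exponents, layer one because its moments with at least two odd exponents vanish.
    · have h111 : e = (1, 1, 1) := by
        simp only [Finset.mem_insert, Finset.mem_singleton] at h
        rcases h with rfl | rfl | rfl | rfl | rfl | rfl | rfl <;> simp at h3 ⊢
      subst h111
      rw [hodd _ 2 (by decide), (pairing_harmonic_dependent z₂).1,
        layerCoeff_eq_zero Θ _ 1 fun f hf => pairing_taylorWeight_eq_zero z₁ hxy hxz hyz hf]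
      simp
  -- Every surplus index has degree at least three, so nothing is left to check for the last three
  -- layers.
  have hind : ∀ e ∈ Lam51, ∀ N ≤ 2, e.1 + e.2.1 + e.2.2 ≤ N → e ∈ indicesLE N := by
    intro e he N hN h
    rcases mem_indicesLE_or he (by omega) h with h' | h'
    · exact h'
    · exfalso
      simp only [Finset.mem_insert, Finset.mem_singleton] at h'
      rcases h' with rfl | rfl | rfl | rfl | rfl | rfl | rfl <;> simp at h <;> omega
  refine ⟨ofLayers x₀ x₁ x₂ x₃ x₄ x₅, ?_, ?_, ?_, ?_⟩
  · intro e he s hs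
    have hL : ∀ x, layerCoeff x (fundamentalU Θ.scaled e) 0 = pairing (harmonic e) x :=
      layerCoeff_zero Θ e
    have hs5 : s ≤ 5 := by omega
    rw [coeff_stencilSum]
    simp only [Fin.sum_univ_six, ofLayers]
    interval_cases s
    · simpa using hzero e he
    · have := level₁ e he (by omega)
      simpa [hL] using this
    · have := level₂ e he (by omega)
      simpa [hL] using this
    · have := h₃ e (hind e he 2 le_rfl (by omega))
      simp [hL, this, hV]
    · have := h₄ e (hind e he 1 (by norm_num) (by omega))
      simp [hL, this, hV]
    · have := h₅ e (hind e he 0 (by norm_num) (by omega))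
      simp [hL, this, hV]
  · rw [coeff_stencilSum]
    simp only [Fin.sum_univ_six, ofLayers]
    simpa using layerCoeff_source Θ
  · show algebraMap ℝ A (laplaceWeight 0 0 0) = -4
    rw [laplaceWeight_values.2.2.2.2.2.2.2.2.2.2.2.2.2.1, map_neg, map_ofNat]
  · intro i j k p hp
    fin_cases p
    · show algebraMap ℝ A (laplaceWeight i j k) = 0
      have : laplaceWeight i j k = 0 := by
        cases i <;> cases j <;> cases k <;> first | rfl | simp [threshold] at hp
      rw [this, map_zero]
    · exact z₁ i j k hp
    · exact z₂ i j k hp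
    · exact z₃ i j k hp
    · exact z₄ i j k hp
    · exact z₅ i j k hp

/-- The difference of two stencils vanishes layer by layer: once the lower layers agree, the
difference of the next one satisfies the homogeneous square system. -/
theorem ScaledAdmissible.unique {c c' : SignType → SignType → SignType → Fin 6 → ℝ}
    {Θ : SplitJets ℝ} (hc : ScaledAdmissible c Θ) (hc' : ScaledAdmissible c' Θ) : c = c' := by
  have key : ∀ s : ℕ, ∀ p : Fin 6, (p : ℕ) = s → ∀ i j k, c i j k p - c' i j k p = 0 := by
    intro s
    induction s using Nat.strong_induction_on with
    | _ s ih =>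
      intro p hp
      have hz : ∀ i j k, threshold i j k ≤ s → c i j k p - c' i j k p = 0 := by
        intro i j k h
        rw [hc.vanish i j k p (by omega), hc'.vanish i j k p (by omega), sub_zero]
      have hL : ∀ e ∈ Lam51, s + (e.1 + e.2.1 + e.2.2) < 6 →
          pairing (harmonic e) (fun i j k => c i j k p - c' i j k p) = 0 := by
        intro e he hs
        have h1 := hc.order e he s hs
        have h2 := hc'.order e he s hs
        rw [coeff_stencilSum] at h1 h2
        have h3 : ∑ p' : Fin 6, (if (p' : ℕ) ≤ s then
            layerCoeff (fun i j k => c i j k p' - c' i j k p') (fundamentalU Θ.scaled e) (s - p')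
            else 0) = 0 := by
          refine Eq.trans ?_ (sub_eq_zero.2 (h1.trans h2.symm))
          rw [← Finset.sum_sub_distrib]
          refine Finset.sum_congr rfl fun p' _ => ?_
          split_ifs
          · simp only [layerCoeff, pairing, smul_sub, Finset.sum_sub_distrib, mul_sub]
          · simp
        -- By induction only the diagonal term `p' = p` survives.
        rw [Finset.sum_eq_single p] at h3
        · rw [if_pos hp.le, hp, Nat.sub_self, layerCoeff_zero] at h3
          exact h3
        · intro p' _ hne
          split_ifs with hle
          · have hlt : (p' : ℕ) < s := lt_of_le_of_ne hle fun h => hne (Fin.ext (h.trans hp.symm))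
            simp only [ih p' hlt p' rfl]
            simp [layerCoeff, pairing]
          · rfl
        · simp
      have hI : ∀ e ∈ indicesLE (5 - s),
          pairing (harmonic e) (fun i j k => c i j k p - c' i j k p) = 0 := by
        intro e he
        have hsub : ∀ e ∈ independentIndices, e ∈ Lam51 := by decide
        simp only [indicesLE, Finset.mem_filter] at he
        exact hL e (hsub e he.1) (by have := p.2; omega)
      rcases Nat.eq_zero_or_pos s with rfl | hs
      · have hp0 : p = 0 := Fin.ext hp
        subst hp0
        exact eq_zero_of_level_0 (x := fun i j k => c i j k 0 - c' i j k 0) hz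
          (by simp only [hc.center, hc'.center, sub_self]) hI
      · exact eq_zero_of_level hs (by have := p.2; omega) hz hI
  funext i j k p
  exact sub_eq_zero.1 (key p p rfl i j k)

end Existence

/-! ### Comparison with the Laurent polynomials in the mesh size -/

section Laurent

open Polynomial

/-- The coefficient jets of the elimination, bundled. -/
def Jets.toCoeffJets (J : Jets) : CoeffJets HPoly where
  a := J.a
  b := J.b
  c := J.c
  d := J.d

/-- The jets with values in Laurent polynomials. -/
def SplitJets.toJets (Θ : SplitJets ℝ) : Jets where
  a i j k := LaurentPolynomial.C (Θ.a i j k)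
  b i j k := LaurentPolynomial.C (Θ.b i j k)
  c i j k := LaurentPolynomial.C (Θ.c i j k)
  d i j k := LaurentPolynomial.C (Θ.d₁ i j k) * LaurentPolynomial.T (-1)
    + LaurentPolynomial.C (Θ.d₂ i j k)

/-- The derivatives at `p` of the coefficients of the semi-discrete equation. -/
def Data.splitJets (D : Data) (meth : TimeMethod) (r t : ℝ) (p : Space) : SplitJets ℝ where
  a i j k := pd i j k (D.a t) p
  b i j k := pd i j k (D.b t) p
  c i j k := pd i j k (D.c t) p
  d₁ i j k := pd i j k (D.d₁ meth t) p / r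
  d₂ i j k := pd i j k (D.d₂ t) p

lemma reduce_eq_eliminate (J : Jets) (U F : ℕ → ℕ → ℕ → HPoly) (m n q : ℕ) :
    reduce J U F m n q = eliminate J.toCoeffJets U F m n q := by
  refine eq_eliminate (V := reduce J U F) (m + n + q) (fun i j k _ => ?_) (fun i j k hi _ => ?_)
    m n q le_rfl
  · unfold SolvesJet
    rw [reduce]
    simp only [lowerOrder, leibniz, ← Finset.sum_add_distrib, ← mul_add, Jets.toCoeffJets]
    ring
  · interval_cases i
    · rw [reduce]
    · rw [reduce]

lemma unitAt_eq_single (e : ℕ × ℕ × ℕ) : unitAt e.1 e.2.1 e.2.2 = single e := rfl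

lemma stretch_split {S : Type*} [CommRing S] {t t' : S} (h : t * t' = 1) (x y : S) (n : ℕ) :
    t ^ (n + 2) * (x * t' + y) = t ^ (n + 1) * (x + t * y) := by
  linear_combination t ^ (n + 1) * x * h

lemma toLaurent_X_pow_mul_C (n : ℕ) (x : ℝ) :
    toLaurent (X ^ n * C x) = LaurentPolynomial.T 1 ^ n * LaurentPolynomial.C x := by
  rw [map_mul, map_pow, toLaurent_X, toLaurent_C]

/-- Stretching clears the only negative power: `h² (d₁ h⁻¹ + d₂) = h (d₁ + h d₂)`. -/
lemma scale_toJets (Θ : SplitJets ℝ) :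
    Θ.toJets.toCoeffJets.scale (LaurentPolynomial.T 1) = Θ.scaled.map toLaurent := by
  have h : (LaurentPolynomial.T 1 : HPoly) * LaurentPolynomial.T (-1) = 1 := by
    rw [← LaurentPolynomial.T_add]; simp
  have hd : ∀ (n : ℕ) (x y : ℝ), LaurentPolynomial.T 1 ^ (n + 2) *
      (LaurentPolynomial.C x * LaurentPolynomial.T (-1) + LaurentPolynomial.C y) =
      toLaurent (X ^ (n + 1) * (C x + X * C y)) := by
    intro n x y
    rw [stretch_split h, map_mul, map_pow, map_add, map_mul, toLaurent_X, toLaurent_C, toLaurent_C]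
  unfold CoeffJets.scale CoeffJets.map
  rw [CoeffJets.mk.injEq]
  refine ⟨?_, ?_, ?_, ?_⟩ <;> funext i j k
  · exact (toLaurent_X_pow_mul_C _ _).symm
  · exact (toLaurent_X_pow_mul_C _ _).symm
  · exact (toLaurent_X_pow_mul_C _ _).symm
  · exact hd _ _ _

lemma T_one_pow_mul_fundamentalU (Θ : SplitJets ℝ) (e : ℕ × ℕ × ℕ) (m n q : ℕ) :
    LaurentPolynomial.T 1 ^ (m + n + q) * fundamentalU Θ.toJets.toCoeffJets e m n q =
      LaurentPolynomial.T 1 ^ (e.1 + e.2.1 + e.2.2) * toLaurent (fundamentalU Θ.scaled e m n q) := by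
  rw [← fundamentalU_scale, scale_toJets, fundamentalU, fundamentalU, map_eliminate]
  simp only [map_single, map_zero]

lemma T_one_pow_mul_fundamentalF (Θ : SplitJets ℝ) (e : ℕ × ℕ × ℕ) (m n q : ℕ) :
    LaurentPolynomial.T 1 ^ (m + n + q) * fundamentalF Θ.toJets.toCoeffJets e m n q =
      LaurentPolynomial.T 1 ^ (e.1 + e.2.1 + e.2.2 + 2) *
        toLaurent (fundamentalF Θ.scaled e m n q) := by
  rw [← fundamentalF_scale, scale_toJets, fundamentalF, fundamentalF, map_eliminate]
  simp only [map_single, map_zero]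

/-- The powers of the displacement supply exactly the factor `h ^ (m + n + q)` that turns
derivatives into derivatives in the stretched variables. -/
lemma taylor5_shift (J : Jets) (U F : ℕ → ℕ → ℕ → HPoly) (i j k : SignType) :
    taylor5 J U F (shift i) (shift j) (shift k) =
      expansion (fun m n q => LaurentPolynomial.T 1 ^ (m + n + q) *
        eliminate J.toCoeffJets U F m n q) i j k := by
  refine Finset.sum_congr rfl fun f _ => ?_
  rw [reduce_eq_eliminate, LaurentPolynomial.smul_eq_C_mul]
  have : taylorWeight f i j k =
      (1 / ((f.1.factorial * f.2.1.factorial * f.2.2.factorial : ℕ) : ℝ)) *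
        ((i : ℝ) ^ f.1 * (j : ℝ) ^ f.2.1 * (k : ℝ) ^ f.2.2) := by
    unfold taylorWeight; ring
  rw [this]
  simp only [shift, map_mul, map_pow]
  ring

lemma expansion_mul_toLaurent (x : HPoly) (V : ℕ → ℕ → ℕ → ℝ[X]) (i j k : SignType) :
    expansion (fun m n q => x * toLaurent (V m n q)) i j k =
      x * toLaurent (expansion V i j k) := by
  simp only [expansion, map_sum, Finset.mul_sum, LaurentPolynomial.smul_eq_C_mul, smul_eq_C_mul,
    map_mul, toLaurent_C]
  exact Finset.sum_congr rfl fun f _ => by ring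

lemma poly_eq_toLaurent (c : Stencil) (i j k : SignType) :
    c.poly i j k = toLaurent (stencilPoly c i j k) := by
  simp [Stencil.poly, stencilPoly]

lemma sum_poly_mul_expansion (c : Stencil) (x : HPoly) (V : ℕ → ℕ → ℕ → ℝ[X]) :
    ∑ i, ∑ j, ∑ k, c.poly i j k * expansion (fun m n q => x * toLaurent (V m n q)) i j k =
      x * toLaurent (stencilSum c V) := by
  simp only [stencilSum, map_sum, map_mul, Finset.mul_sum, expansion_mul_toLaurent,
    poly_eq_toLaurent]
  refine Finset.sum_congr rfl fun i _ => Finset.sum_congr rfl fun j _ =>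
    Finset.sum_congr rfl fun k _ => by ring

lemma I_eq_toLaurent (c : Stencil) (Θ : SplitJets ℝ) (e : ℕ × ℕ × ℕ) :
    c.I Θ.toJets e.1 e.2.1 e.2.2 = LaurentPolynomial.T 1 ^ (e.1 + e.2.1 + e.2.2) *
      toLaurent (stencilSum c (fundamentalU Θ.scaled e)) := by
  rw [← sum_poly_mul_expansion]
  simp only [Stencil.I, G, taylor5_shift, unitAt_eq_single, ← T_one_pow_mul_fundamentalU]
  rfl

lemma rhs_eq_toLaurent (c : Stencil) (Θ : SplitJets ℝ) (e : ℕ × ℕ × ℕ) :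
    c.rhs Θ.toJets e.1 e.2.1 e.2.2 = LaurentPolynomial.T 1 ^ (e.1 + e.2.1 + e.2.2 + 2) *
      toLaurent (stencilSum c (fundamentalF Θ.scaled e)) := by
  rw [← sum_poly_mul_expansion]
  simp only [Stencil.rhs, H, taylor5_shift, unitAt_eq_single, ← T_one_pow_mul_fundamentalF]
  rfl

lemma coeff_T_mul (n k : ℤ) (P : HPoly) :
    (LaurentPolynomial.T n * P).coeff k = P.coeff (k - n) := by
  rw [LaurentPolynomial.T, AddMonoidAlgebra.coeff_single_mul_apply, one_mul, neg_add_eq_sub]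

lemma coeff_toLaurent_natCast (P : ℝ[X]) (s : ℕ) : (toLaurent P).coeff (s : ℤ) = P.coeff s := by
  rw [LaurentPolynomial.coeff_toLaurent]
  exact Finsupp.mapDomain_apply Nat.castEmbedding.injective _ s

lemma coeff_toLaurent_neg (P : ℝ[X]) {k : ℤ} (hk : k < 0) : (toLaurent P).coeff k = 0 := by
  rw [LaurentPolynomial.coeff_toLaurent]
  refine Finsupp.mapDomain_of_notMem_range _ _ ?_
  rintro ⟨s, rfl⟩
  exact absurd hk (not_lt.2 (Int.natCast_nonneg s))

lemma Stencil.Admissible.vanish {c : Stencil} {J : Jets} (hc : c.Admissible J)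
    (i j k : SignType) (p : Fin 6) (h : threshold i j k ≤ (p : ℕ)) : c i j k p = 0 := by
  cases i <;> cases j <;> cases k
  all_goals first
    | (exact hc.corner _ _ _ (by decide) (by decide) (by decide) p)
    | (exact absurd h (by have := p.2; simp only [threshold]; omega))
    | (exact hc.zero_n0n p h)
    | (exact hc.zero_n00 p h)
    | (exact hc.zero_n01 p h)
    | (exact hc.zero_n10 p h)
    | (exact hc.zero_0nn p h)
    | (exact hc.zero_0n0 p h)
    | (exact hc.zero_0n1 p h)
    | (exact hc.zero_00n p h)
    | (exact hc.zero_000 p h)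
    | (exact hc.zero_001 p h)
    | (exact hc.zero_01n p h)
    | (exact hc.zero_010 p h)
    | (exact hc.zero_011 p h)
    | (exact hc.zero_1n0 p h)
    | (exact hc.zero_10n p h)
    | (exact hc.zero_100 p h)
    | (exact hc.zero_101 p h)
    | (exact hc.zero_110 p h)

/-- The functions `I` and `J` are `h ^ |e|` and `h ^ (|e| + 2)` times polynomials in `h`. Hence
`order` becomes a condition on coefficients with `s + |e| < 6`, and all of `lowest` is automatic
except the `h⁰` coefficient at `f` itself. -/
theorem admissible_iff {c : Stencil} {Θ : SplitJets ℝ} :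
    c.Admissible Θ.toJets ↔ ScaledAdmissible c Θ := by
  have hT : ∀ n : ℕ, (LaurentPolynomial.T 1 : HPoly) ^ n = LaurentPolynomial.T n := by
    intro n; rw [LaurentPolynomial.T_pow, mul_one]
  have hI : ∀ (e : ℕ × ℕ × ℕ) (k : ℤ), (c.I Θ.toJets e.1 e.2.1 e.2.2).coeff k =
      (toLaurent (stencilSum c (fundamentalU Θ.scaled e))).coeff
        (k - (e.1 + e.2.1 + e.2.2 : ℕ)) := by
    intro e k
    rw [I_eq_toLaurent, hT, coeff_T_mul]
  have hR : ∀ (e : ℕ × ℕ × ℕ) (k : ℤ),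
      (LaurentPolynomial.T (-2) * c.rhs Θ.toJets e.1 e.2.1 e.2.2).coeff k =
      (toLaurent (stencilSum c (fundamentalF Θ.scaled e))).coeff
        (k - (e.1 + e.2.1 + e.2.2 : ℕ)) := by
    intro e k
    rw [rhs_eq_toLaurent, hT, coeff_T_mul, coeff_T_mul]
    congr 1
    push_cast
    ring
  constructor
  · intro hc
    refine ⟨fun e he s hs => ?_, ?_, hc.center, hc.vanish⟩
    · have := hc.order e he ((s + (e.1 + e.2.1 + e.2.2) : ℕ) : ℤ) (by exact_mod_cast hs)
      rw [hI, Nat.cast_add s, add_sub_cancel_right, coeff_toLaurent_natCast] at this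
      exact this
    · have := hc.lowest (0, 0, 0) (by decide) 0 le_rfl
      rw [hR] at this
      simpa [-LaurentPolynomial.coeff_toLaurent] using
        (coeff_toLaurent_natCast _ 0).symm.trans this
  · intro hc
    refine ⟨fun e he k hk => ?_, fun e he k hk => ?_, fun i j k hi hj hk p => ?_, hc.center,
      fun p hp => hc.vanish _ _ _ p hp, fun p hp => hc.vanish _ _ _ p hp,
      fun p hp => hc.vanish _ _ _ p hp, fun p hp => hc.vanish _ _ _ p hp,
      fun p hp => hc.vanish _ _ _ p hp, fun p hp => hc.vanish _ _ _ p hp,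
      fun p hp => hc.vanish _ _ _ p hp, fun p hp => hc.vanish _ _ _ p hp,
      fun p hp => hc.vanish _ _ _ p hp, fun p hp => hc.vanish _ _ _ p hp,
      fun p hp => hc.vanish _ _ _ p hp, fun p hp => hc.vanish _ _ _ p hp,
      fun p hp => hc.vanish _ _ _ p hp, fun p hp => hc.vanish _ _ _ p hp,
      fun p hp => hc.vanish _ _ _ p hp, fun p hp => hc.vanish _ _ _ p hp,
      fun p hp => hc.vanish _ _ _ p hp, fun p hp => hc.vanish _ _ _ p hp⟩
    · rw [hI]
      rcases lt_or_ge (k - (e.1 + e.2.1 + e.2.2 : ℕ)) 0 with h | h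
      · exact coeff_toLaurent_neg _ h
      · obtain ⟨s, hs⟩ := Int.eq_ofNat_of_zero_le h
        rw [hs, coeff_toLaurent_natCast]
        exact hc.order e he s (by omega)
    · rw [hR]
      rcases lt_or_ge (k - (e.1 + e.2.1 + e.2.2 : ℕ)) 0 with h | h
      · rw [coeff_toLaurent_neg _ h, if_neg]
        rintro ⟨rfl, rfl⟩
        simp at h
      · obtain ⟨m, n, q⟩ := e
        simp only at h ⊢
        obtain ⟨rfl, rfl, rfl, rfl⟩ : k = 0 ∧ m = 0 ∧ n = 0 ∧ q = 0 := by omega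
        simpa [-LaurentPolynomial.coeff_toLaurent] using
          (coeff_toLaurent_natCast _ 0).trans hc.source
    · exact hc.vanish i j k p (by
        rw [threshold_corner (by tauto)]; exact Nat.zero_le _)

lemma jets_eq_toJets (D : Data) (meth : TimeMethod) (r t : ℝ) (p : Space) :
    D.jets meth r t p = (D.splitJets meth r t p).toJets := rfl

theorem existsUnique_admissible (Θ : SplitJets ℝ) : ∃! c : Stencil, c.Admissible Θ.toJets := by
  obtain ⟨c, hc⟩ := exists_scaledAdmissible Θ
  exact ⟨c, admissible_iff.2 hc, fun c' hc' => (admissible_iff.1 hc').unique hc⟩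

/-- The polynomial whose quotient by `h` is the right-hand side of the scheme before
truncation. -/
def sourcePolynomial {A : Type*} [CommRing A] [Algebra ℝ A]
    (c : SignType → SignType → SignType → Fin 6 → A) (Θ : SplitJets A)
    (φ₁ φ₂ : ℕ → ℕ → ℕ → A) : A[X] :=
  ∑ e ∈ degLE 3, X ^ (e.1 + e.2.1 + e.2.2) *
    (C (φ₁ e.1 e.2.1 e.2.2) * X + C (φ₂ e.1 e.2.1 e.2.2)) *
      stencilSum c (fundamentalF Θ.scaled e)

lemma sourcePoly_eq_toLaurent (c : Stencil) (Θ : SplitJets ℝ) (r : ℝ) (f₁ f₂ : Space → ℝ)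
    (p : Space) : c.sourcePoly Θ.toJets r f₁ f₂ p = LaurentPolynomial.T (-1) * toLaurent
      (sourcePolynomial c Θ (fun m n q => pd m n q f₁ p) (fun m n q => pd m n q f₂ p / r)) := by
  have h : (LaurentPolynomial.T (-1) : HPoly) * LaurentPolynomial.T 1 = 1 := by
    rw [← LaurentPolynomial.T_add]; simp
  have h2 : (LaurentPolynomial.T (-2) : HPoly) =
      LaurentPolynomial.T (-1) * LaurentPolynomial.T (-1) := by
    rw [← LaurentPolynomial.T_add]; rfl
  have key : ∀ {S : Type} [CommRing S] (t t' x y z : S) (n : ℕ), t' * t = 1 →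
      t' * t' * ((x + y * t') * (t ^ (n + 2) * z)) = t' * (t ^ n * (x * t + y) * z) := by
    intro S _ t t' x y z n h
    linear_combination (t' * t ^ (n + 1) * x * z + t' * t ^ n * y * z * (t' * t + 1)) * h
  simp only [Stencil.sourcePoly, sourcePolynomial, Finset.mul_sum, map_sum, rhs_eq_toLaurent,
    map_mul, map_add, map_pow, toLaurent_X, toLaurent_C, h2]
  exact Finset.sum_congr rfl fun e _ => key _ _ _ _ _ _ h

lemma mul_valueTrunc3 (Q : ℝ[X]) {h : ℝ} (hh : h ≠ 0) :
    h * valueTrunc3 (LaurentPolynomial.T (-1) * toLaurent Q) h =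
      ∑ s ∈ Finset.range 5, Q.coeff s * h ^ s := by
  set P := LaurentPolynomial.T (-1) * toLaurent Q with hP
  have hc : ∀ s : ℕ, P.coeff ((s : ℤ) - 1) = Q.coeff s := by
    intro s
    rw [hP, coeff_T_mul, sub_neg_eq_add, sub_add_cancel, coeff_toLaurent_natCast]
  have hneg : ∀ k : ℤ, k < -1 → P.coeff k = 0 := by
    intro k hk
    rw [hP, coeff_T_mul, coeff_toLaurent_neg _ (by omega)]
  -- The division by `h` shifts exponents by one: `s - 1 ≤ 3` means `s < 5`, and the lowest possible
  -- exponent is `-1`.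
  have hsum : valueTrunc3 P h = ∑ s ∈ Finset.range 5, Q.coeff s * h ^ ((s : ℤ) - 1) := by
    unfold valueTrunc3
    rw [Finsupp.sum_of_support_subset (s := (Finset.range 5).image fun s : ℕ => (s : ℤ) - 1)]
    · rw [Finset.sum_image (fun a _ b _ hab => by simpa using hab)]
      refine Finset.sum_congr rfl fun s hs => ?_
      rw [Finsupp.filter_apply_pos _ _ (by simp only [Finset.mem_range] at hs; omega), hc]
    · intro k hk
      simp only [Finsupp.support_filter, Finset.mem_filter, Finsupp.mem_support_iff] at hk
      have : -1 ≤ k := by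
        by_contra hlt
        exact hk.1 (hneg k (by omega))
      simp only [Finset.mem_image, Finset.mem_range]
      exact ⟨(k + 1).toNat, by omega, by omega⟩
    · simp
  rw [hsum, Finset.mul_sum]
  refine Finset.sum_congr rfl fun s _ => ?_
  rw [zpow_sub₀ hh, zpow_natCast, zpow_one]
  field_simp

end Laurent

/-! ### Partial derivatives of smooth functions on open sets -/

section PartialDerivatives

open Topology

variable {U : Set Space} {g g' : Space → ℝ} {v w : Space}

/-- The derivative in the direction `v`. -/
def dirDeriv (v : Space) (g : Space → ℝ) (p : Space) : ℝ := fderiv ℝ g p v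

lemma contDiffOn_dirDeriv (hU : IsOpen U) (hg : ContDiffOn ℝ ∞ g U) (v : Space) :
    ContDiffOn ℝ ∞ (dirDeriv v g) U :=
  (hg.fderiv_of_isOpen hU (m := ∞) (by simp)).clm_apply contDiffOn_const

lemma contDiffOn_iterate_dirDeriv (hU : IsOpen U) (hg : ContDiffOn ℝ ∞ g U) (v : Space) (m : ℕ) :
    ContDiffOn ℝ ∞ ((dirDeriv v)^[m] g) U := by
  induction m with
  | zero => exact hg
  | succ m ih =>
    rw [Function.iterate_succ_apply']
    exact contDiffOn_dirDeriv hU ih v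

lemma dirDeriv_congr (hU : IsOpen U) (h : Set.EqOn g g' U) (v : Space) :
    Set.EqOn (dirDeriv v g) (dirDeriv v g') U := fun p hp => by
  unfold dirDeriv
  rw [(Filter.eventuallyEq_of_mem (hU.mem_nhds hp) h).fderiv_eq]

lemma iterate_dirDeriv_congr (hU : IsOpen U) (h : Set.EqOn g g' U) (v : Space) (m : ℕ) :
    Set.EqOn ((dirDeriv v)^[m] g) ((dirDeriv v)^[m] g') U := by
  induction m with
  | zero => exact h
  | succ m ih =>
    rw [Function.iterate_succ_apply', Function.iterate_succ_apply']
    exact dirDeriv_congr hU ih v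

lemma differentiableAt_of_contDiffOn (hU : IsOpen U) (hg : ContDiffOn ℝ ∞ g U) {p : Space}
    (hp : p ∈ U) : DifferentiableAt ℝ g p :=
  (hg.contDiffAt (hU.mem_nhds hp)).differentiableAt (by simp)

lemma dirDeriv_comm (hU : IsOpen U) (hg : ContDiffOn ℝ ∞ g U) (v w : Space) :
    Set.EqOn (dirDeriv v (dirDeriv w g)) (dirDeriv w (dirDeriv v g)) U := fun p hp => by
  have hd : DifferentiableAt ℝ (fderiv ℝ g) p :=
    ((hg.fderiv_of_isOpen hU (m := ∞) (by simp)).contDiffAt (hU.mem_nhds hp)).differentiableAt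
      (by simp)
  have key : ∀ v w, dirDeriv v (dirDeriv w g) p = fderiv ℝ (fderiv ℝ g) p v w := by
    intro v w
    show fderiv ℝ (fun p => fderiv ℝ g p w) p v = _
    rw [fderiv_clm_apply hd (differentiableAt_const w)]
    simp
  rw [key, key]
  exact (hg.contDiffAt (hU.mem_nhds hp)).isSymmSndFDerivAt
    (by rw [minSmoothness_of_isRCLikeNormedField]; exact WithTop.coe_le_coe.2 (le_top (a := (2 : ℕ∞)))) v w

lemma iterate_dirDeriv_comm (hU : IsOpen U) (hg : ContDiffOn ℝ ∞ g U) (v w : Space) (m n : ℕ) :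
    Set.EqOn ((dirDeriv v)^[m] ((dirDeriv w)^[n] g)) ((dirDeriv w)^[n] ((dirDeriv v)^[m] g)) U := by
  have h1 : ∀ {g : Space → ℝ}, ContDiffOn ℝ ∞ g U →
      Set.EqOn (dirDeriv v ((dirDeriv w)^[n] g)) ((dirDeriv w)^[n] (dirDeriv v g)) U := by
    intro g hg
    induction n with
    | zero => exact fun _ _ => rfl
    | succ n ih =>
      rw [Function.iterate_succ_apply', Function.iterate_succ_apply']
      exact (dirDeriv_comm hU (contDiffOn_iterate_dirDeriv hU hg w n) v w).trans
        (dirDeriv_congr hU ih w)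
  induction m with
  | zero => exact fun _ _ => rfl
  | succ m ih =>
    rw [Function.iterate_succ_apply', Function.iterate_succ_apply']
    exact (dirDeriv_congr hU ih v).trans (h1 (contDiffOn_iterate_dirDeriv hU hg v m))

/-- Derivatives along a line. -/
lemma iteratedDeriv_comp_line (hU : IsOpen U) (hg : ContDiffOn ℝ ∞ g U) {γ : ℝ → Space}
    (hγ : ∀ s, HasDerivAt γ v s) (m : ℕ) :
    ∀ s, γ s ∈ U → iteratedDeriv m (fun s => g (γ s)) s = (dirDeriv v)^[m] g (γ s) := by
  induction m with
  | zero => intro s _; rfl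
  | succ m ih =>
    intro s hs
    rw [iteratedDeriv_succ, Function.iterate_succ_apply']
    have hev : iteratedDeriv m (fun s => g (γ s)) =ᶠ[𝓝 s]
        fun s => (dirDeriv v)^[m] g (γ s) := by
      filter_upwards [(hγ s).continuousAt.preimage_mem_nhds (hU.mem_nhds hs)] with s' hs'
      exact ih s' hs'
    rw [hev.deriv_eq]
    exact ((differentiableAt_of_contDiffOn hU
      (contDiffOn_iterate_dirDeriv hU hg v m) hs).hasFDerivAt.comp_hasDerivAt s (hγ s)).deriv

/-- The first coordinate direction. -/
def dirX : Space := (1, 0, 0)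

/-- The second coordinate direction. -/
def dirY : Space := (0, 1, 0)

/-- The third coordinate direction. -/
def dirZ : Space := (0, 0, 1)

/-- `pd` nests one-variable derivatives; since `U` is open, each inner one can be replaced by a
directional derivative on a whole neighbourhood before the next is taken. -/
lemma pd_eqOn (hU : IsOpen U) (hg : ContDiffOn ℝ ∞ g U) (m n q : ℕ) :
    Set.EqOn (pd m n q g)
      ((dirDeriv dirX)^[m] ((dirDeriv dirY)^[n] ((dirDeriv dirZ)^[q] g))) U := by
  have hγ₁ : ∀ (y z x : ℝ), HasDerivAt (fun x : ℝ => ((x, y, z) : Space)) dirX x := fun y z x =>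
    (hasDerivAt_id x).prodMk ((hasDerivAt_const x y).prodMk (hasDerivAt_const x z))
  have hγ₂ : ∀ (x z y : ℝ), HasDerivAt (fun y : ℝ => ((x, y, z) : Space)) dirY y := fun x z y =>
    (hasDerivAt_const y x).prodMk ((hasDerivAt_id y).prodMk (hasDerivAt_const y z))
  have hγ₃ : ∀ (x y z : ℝ), HasDerivAt (fun z : ℝ => ((x, y, z) : Space)) dirZ z := fun x y z =>
    (hasDerivAt_const z x).prodMk ((hasDerivAt_const z y).prodMk (hasDerivAt_id z))
  have h₃ : ∀ x y z, (x, y, z) ∈ U → iteratedDeriv q (fun z => g (x, y, z)) z =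
      (dirDeriv dirZ)^[q] g (x, y, z) := fun x y z h =>
    iteratedDeriv_comp_line hU hg (hγ₃ x y) q z h
  have h₂ : ∀ x y z, (x, y, z) ∈ U →
      iteratedDeriv n (fun y => iteratedDeriv q (fun z => g (x, y, z)) z) y =
      (dirDeriv dirY)^[n] ((dirDeriv dirZ)^[q] g) (x, y, z) := by
    intro x y z h
    have hev : (fun y => iteratedDeriv q (fun z => g (x, y, z)) z) =ᶠ[𝓝 y]
        fun y => (dirDeriv dirZ)^[q] g (x, y, z) := by
      filter_upwards [(hγ₂ x z y).continuousAt.preimage_mem_nhds (hU.mem_nhds h)] with y' hy'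
      exact h₃ x y' z hy'
    rw [hev.iteratedDeriv_eq]
    exact iteratedDeriv_comp_line hU (contDiffOn_iterate_dirDeriv hU hg _ _) (hγ₂ x z) n y h
  rintro ⟨x, y, z⟩ h
  have hev : (fun x => iteratedDeriv n (fun y => iteratedDeriv q (fun z => g (x, y, z)) z) y)
      =ᶠ[𝓝 x] fun x => (dirDeriv dirY)^[n] ((dirDeriv dirZ)^[q] g) (x, y, z) := by
    filter_upwards [(hγ₁ y z x).continuousAt.preimage_mem_nhds (hU.mem_nhds h)] with x' hx'
    exact h₂ x' y z hx'
  show iteratedDeriv m _ x = _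
  rw [hev.iteratedDeriv_eq]
  exact iteratedDeriv_comp_line hU (contDiffOn_iterate_dirDeriv hU
    (contDiffOn_iterate_dirDeriv hU hg _ _) _ _) (hγ₁ y z) m x h

lemma contDiffOn_pd (hU : IsOpen U) (hg : ContDiffOn ℝ ∞ g U) (m n q : ℕ) :
    ContDiffOn ℝ ∞ (pd m n q g) U :=
  (contDiffOn_iterate_dirDeriv hU (contDiffOn_iterate_dirDeriv hU
    (contDiffOn_iterate_dirDeriv hU hg _ _) _ _) _ _).congr (pd_eqOn hU hg m n q)

lemma pd_congr (hU : IsOpen U) (hg : ContDiffOn ℝ ∞ g U) (h : Set.EqOn g g' U) (m n q : ℕ) :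
    Set.EqOn (pd m n q g) (pd m n q g') U :=
  (pd_eqOn hU hg m n q).trans <| (iterate_dirDeriv_congr hU (iterate_dirDeriv_congr hU
    (iterate_dirDeriv_congr hU h _ _) _ _) _ _).trans
      (pd_eqOn hU (hg.congr fun _ hp => (h hp).symm) m n q).symm

lemma pd_pd (hU : IsOpen U) (hg : ContDiffOn ℝ ∞ g U) (m n q i j k : ℕ) :
    Set.EqOn (pd m n q (pd i j k g)) (pd (m + i) (n + j) (q + k) g) U := by
  have hz := contDiffOn_iterate_dirDeriv hU hg dirZ
  have hs := fun {g : Space → ℝ} (hg : ContDiffOn ℝ ∞ g U) v m =>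
    contDiffOn_iterate_dirDeriv hU hg v m
  refine (pd_congr hU (contDiffOn_pd hU hg i j k) (pd_eqOn hU hg i j k) m n q).trans ?_
  refine (pd_eqOn hU (hs (hs (hs hg _ _) _ _) _ _) m n q).trans ?_
  refine Set.EqOn.trans ?_ (pd_eqOn hU hg _ _ _).symm
  rw [Function.iterate_add_apply, Function.iterate_add_apply, Function.iterate_add_apply]
  refine iterate_dirDeriv_congr hU ?_ _ _
  refine (iterate_dirDeriv_congr hU (iterate_dirDeriv_comm hU (hs (hs hg _ _) _ _)
    dirZ dirX q i) dirY n).trans ?_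
  refine (iterate_dirDeriv_comm hU (hs (hs (hs hg _ _) _ _) _ _) dirY dirX n i).trans ?_
  refine iterate_dirDeriv_congr hU ?_ _ _
  exact iterate_dirDeriv_congr hU (iterate_dirDeriv_comm hU (hs hg _ _) dirZ dirY q j) dirY n

lemma iterate_dirDeriv_sum (hU : IsOpen U) {ι : Type*} (s : Finset ι) (c : ι → ℝ)
    {G : ι → Space → ℝ} (hG : ∀ i ∈ s, ContDiffOn ℝ ∞ (G i) U) (v : Space) (m : ℕ) :
    Set.EqOn ((dirDeriv v)^[m] fun p => ∑ i ∈ s, c i * G i p)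
      (fun p => ∑ i ∈ s, c i * (dirDeriv v)^[m] (G i) p) U := by
  induction m with
  | zero => exact fun _ _ => rfl
  | succ m ih =>
    simp only [Function.iterate_succ_apply']
    refine (dirDeriv_congr hU ih v).trans fun p hp => ?_
    have hd : ∀ i ∈ s, DifferentiableAt ℝ ((dirDeriv v)^[m] (G i)) p := fun i hi =>
      differentiableAt_of_contDiffOn hU (contDiffOn_iterate_dirDeriv hU (hG i hi) v m) hp
    show fderiv ℝ (fun p => ∑ i ∈ s, c i * (dirDeriv v)^[m] (G i) p) p v =
      ∑ i ∈ s, c i * fderiv ℝ ((dirDeriv v)^[m] (G i)) p v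
    rw [fderiv_fun_sum fun i hi => (hd i hi).const_mul (c i), sum_apply]
    refine Finset.sum_congr rfl fun i hi => ?_
    rw [fderiv_const_mul (hd i hi)]
    rfl

/-- Restriction to the line through `p` in the direction `v` reduces this to the one-variable
Leibniz rule. -/
lemma iterate_dirDeriv_mul (hU : IsOpen U) (hg : ContDiffOn ℝ ∞ g U) (hg' : ContDiffOn ℝ ∞ g' U)
    (v : Space) (m : ℕ) :
    Set.EqOn ((dirDeriv v)^[m] fun p => g p * g' p)
      (fun p => ∑ i ∈ Finset.range (m + 1),
        (m.choose i : ℝ) * ((dirDeriv v)^[i] g p * (dirDeriv v)^[m - i] g' p)) U := by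
  intro p hp
  set γ : ℝ → Space := fun s => p + s • v with hγdef
  have hγ : ∀ s, HasDerivAt γ v s := fun s => by
    have := ((hasDerivAt_id s).smul_const v).const_add p
    rwa [one_smul] at this
  have h0 : γ 0 = p := by simp [hγdef]
  have hU0 : γ 0 ∈ U := by rwa [h0]
  have hγc : ContDiff ℝ ∞ γ := contDiff_const.add (contDiff_id.smul contDiff_const)
  have hcomp : ∀ {g : Space → ℝ}, ContDiffOn ℝ ∞ g U → ContDiffAt ℝ m (fun s => g (γ s)) 0 := by
    intro g hg
    have h1 : ContDiffAt ℝ ∞ g (γ 0) := hg.contDiffAt (hU.mem_nhds hU0)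
    exact (h1.comp 0 hγc.contDiffAt).of_le (by exact_mod_cast le_top)
  have hl := fun {g : Space → ℝ} (hg : ContDiffOn ℝ ∞ g U) m =>
    iteratedDeriv_comp_line hU hg hγ m 0 hU0
  have h1 := hl (hg.mul hg') m
  have h2 := iteratedDeriv_fun_mul (hcomp hg) (hcomp hg')
  rw [h0] at h1
  refine Eq.trans h1.symm (h2.trans ?_)
  refine Finset.sum_congr rfl fun i _ => ?_
  rw [hl hg, hl hg', h0, mul_assoc]

/-- The Leibniz rule for mixed partial derivatives. -/
lemma pd_mul (hU : IsOpen U) (hg : ContDiffOn ℝ ∞ g U) (hg' : ContDiffOn ℝ ∞ g' U) (m n q : ℕ)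
    {p : Space} (hp : p ∈ U) :
    pd m n q (fun p => g p * g' p) p =
      leibniz (fun i j k => pd i j k g p) (fun i j k => pd i j k g' p) m n q := by
  have hs := fun {g : Space → ℝ} (hg : ContDiffOn ℝ ∞ g U) v m =>
    contDiffOn_iterate_dirDeriv hU hg v m
  have h₂ : Set.EqOn ((dirDeriv dirY)^[n] ((dirDeriv dirZ)^[q] fun p => g p * g' p))
      (fun p => ∑ k ∈ Finset.range (q + 1), (q.choose k : ℝ) * ∑ j ∈ Finset.range (n + 1),
        (n.choose j : ℝ) * ((dirDeriv dirY)^[j] ((dirDeriv dirZ)^[k] g) p *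
          (dirDeriv dirY)^[n - j] ((dirDeriv dirZ)^[q - k] g') p)) U := by
    refine (iterate_dirDeriv_congr hU (iterate_dirDeriv_mul hU hg hg' dirZ q) _ _).trans ?_
    refine (iterate_dirDeriv_sum hU _ _ (fun k _ => (hs hg _ _).mul (hs hg' _ _)) _ _).trans ?_
    intro p hp
    refine Finset.sum_congr rfl fun k _ => ?_
    congr 1
    exact iterate_dirDeriv_mul hU (hs hg _ _) (hs hg' _ _) _ _ hp
  have h₂' : Set.EqOn ((dirDeriv dirY)^[n] ((dirDeriv dirZ)^[q] fun p => g p * g' p))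
      (fun p => ∑ e ∈ Finset.range (n + 1) ×ˢ Finset.range (q + 1),
        ((n.choose e.1 * q.choose e.2 : ℕ) : ℝ) * ((dirDeriv dirY)^[e.1] ((dirDeriv dirZ)^[e.2] g) p *
          (dirDeriv dirY)^[n - e.1] ((dirDeriv dirZ)^[q - e.2] g') p)) U := by
    refine h₂.trans fun p _ => ?_
    simp only [Finset.sum_product, Finset.mul_sum]
    rw [Finset.sum_comm]
    refine Finset.sum_congr rfl fun j _ => Finset.sum_congr rfl fun k _ => ?_
    push_cast
    ring
  rw [pd_eqOn hU (hg.mul hg') m n q hp, iterate_dirDeriv_congr hU h₂' dirX m hp,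
    iterate_dirDeriv_sum hU _ _
      (fun e _ => (hs (hs hg _ _) _ _).mul (hs (hs hg' _ _) _ _)) _ _ hp]
  simp only [leibniz]
  have h₁ : ∀ e : ℕ × ℕ, (dirDeriv dirX)^[m] (fun p =>
      (dirDeriv dirY)^[e.1] ((dirDeriv dirZ)^[e.2] g) p *
        (dirDeriv dirY)^[n - e.1] ((dirDeriv dirZ)^[q - e.2] g') p) p =
      ∑ i ∈ Finset.range (m + 1), (m.choose i : ℝ) * (pd i e.1 e.2 g p *
        pd (m - i) (n - e.1) (q - e.2) g' p) := by
    intro e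
    rw [iterate_dirDeriv_mul hU (hs (hs hg _ _) _ _) (hs (hs hg' _ _) _ _) _ _ hp]
    refine Finset.sum_congr rfl fun i _ => ?_
    rw [pd_eqOn hU hg _ _ _ hp, pd_eqOn hU hg' _ _ _ hp]
  have h₀ := Finset.sum_congr (rfl : Finset.range (n + 1) ×ˢ Finset.range (q + 1) = _)
    fun e _ => congrArg (((n.choose e.1 * q.choose e.2 : ℕ) : ℝ) * ·) (h₁ e)
  refine h₀.trans ?_
  simp only [Finset.mul_sum]
  rw [Finset.sum_comm]
  refine Finset.sum_congr rfl fun i _ => ?_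
  rw [Finset.sum_product]
  refine Finset.sum_congr rfl fun j _ => Finset.sum_congr rfl fun k _ => ?_
  push_cast
  ring

lemma pd_sum (hU : IsOpen U) {ι : Type*} (s : Finset ι) (c : ι → ℝ) {G : ι → Space → ℝ}
    (hG : ∀ i ∈ s, ContDiffOn ℝ ∞ (G i) U) (m n q : ℕ) {p : Space} (hp : p ∈ U) :
    pd m n q (fun p => ∑ i ∈ s, c i * G i p) p = ∑ i ∈ s, c i * pd m n q (G i) p := by
  have hs := fun {g : Space → ℝ} (hg : ContDiffOn ℝ ∞ g U) v m =>
    contDiffOn_iterate_dirDeriv hU hg v m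
  rw [pd_eqOn hU (ContDiffOn.sum fun i hi => contDiffOn_const.mul (hG i hi)) m n q hp]
  rw [iterate_dirDeriv_congr hU ((iterate_dirDeriv_congr hU (iterate_dirDeriv_sum hU s c hG dirZ q)
    dirY n).trans (iterate_dirDeriv_sum hU s c (fun i hi => hs (hG i hi) _ _) dirY n)) dirX m hp,
    iterate_dirDeriv_sum hU s c (fun i hi => hs (hs (hG i hi) _ _) _ _) dirX m hp]
  exact Finset.sum_congr rfl fun i hi => by rw [pd_eqOn hU (hG i hi) _ _ _ hp]

lemma pd_add (hU : IsOpen U) (hg : ContDiffOn ℝ ∞ g U) (hg' : ContDiffOn ℝ ∞ g' U) (m n q : ℕ)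
    {p : Space} (hp : p ∈ U) :
    pd m n q (fun p => g p + g' p) p = pd m n q g p + pd m n q g' p := by
  have := pd_sum hU (Finset.univ : Finset (Fin 2)) (fun _ => 1) (G := ![g, g'])
    (fun i _ => by fin_cases i <;> assumption) m n q hp
  simpa [Fin.sum_univ_two] using this

lemma pd_const_mul (hU : IsOpen U) (hg : ContDiffOn ℝ ∞ g U) (c : ℝ) (m n q : ℕ)
    {p : Space} (hp : p ∈ U) : pd m n q (fun p => c * g p) p = c * pd m n q g p := by
  have := pd_sum hU {()} (fun _ => c) (G := fun _ => g) (fun _ _ => hg) m n q hp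
  simpa using this

end PartialDerivatives

/-! ### Taylor expansion in a box -/

section Taylor

open Topology

lemma isOpen_openBox (l₁ l₂ : ℝ) : IsOpen (openBox l₁ l₂) :=
  isOpen_Ioo.prod (isOpen_Ioo.prod isOpen_Ioo)

lemma convex_openBox (l₁ l₂ : ℝ) : Convex ℝ (openBox l₁ l₂) :=
  (convex_Ioo _ _).prod ((convex_Ioo _ _).prod (convex_Ioo _ _))

lemma openBox_subset_closedBox (l₁ l₂ : ℝ) : openBox l₁ l₂ ⊆ closedBox l₁ l₂ :=
  Set.prod_mono Set.Ioo_subset_Icc_self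
    (Set.prod_mono Set.Ioo_subset_Icc_self Set.Ioo_subset_Icc_self)

/-- Taylor's theorem along a line. -/
lemma abs_sub_taylor_line_le {U : Set Space} (hU : IsOpen U) (hconv : Convex ℝ U)
    {g : Space → ℝ} (hg : ContDiffOn ℝ ∞ g U) {v p : Space} {δ B : ℝ} {n : ℕ} (hp : p ∈ U)
    (hpδ : p + δ • v ∈ U) (hB : ∀ q ∈ U, |(dirDeriv v)^[n + 1] g q| ≤ B) :
    |g (p + δ • v) - ∑ i ∈ Finset.range (n + 1),
      δ ^ i / (i.factorial : ℝ) * (dirDeriv v)^[i] g p| ≤ B * |δ| ^ (n + 1) := by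
  have hB0 : 0 ≤ B := (abs_nonneg _).trans (hB p hp)
  -- The Lagrange form of the remainder needs two distinct endpoints.
  rcases eq_or_ne (0 : ℝ) δ with rfl | hδ
  · rw [Finset.sum_range_succ']
    simp
  set γ : ℝ → Space := fun s => p + s • v with hγdef
  have hγ : ∀ s, HasDerivAt γ v s := fun s => by
    have := ((hasDerivAt_id s).smul_const v).const_add p
    rwa [one_smul] at this
  have hγc : ContDiff ℝ ∞ γ := contDiff_const.add (contDiff_id.smul contDiff_const)
  have h0 : γ 0 = p := by simp [hγdef]
  have hmem : ∀ s ∈ Set.uIcc 0 δ, γ s ∈ U := by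
    intro s hs
    have hpre : Convex ℝ (γ ⁻¹' U) := by
      intro s hs s' hs' a b ha hb hab
      have : γ (a • s + b • s') = a • γ s + b • γ s' := by
        obtain rfl : a = 1 - b := by linarith
        simp only [hγdef, smul_eq_mul]
        module
      rw [Set.mem_preimage, this]
      exact hconv hs hs' ha hb hab
    exact (hpre.ordConnected.uIcc_subset (show γ 0 ∈ U by rwa [h0]) hpδ) hs
  have hat : ∀ s ∈ Set.uIcc 0 δ, ContDiffAt ℝ ∞ (fun s => g (γ s)) s := fun s hs =>
    (hg.contDiffAt (hU.mem_nhds (hmem s hs))).comp s hγc.contDiffAt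
  obtain ⟨s, hs, h⟩ := taylor_mean_remainder_lagrange_iteratedDeriv (f := fun s => g (γ s))
    (n := n) hδ (fun s hs => ((hat s hs).of_le (by exact_mod_cast le_top)).contDiffWithinAt)
  have hs' : s ∈ Set.uIcc 0 δ := ⟨hs.1.le, hs.2.le⟩
  have hT : taylorWithinEval (fun s => g (γ s)) n (Set.uIcc 0 δ) 0 δ =
      ∑ i ∈ Finset.range (n + 1), δ ^ i / (i.factorial : ℝ) * (dirDeriv v)^[i] g p := by
    rw [taylor_within_apply]
    refine Finset.sum_congr rfl fun i _ => ?_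
    rw [iteratedDerivWithin_eq_iteratedDeriv (uniqueDiffOn_uIcc hδ)
      ((hat 0 Set.left_mem_uIcc).of_le (by exact_mod_cast le_top)) Set.left_mem_uIcc,
      iteratedDeriv_comp_line hU hg hγ i 0 (hmem 0 Set.left_mem_uIcc), h0, sub_zero, smul_eq_mul]
    ring
  rw [hT, iteratedDeriv_comp_line hU hg hγ _ s (hmem s hs'), sub_zero] at h
  have hfac : (1 : ℝ) ≤ ((n + 1).factorial : ℝ) := by
    exact_mod_cast Nat.factorial_pos _
  show |g (γ δ) - _| ≤ _
  rw [h, abs_div, abs_mul, abs_pow, Nat.abs_cast]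
  exact (div_le_self (by positivity) hfac).trans
    (mul_le_mul_of_nonneg_right (hB _ (hmem s hs')) (by positivity))

/-- The Taylor polynomial of degree five. -/
def taylorPoly5 (g : Space → ℝ) (p δ : Space) : ℝ :=
  ∑ f ∈ degLE 5, δ.1 ^ f.1 * δ.2.1 ^ f.2.1 * δ.2.2 ^ f.2.2
    / ((f.1.factorial * f.2.1.factorial * f.2.2.factorial : ℕ) : ℝ) * pd f.1 f.2.1 f.2.2 g p

lemma sum_degLE_five_rev (φ : ℕ × ℕ × ℕ → ℝ) :
    ∑ f ∈ degLE 5, φ f = ∑ c ∈ Finset.range 6, ∑ b ∈ Finset.range (6 - c),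
      ∑ a ∈ Finset.range (6 - c - b), φ (a, b, c) := by
  rw [sum_degLE_five]
  simp [Finset.sum_range_succ]
  ring

lemma abs_sum_mul_sub_le (N : ℕ) (x y w : ℕ → ℝ) (E : ℝ)
    (h : ∀ i ∈ Finset.range N, |w i| * |x i - y i| ≤ E) :
    |∑ i ∈ Finset.range N, w i * x i - ∑ i ∈ Finset.range N, w i * y i| ≤ N * E := by
  rw [← Finset.sum_sub_distrib]
  refine (Finset.abs_sum_le_sum_abs _ _).trans ?_
  refine (Finset.sum_le_sum (g := fun _ => E) fun i hi => ?_).trans (by simp)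
  rw [← mul_sub, abs_mul]
  exact h i hi

lemma abs_pow_div_factorial_le {δ h : ℝ} (hδ : |δ| ≤ h) (i : ℕ) :
    |δ ^ i / (i.factorial : ℝ)| ≤ h ^ i := by
  have hfac : (1 : ℝ) ≤ (i.factorial : ℝ) := by
    exact_mod_cast Nat.factorial_pos _
  rw [abs_div, abs_pow, Nat.abs_cast]
  exact (div_le_self (by positivity) hfac).trans (pow_le_pow_left₀ (abs_nonneg _) hδ i)

/-- The function is expanded in `z`, then its `z`-derivatives in `y`, then the results in `x`, along
edges that stay in the box. Each expansion stops so that its remainder contains a derivative of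
total order exactly six and is at most `M h⁶` after weighting. The constant is `43 = 1 + 6 (1 + 6)`,
with at most six terms per sum. -/
lemma abs_sub_taylorPoly5_le_of_mem {l₁ l₂ : ℝ} {g : Space → ℝ}
    (hg : ContDiffOn ℝ ∞ g (openBox l₁ l₂)) {M h : ℝ}
    (hM : ∀ m n q : ℕ, m + n + q ≤ 6 → ∀ p ∈ openBox l₁ l₂, |pd m n q g p| ≤ M)
    {p δ : Space} (hp : p ∈ openBox l₁ l₂) (hpδ : p + δ ∈ openBox l₁ l₂)
    (h1 : |δ.1| ≤ h) (h2 : |δ.2.1| ≤ h) (h3 : |δ.2.2| ≤ h) :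
    |g (p + δ) - taylorPoly5 g p δ| ≤ 43 * (M * h ^ 6) := by
  obtain ⟨x, y, z⟩ := p
  obtain ⟨δ₁, δ₂, δ₃⟩ := δ
  simp only at h1 h2 h3
  have hU := isOpen_openBox l₁ l₂
  have hC := convex_openBox l₁ l₂
  have hs := fun {g : Space → ℝ} (hg : ContDiffOn ℝ ∞ g (openBox l₁ l₂)) v m =>
    contDiffOn_iterate_dirDeriv hU hg v m
  have hh : 0 ≤ h := (abs_nonneg _).trans h1
  have hM0 : 0 ≤ M := (abs_nonneg _).trans (hM 0 0 0 (by norm_num) _ hp)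
  have hpx : ((x + δ₁, y, z) : Space) ∈ openBox l₁ l₂ := ⟨hpδ.1, hp.2⟩
  have hpxy : ((x + δ₁, y + δ₂, z) : Space) ∈ openBox l₁ l₂ := ⟨hpδ.1, hpδ.2.1, hp.2.2⟩
  have ex : ((x + δ₁, y, z) : Space) = (x, y, z) + δ₁ • dirX := by simp [dirX]
  have ey : ((x + δ₁, y + δ₂, z) : Space) = (x + δ₁, y, z) + δ₂ • dirY := by simp [dirY]
  have ez : ((x, y, z) + (δ₁, δ₂, δ₃) : Space) = (x + δ₁, y + δ₂, z) + δ₃ • dirZ := by simp [dirZ]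
  have hbound : ∀ {E : ℝ} {δ : ℝ} {c n : ℕ}, |δ| ≤ h → n ≤ 6 → c + n = 6 →
      E ≤ M * |δ| ^ n → h ^ c * E ≤ M * h ^ 6 := by
    intro E δ c n hδ _ hcn hE
    calc h ^ c * E ≤ h ^ c * (M * h ^ n) :=
          mul_le_mul_of_nonneg_left (hE.trans (mul_le_mul_of_nonneg_left
            (pow_le_pow_left₀ (abs_nonneg _) hδ n) hM0)) (by positivity)
      _ = M * h ^ 6 := by rw [← hcn, pow_add]; ring
  set Dz := fun c => (dirDeriv dirZ)^[c] g with hDz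
  set Dy := fun c b => (dirDeriv dirY)^[b] (Dz c) with hDy
  set Dx := fun c b a => (dirDeriv dirX)^[a] (Dy c b) with hDx
  have hpd : ∀ c b a, ∀ p ∈ openBox l₁ l₂, pd a b c g p = Dx c b a p := fun c b a p hp =>
    pd_eqOn hU hg a b c hp
  -- the three successive expansions
  have sz : |g ((x, y, z) + (δ₁, δ₂, δ₃)) - ∑ c ∈ Finset.range 6,
      δ₃ ^ c / (c.factorial : ℝ) * Dz c (x + δ₁, y + δ₂, z)| ≤ M * h ^ 6 := by
    rw [ez]
    have := abs_sub_taylor_line_le hU hC hg (n := 5) (B := M) hpxy (ez ▸ hpδ) (fun q hq => by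
      have := hM 0 0 6 (by norm_num) q hq
      rwa [hpd _ _ _ q hq] at this)
    have h' := hbound (c := 0) h3 le_rfl rfl this
    rwa [pow_zero, one_mul] at h'
  have sy : ∀ c ∈ Finset.range 6, h ^ c * |Dz c (x + δ₁, y + δ₂, z) -
      ∑ b ∈ Finset.range (6 - c), δ₂ ^ b / (b.factorial : ℝ) * Dy c b (x + δ₁, y, z)|
      ≤ M * h ^ 6 := by
    intro c hc
    rw [Finset.mem_range] at hc
    obtain ⟨n, hn⟩ : ∃ n, 6 - c = n + 1 := ⟨5 - c, by omega⟩
    rw [hn, ey]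
    have := abs_sub_taylor_line_le hU hC (hs hg dirZ c) (n := n) (B := M) hpx (ey ▸ hpxy)
      (fun q hq => by
        have := hM 0 (n + 1) c (by omega) q hq
        rwa [hpd _ _ _ q hq] at this)
    exact hbound h2 (by omega) (by omega) this
  have sx : ∀ c ∈ Finset.range 6, ∀ b ∈ Finset.range (6 - c), h ^ (c + b) * |Dy c b (x + δ₁, y, z) -
      ∑ a ∈ Finset.range (6 - c - b), δ₁ ^ a / (a.factorial : ℝ) * Dx c b a (x, y, z)|
      ≤ M * h ^ 6 := by
    intro c hc b hb
    rw [Finset.mem_range] at hc hb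
    obtain ⟨n, hn⟩ : ∃ n, 6 - c - b = n + 1 := ⟨5 - c - b, by omega⟩
    rw [hn, ex]
    have := abs_sub_taylor_line_le hU hC (hs (hs hg dirZ c) dirY b) (n := n) (B := M) hp (ex ▸ hpx)
      (fun q hq => by
        have := hM (n + 1) b c (by omega) q hq
        rwa [hpd _ _ _ q hq] at this)
    exact hbound h1 (by omega) (by omega) this
  have sxy : ∀ c ∈ Finset.range 6, h ^ c * |∑ b ∈ Finset.range (6 - c),
      δ₂ ^ b / (b.factorial : ℝ) * Dy c b (x + δ₁, y, z) - ∑ b ∈ Finset.range (6 - c),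
      δ₂ ^ b / (b.factorial : ℝ) * ∑ a ∈ Finset.range (6 - c - b),
        δ₁ ^ a / (a.factorial : ℝ) * Dx c b a (x, y, z)| ≤ 6 * (M * h ^ 6) := by
    intro c hc
    have hE : (0 : ℝ) ≤ M * h ^ 6 := by positivity
    rw [← abs_of_nonneg (pow_nonneg hh c), ← abs_mul, mul_sub, Finset.mul_sum, Finset.mul_sum]
    simp only [← mul_assoc (h ^ c)]
    refine (abs_sum_mul_sub_le _ _ _ _ (M * h ^ 6) fun b hb => ?_).trans
      (mul_le_mul_of_nonneg_right ?_ hE)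
    · refine le_trans ?_ (sx c hc b hb)
      refine mul_le_mul_of_nonneg_right ?_ (abs_nonneg _)
      rw [abs_mul, abs_of_nonneg (pow_nonneg hh c), pow_add]
      exact mul_le_mul_of_nonneg_left (abs_pow_div_factorial_le h2 b) (by positivity)
    · exact_mod_cast Nat.sub_le 6 c
  have hT : taylorPoly5 g (x, y, z) (δ₁, δ₂, δ₃) = ∑ c ∈ Finset.range 6,
      δ₃ ^ c / (c.factorial : ℝ) * ∑ b ∈ Finset.range (6 - c),
      δ₂ ^ b / (b.factorial : ℝ) * ∑ a ∈ Finset.range (6 - c - b),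
        δ₁ ^ a / (a.factorial : ℝ) * Dx c b a (x, y, z) := by
    rw [taylorPoly5, sum_degLE_five_rev]
    simp only [Finset.mul_sum, hpd _ _ _ _ hp]
    refine Finset.sum_congr rfl fun c _ => Finset.sum_congr rfl fun b _ =>
      Finset.sum_congr rfl fun a _ => ?_
    push_cast
    field_simp
  have t1 := abs_sum_mul_sub_le 6 (fun c => Dz c (x + δ₁, y + δ₂, z)) (fun c =>
      ∑ b ∈ Finset.range (6 - c), δ₂ ^ b / (b.factorial : ℝ) * ∑ a ∈ Finset.range (6 - c - b),
        δ₁ ^ a / (a.factorial : ℝ) * Dx c b a (x, y, z))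
    (fun c => δ₃ ^ c / (c.factorial : ℝ)) (7 * (M * h ^ 6)) (fun c hc => by
      refine (mul_le_mul_of_nonneg_right (abs_pow_div_factorial_le h3 c) (abs_nonneg _)).trans ?_
      have h1 := sy c hc
      have h2 := sxy c hc
      have h3 := mul_le_mul_of_nonneg_left (abs_sub_le (Dz c (x + δ₁, y + δ₂, z))
        (∑ b ∈ Finset.range (6 - c), δ₂ ^ b / (b.factorial : ℝ) * Dy c b (x + δ₁, y, z))
        (∑ b ∈ Finset.range (6 - c), δ₂ ^ b / (b.factorial : ℝ) * ∑ a ∈ Finset.range (6 - c - b),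
          δ₁ ^ a / (a.factorial : ℝ) * Dx c b a (x, y, z))) (pow_nonneg hh c)
      linarith)
  rw [← hT] at t1
  have t2 := abs_sub_le (g ((x, y, z) + (δ₁, δ₂, δ₃))) (∑ c ∈ Finset.range 6,
    δ₃ ^ c / (c.factorial : ℝ) * Dz c (x + δ₁, y + δ₂, z))
    (taylorPoly5 g (x, y, z) (δ₁, δ₂, δ₃))
  push_cast at t1
  linarith

/-- Taylor's theorem for a function that is smooth in the open box and continuous up to the
boundary, on which the displaced point may lie. -/
lemma abs_sub_taylorPoly5_le {l₁ l₂ : ℝ} {g : Space → ℝ}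
    (hg : ContDiffOn ℝ ∞ g (closedBox l₁ l₂)) {M h : ℝ}
    (hM : ∀ m n q : ℕ, m + n + q ≤ 6 → ∀ p ∈ openBox l₁ l₂, |pd m n q g p| ≤ M)
    {p δ : Space} (hp : p ∈ openBox l₁ l₂) (hpδ : p + δ ∈ closedBox l₁ l₂)
    (h1 : |δ.1| ≤ h) (h2 : |δ.2.1| ≤ h) (h3 : |δ.2.2| ≤ h) :
    |g (p + δ) - taylorPoly5 g p δ| ≤ 43 * (M * h ^ 6) := by
  have hpath : Continuous fun s : ℝ => p + s • δ := by fun_prop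
  have hIoo : ∀ {a b s : ℝ}, a ∈ Set.Ioo l₁ l₂ → a + b ∈ Set.Icc l₁ l₂ → s ∈ Set.Ico (0 : ℝ) 1 →
      a + s * b ∈ Set.Ioo l₁ l₂ := by
    rintro a b s ⟨ha, ha'⟩ ⟨hb, hb'⟩ ⟨hs, hs'⟩
    constructor <;> nlinarith
  -- The segment stays in the open box before its endpoint, so the interior estimate holds for `s <
  -- 1` and passes to the limit `s → 1` by continuity.
  have hmem : ∀ s ∈ Set.Ico (0 : ℝ) 1, p + s • δ ∈ openBox l₁ l₂ := fun s hs =>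
    ⟨hIoo hp.1 hpδ.1 hs, hIoo hp.2.1 hpδ.2.1 hs, hIoo hp.2.2 hpδ.2.2 hs⟩
  have habs : ∀ {b s : ℝ}, |b| ≤ h → s ∈ Set.Ico (0 : ℝ) 1 → |s * b| ≤ h := by
    rintro b s hb ⟨hs, hs'⟩
    rw [abs_mul, abs_of_nonneg hs]
    nlinarith [abs_nonneg b]
  have hineq : ∀ s ∈ Set.Ico (0 : ℝ) 1,
      |g (p + s • δ) - taylorPoly5 g p (s • δ)| ≤ 43 * (M * h ^ 6) := fun s hs =>
    abs_sub_taylorPoly5_le_of_mem (hg.mono (openBox_subset_closedBox _ _)) hM hp (hmem s hs)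
      (habs h1 hs) (habs h2 hs) (habs h3 hs)
  have hlim : Filter.Tendsto (fun s : ℝ => |g (p + s • δ) - taylorPoly5 g p (s • δ)|)
      (𝓝[Set.Ico 0 1] 1) (𝓝 |g (p + δ) - taylorPoly5 g p δ|) := by
    refine (Filter.Tendsto.sub ?_ ?_).abs
    · have hc := hg.continuousOn.continuousWithinAt hpδ
      refine hc.tendsto.comp (tendsto_nhdsWithin_iff.2 ⟨?_, ?_⟩)
      · have := hpath.tendsto 1
        rw [one_smul] at this
        exact this.mono_left nhdsWithin_le_nhds
      · filter_upwards [self_mem_nhdsWithin] with s hs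
        exact openBox_subset_closedBox _ _ (hmem s hs)
    · have hcont : Continuous fun s : ℝ => taylorPoly5 g p (s • δ) := by
        unfold taylorPoly5
        fun_prop
      have := hcont.tendsto 1
      rw [one_smul] at this
      exact this.mono_left nhdsWithin_le_nhds
  have hne : (𝓝[Set.Ico (0 : ℝ) 1] 1).NeBot := by
    rw [← mem_closure_iff_nhdsWithin_neBot, closure_Ico (by norm_num)]
    norm_num
  refine le_of_tendsto hlim ?_
  filter_upwards [self_mem_nhdsWithin] with s hs
  exact hineq s hs

end Taylor

/-! ### Uniform bounds for the derivatives of the coefficients -/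

section UniformBounds

variable {l₁ l₂ T : ℝ}

/-- On `[0, T] × Ω` the function agrees with one that is smooth on the closure. -/
def ExtendsSmoothly (l₁ l₂ T : ℝ) (g : ℝ → Space → ℝ) : Prop :=
  ∃ G : ℝ × Space → ℝ, ContDiffOn ℝ ∞ G (Set.Icc 0 T ×ˢ closedBox l₁ l₂) ∧
    ∀ t ∈ Set.Icc 0 T, ∀ p ∈ openBox l₁ l₂, g t p = G (t, p)

lemma SmoothOn.extendsSmoothly {g : ℝ → Space → ℝ} (hg : SmoothOn l₁ l₂ T g) :
    ExtendsSmoothly l₁ l₂ T g :=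
  ⟨_, hg, fun _ _ _ _ => rfl⟩

lemma ExtendsSmoothly.contDiffOn {g : ℝ → Space → ℝ} (hg : ExtendsSmoothly l₁ l₂ T g) {t : ℝ}
    (ht : t ∈ Set.Icc 0 T) : ContDiffOn ℝ ∞ (g t) (openBox l₁ l₂) := by
  obtain ⟨G, hG, h⟩ := hg
  have : ContDiffOn ℝ ∞ (fun p : Space => G (t, p)) (openBox l₁ l₂) :=
    hG.comp (contDiff_prodMk_right t).contDiffOn
      fun p hp => ⟨ht, openBox_subset_closedBox l₁ l₂ hp⟩
  exact this.congr fun p hp => h t ht p hp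

lemma uniqueDiffOn_cylinder (hl : l₁ < l₂) (hT : 0 < T) :
    UniqueDiffOn ℝ (Set.Icc 0 T ×ˢ closedBox l₁ l₂) :=
  (uniqueDiffOn_Icc hT).prod ((uniqueDiffOn_Icc hl).prod
    ((uniqueDiffOn_Icc hl).prod (uniqueDiffOn_Icc hl)))

lemma isCompact_cylinder (l₁ l₂ T : ℝ) : IsCompact (Set.Icc 0 T ×ˢ closedBox l₁ l₂) :=
  isCompact_Icc.prod (isCompact_Icc.prod (isCompact_Icc.prod isCompact_Icc))

/-- The derivative of the extension within the closed cylinder is smooth up to the boundary and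
agrees with the ordinary spatial derivative in the open box. The class is thus closed under `pd`,
and compactness bounds its members. -/
lemma ExtendsSmoothly.dirDeriv (hl : l₁ < l₂) (hT : 0 < T) {g : ℝ → Space → ℝ}
    (hg : ExtendsSmoothly l₁ l₂ T g) (v : Space) :
    ExtendsSmoothly l₁ l₂ T fun t => dirDeriv v (g t) := by
  obtain ⟨G, hG, h⟩ := hg
  refine ⟨fun q => fderivWithin ℝ G (Set.Icc 0 T ×ˢ closedBox l₁ l₂) q (0, v),
    (hG.fderivWithin (uniqueDiffOn_cylinder hl hT) (m := ∞) (by simp)).clm_apply contDiffOn_const,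
    fun t ht p hp => ?_⟩
  have hU := isOpen_openBox l₁ l₂
  refine (dirDeriv_congr hU (fun p hp => h t ht p hp) v hp).trans ?_
  have hq : (t, p) ∈ Set.Icc 0 T ×ˢ closedBox l₁ l₂ := ⟨ht, openBox_subset_closedBox l₁ l₂ hp⟩
  have h1 : HasFDerivWithinAt G (fderivWithin ℝ G (Set.Icc 0 T ×ˢ closedBox l₁ l₂) (t, p))
      (Set.Icc 0 T ×ˢ closedBox l₁ l₂) (t, p) :=
    (hG.differentiableOn (by simp) _ hq).hasFDerivWithinAt
  have h2 : HasFDerivWithinAt (fun p : Space => ((t, p) : ℝ × Space))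
      (ContinuousLinearMap.inr ℝ ℝ Space) (openBox l₁ l₂) p :=
    (hasFDerivAt_prodMk_right t p).hasFDerivWithinAt
  have h3 := (h1.comp p h2 fun p hp => ⟨ht, openBox_subset_closedBox l₁ l₂ hp⟩).hasFDerivAt
    (hU.mem_nhds hp)
  show fderiv ℝ (fun p => G (t, p)) p v = _
  have h4 : fderiv ℝ (fun p => G (t, p)) p = _ := h3.fderiv
  rw [h4]
  rfl

lemma ExtendsSmoothly.congr {g g' : ℝ → Space → ℝ} (hg : ExtendsSmoothly l₁ l₂ T g)
    (h : ∀ t ∈ Set.Icc 0 T, Set.EqOn (g' t) (g t) (openBox l₁ l₂)) :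
    ExtendsSmoothly l₁ l₂ T g' := by
  obtain ⟨G, hG, h'⟩ := hg
  exact ⟨G, hG, fun t ht p hp => (h t ht hp).trans (h' t ht p hp)⟩

lemma ExtendsSmoothly.iterate_dirDeriv (hl : l₁ < l₂) (hT : 0 < T) {g : ℝ → Space → ℝ}
    (hg : ExtendsSmoothly l₁ l₂ T g) (v : Space) (m : ℕ) :
    ExtendsSmoothly l₁ l₂ T fun t => (CompactFDM.dirDeriv v)^[m] (g t) := by
  induction m with
  | zero => exact hg
  | succ m ih =>
    simp only [Function.iterate_succ_apply']
    exact ih.dirDeriv hl hT v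

lemma ExtendsSmoothly.pd (hl : l₁ < l₂) (hT : 0 < T) {g : ℝ → Space → ℝ}
    (hg : ExtendsSmoothly l₁ l₂ T g) (m n q : ℕ) :
    ExtendsSmoothly l₁ l₂ T fun t => pd m n q (g t) :=
  (((hg.iterate_dirDeriv hl hT dirZ q).iterate_dirDeriv hl hT dirY n).iterate_dirDeriv
    hl hT dirX m).congr fun _ ht => pd_eqOn (isOpen_openBox l₁ l₂) (hg.contDiffOn ht) m n q

lemma ExtendsSmoothly.exists_bound {g : ℝ → Space → ℝ} (hg : ExtendsSmoothly l₁ l₂ T g) :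
    ∃ B, ∀ t ∈ Set.Icc 0 T, ∀ p ∈ openBox l₁ l₂, |g t p| ≤ B := by
  obtain ⟨G, hG, h⟩ := hg
  obtain ⟨B, hB⟩ := (isCompact_cylinder l₁ l₂ T).exists_bound_of_continuousOn hG.continuousOn
  refine ⟨B, fun t ht p hp => ?_⟩
  rw [h t ht p hp]
  exact hB _ ⟨ht, openBox_subset_closedBox l₁ l₂ hp⟩

lemma ExtendsSmoothly.sub {g g' : ℝ → Space → ℝ} (hg : ExtendsSmoothly l₁ l₂ T g)
    (hg' : ExtendsSmoothly l₁ l₂ T g') : ExtendsSmoothly l₁ l₂ T fun t p => g t p - g' t p := by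
  obtain ⟨G, hG, h⟩ := hg
  obtain ⟨G', hG', h'⟩ := hg'
  exact ⟨fun q => G q - G' q, hG.sub hG', fun t ht p hp => by simp only [h t ht p hp, h' t ht p hp]⟩

lemma ExtendsSmoothly.neg {g : ℝ → Space → ℝ} (hg : ExtendsSmoothly l₁ l₂ T g) :
    ExtendsSmoothly l₁ l₂ T fun t p => -g t p := by
  obtain ⟨G, hG, h⟩ := hg
  exact ⟨fun q => -G q, hG.neg, fun t ht p hp => by simp only [h t ht p hp]⟩

lemma extendsSmoothly_const (x : ℝ) : ExtendsSmoothly l₁ l₂ T fun _ _ => x :=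
  ⟨fun _ => x, contDiffOn_const, fun _ _ _ _ => rfl⟩

variable {D : Data}

lemma ExtendsSmoothly.div_κ (hD : D.Regular l₁ l₂ T) {g : ℝ → Space → ℝ}
    (hg : ExtendsSmoothly l₁ l₂ T g) : ExtendsSmoothly l₁ l₂ T fun t p => g t p / D.κ t p := by
  obtain ⟨G, hG, h⟩ := hg
  refine ⟨fun q => G q / D.κ q.1 q.2, hG.div hD.smooth_κ
    fun q hq => (hD.κ_pos q.1 hq.1 q.2 hq.2).ne', fun t ht p hp => by simp only [h t ht p hp]⟩

lemma extendsSmoothly_a (hl : l₁ < l₂) (hT : 0 < T) (hD : D.Regular l₁ l₂ T) :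
    ExtendsSmoothly l₁ l₂ T D.a :=
  ((hD.smooth_κ.extendsSmoothly.pd hl hT 1 0 0).sub hD.smooth_α.extendsSmoothly).div_κ hD

lemma extendsSmoothly_b (hl : l₁ < l₂) (hT : 0 < T) (hD : D.Regular l₁ l₂ T) :
    ExtendsSmoothly l₁ l₂ T D.b :=
  ((hD.smooth_κ.extendsSmoothly.pd hl hT 0 1 0).sub hD.smooth_β.extendsSmoothly).div_κ hD

lemma extendsSmoothly_c (hl : l₁ < l₂) (hT : 0 < T) (hD : D.Regular l₁ l₂ T) :
    ExtendsSmoothly l₁ l₂ T D.c :=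
  ((hD.smooth_κ.extendsSmoothly.pd hl hT 0 0 1).sub hD.smooth_γ.extendsSmoothly).div_κ hD

lemma extendsSmoothly_d₁ (hD : D.Regular l₁ l₂ T) (meth : TimeMethod) :
    ExtendsSmoothly l₁ l₂ T (D.d₁ meth) :=
  (extendsSmoothly_const _).div_κ hD

lemma extendsSmoothly_d₂ (hD : D.Regular l₁ l₂ T) : ExtendsSmoothly l₁ l₂ T D.d₂ :=
  hD.smooth_lam.extendsSmoothly.neg.div_κ hD

lemma extendsSmoothly_f₁ (hD : D.Regular l₁ l₂ T) : ExtendsSmoothly l₁ l₂ T D.f₁ :=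
  hD.smooth_φ.extendsSmoothly.neg.div_κ hD

lemma contDiffOn_f₂ (hD : D.Regular l₁ l₂ T) (meth : TimeMethod) {t : ℝ} (ht : t ∈ Set.Icc 0 T)
    {w : ℕ → Space → ℝ} (hw : ∀ s, ContDiffOn ℝ ∞ (w s) (closedBox l₁ l₂)) :
    ContDiffOn ℝ ∞ (D.f₂ meth t w) (openBox l₁ l₂) := by
  have hw' := fun s => (hw s).mono (openBox_subset_closedBox l₁ l₂)
  have hκ := hD.smooth_κ.extendsSmoothly.contDiffOn ht
  have hne : ∀ p ∈ openBox l₁ l₂, D.κ t p ≠ 0 := fun p hp =>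
    (hD.κ_pos t ht p (openBox_subset_closedBox l₁ l₂ hp)).ne'
  refine ContDiffOn.div (ContDiffOn.neg ?_) hκ hne
  cases meth
  · exact contDiffOn_const.mul (hw' 0)
  · exact (((contDiffOn_const.mul (hw' 2)).sub (contDiffOn_const.mul (hw' 1))).add
      (contDiffOn_const.mul (hw' 0))).div_const 6
  · exact ((((contDiffOn_const.mul (hw' 3)).sub (contDiffOn_const.mul (hw' 2))).add
      (contDiffOn_const.mul (hw' 1))).sub (contDiffOn_const.mul (hw' 0))).div_const 12

/-- The derivatives of a solution of the semi-discrete equation satisfy the differentiated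
equation. The time step is kept out of the denominators. -/
lemma SolvesSemidiscrete.pd_eq (hl : l₁ < l₂) (hT : 0 < T) (hD : D.Regular l₁ l₂ T)
    {meth : TimeMethod} {τ t : ℝ} (hτ : τ ≠ 0) (ht : t ∈ Set.Icc 0 T) {v : Space → ℝ}
    {w : ℕ → Space → ℝ} (hv : ContDiffOn ℝ ∞ v (closedBox l₁ l₂))
    (hw : ∀ s, ContDiffOn ℝ ∞ (w s) (closedBox l₁ l₂))
    (h : SolvesSemidiscrete D meth l₁ l₂ τ t v w) (m n q : ℕ) {p : Space}
    (hp : p ∈ openBox l₁ l₂) :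
    τ * (pd (m + 2) n q v p + pd m (n + 2) q v p + pd m n (q + 2) v p
      + leibniz (fun i j k => pd i j k (D.a t) p) (fun i j k => pd (i + 1) j k v p) m n q
      + leibniz (fun i j k => pd i j k (D.b t) p) (fun i j k => pd i (j + 1) k v p) m n q
      + leibniz (fun i j k => pd i j k (D.c t) p) (fun i j k => pd i j (k + 1) v p) m n q
      + leibniz (fun i j k => pd i j k (D.d₂ t) p) (fun i j k => pd i j k v p) m n q)
      + leibniz (fun i j k => pd i j k (D.d₁ meth t) p) (fun i j k => pd i j k v p) m n q
    = τ * pd m n q (D.f₁ t) p + pd m n q (D.f₂ meth t w) p := by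
  have hU := isOpen_openBox l₁ l₂
  have hv' := hv.mono (openBox_subset_closedBox l₁ l₂)
  have hx := contDiffOn_pd hU hv'
  have ha := (extendsSmoothly_a hl hT hD).contDiffOn ht
  have hb := (extendsSmoothly_b hl hT hD).contDiffOn ht
  have hc := (extendsSmoothly_c hl hT hD).contDiffOn ht
  have hd₁ := (extendsSmoothly_d₁ hD meth).contDiffOn ht
  have hd₂ := (extendsSmoothly_d₂ hD).contDiffOn ht
  have hf₁ := (extendsSmoothly_f₁ hD).contDiffOn ht
  have hf₂ := contDiffOn_f₂ hD meth ht hw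
  have s1 := (hx 2 0 0).add (hx 0 2 0)
  have s2 := s1.add (hx 0 0 2)
  have s3 := s2.add (ha.mul (hx 1 0 0))
  have s4 := s3.add (hb.mul (hx 0 1 0))
  have s5 := s4.add (hc.mul (hx 0 0 1))
  have s6 := s5.add (hd₂.mul hv')
  -- The equation multiplied by `τ`, as an identity on an open set, may be differentiated term by
  -- term.
  have heq : Set.EqOn (fun p => τ * (pd 2 0 0 v p + pd 0 2 0 v p + pd 0 0 2 v p
      + D.a t p * pd 1 0 0 v p + D.b t p * pd 0 1 0 v p + D.c t p * pd 0 0 1 v p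
      + D.d₂ t p * v p) + D.d₁ meth t p * v p)
      (fun p => τ * D.f₁ t p + D.f₂ meth t w p) (openBox l₁ l₂) := by
    intro p hp
    have := h p hp
    field_simp at this
    simp only
    linear_combination this
  have hderiv := pd_congr hU ((contDiffOn_const.mul s6).add (hd₁.mul hv')) heq m n q hp
  rw [pd_add hU (contDiffOn_const.mul s6) (hd₁.mul hv') m n q hp, pd_const_mul hU s6 τ m n q hp,
    pd_add hU s5 (hd₂.mul hv') m n q hp, pd_add hU s4 (hc.mul (hx 0 0 1)) m n q hp,
    pd_add hU s3 (hb.mul (hx 0 1 0)) m n q hp, pd_add hU s2 (ha.mul (hx 1 0 0)) m n q hp,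
    pd_add hU s1 (hx 0 0 2) m n q hp, pd_add hU (hx 2 0 0) (hx 0 2 0) m n q hp,
    pd_mul hU ha (hx 1 0 0) m n q hp, pd_mul hU hb (hx 0 1 0) m n q hp,
    pd_mul hU hc (hx 0 0 1) m n q hp, pd_mul hU hd₂ hv' m n q hp, pd_mul hU hd₁ hv' m n q hp,
    pd_add hU (contDiffOn_const.mul hf₁) hf₂ m n q hp, pd_const_mul hU hf₁ τ m n q hp] at hderiv
  have e := fun m n q i j k => pd_pd hU hv' m n q i j k hp
  simp only [e, add_zero] at hderiv
  exact hderiv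

end UniformBounds

/-! ### The stencil applied to a solution -/

section Consistency

open Polynomial

variable {A B : Type*} [CommRing A] [Algebra ℝ A] [CommRing B] [Algebra ℝ B]

/-- The image of the coefficient jets under a map. -/
def SplitJets.map (φ : A → B) (Θ : SplitJets A) : SplitJets B where
  a i j k := φ (Θ.a i j k)
  b i j k := φ (Θ.b i j k)
  c i j k := φ (Θ.c i j k)
  d₁ i j k := φ (Θ.d₁ i j k)
  d₂ i j k := φ (Θ.d₂ i j k)

lemma scaled_map (φ : A →ₐ[ℝ] B) (Θ : SplitJets A) :
    Θ.scaled.map (mapRingHom (φ : A →+* B)) = (Θ.map φ).scaled := by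
  unfold SplitJets.scaled CoeffJets.map SplitJets.map
  simp

lemma map_expansion (φ : A →ₐ[ℝ] B) (V : ℕ → ℕ → ℕ → A) (i j k : SignType) :
    φ (expansion V i j k) = expansion (fun m n q => φ (V m n q)) i j k := by
  simp only [expansion, map_sum, map_smul]

lemma map_stencilSum (φ : A →ₐ[ℝ] B) (c : SignType → SignType → SignType → Fin 6 → A)
    (V : ℕ → ℕ → ℕ → A[X]) :
    (stencilSum c V).map (φ : A →+* B) =
      stencilSum (fun i j k p => φ (c i j k p)) (fun m n q => (V m n q).map (φ : A →+* B)) := by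
  have h : ∀ i j k, (expansion V i j k).map (φ : A →+* B) =
      expansion (fun m n q => (V m n q).map (φ : A →+* B)) i j k := fun i j k =>
    map_expansion (mapAlgHom φ) V i j k
  simp only [stencilSum, Polynomial.map_sum, Polynomial.map_mul, h, stencilPoly,
    Polynomial.map_pow, map_X, map_C]
  rfl

lemma map_fundamentalU (φ : A →ₐ[ℝ] B) (Θ : SplitJets A) (e : ℕ × ℕ × ℕ) (m n q : ℕ) :
    (fundamentalU Θ.scaled e m n q).map (φ : A →+* B) =
      fundamentalU (Θ.map φ).scaled e m n q := by
  rw [← coe_mapRingHom, fundamentalU, map_eliminate, scaled_map]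
  simp only [map_single, map_zero]
  rfl

lemma map_fundamentalF (φ : A →ₐ[ℝ] B) (Θ : SplitJets A) (e : ℕ × ℕ × ℕ) (m n q : ℕ) :
    (fundamentalF Θ.scaled e m n q).map (φ : A →+* B) =
      fundamentalF (Θ.map φ).scaled e m n q := by
  rw [← coe_mapRingHom, fundamentalF, map_eliminate, scaled_map]
  simp only [map_single, map_zero]
  rfl

/-- All constructions are natural in the algebra, so a stencil built over a ring of functions
specializes to an admissible stencil at each point. -/
lemma ScaledAdmissible.map (φ : A →ₐ[ℝ] B) {c : SignType → SignType → SignType → Fin 6 → A}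
    {Θ : SplitJets A} (hc : ScaledAdmissible c Θ) :
    ScaledAdmissible (fun i j k p => φ (c i j k p)) (Θ.map φ) := by
  refine ⟨fun e he s hs => ?_, ?_, ?_, fun i j k p h => ?_⟩
  · have h := congrArg φ (hc.order e he s hs)
    rw [map_zero] at h
    rw [← h, ← AlgHom.coe_toRingHom, ← coeff_map, map_stencilSum]
    simp only [map_fundamentalU]
    rfl
  · have h := congrArg φ hc.source
    rw [map_one] at h
    rw [← h, ← AlgHom.coe_toRingHom, ← coeff_map, map_stencilSum]
    simp only [map_fundamentalF]
    rfl
  · rw [hc.center, map_neg, map_ofNat]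
  · rw [hc.vanish i j k p h, map_zero]

lemma map_sourcePolynomial (φ : A →ₐ[ℝ] B) (c : SignType → SignType → SignType → Fin 6 → A)
    (Θ : SplitJets A) (φ₁ φ₂ : ℕ → ℕ → ℕ → A) :
    (sourcePolynomial c Θ φ₁ φ₂).map (φ : A →+* B) =
      sourcePolynomial (fun i j k p => φ (c i j k p)) (Θ.map φ) (fun m n q => φ (φ₁ m n q))
        (fun m n q => φ (φ₂ m n q)) := by
  simp only [sourcePolynomial, Polynomial.map_sum, Polynomial.map_mul, Polynomial.map_pow,
    Polynomial.map_add, map_X, map_C, map_stencilSum, map_fundamentalF]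
  rfl

/-- The part of `h Δv + ⋯` that does not contain `d₁`, differentiated `(m, n, q)` times. -/
def regularPart (Θ : SplitJets A) (V : ℕ → ℕ → ℕ → A) (m n q : ℕ) : A :=
  V (m + 2) n q + V m (n + 2) q + V m n (q + 2)
    + leibniz Θ.a (fun i j k => V (i + 1) j k) m n q
    + leibniz Θ.b (fun i j k => V i (j + 1) k) m n q
    + leibniz Θ.c (fun i j k => V i j (k + 1)) m n q + leibniz Θ.d₂ V m n q

/-- The derivatives of `f₂ / r` that the equation yields. -/
def historyJet (Θ : SplitJets A) (η : A) (V φ₁ : ℕ → ℕ → ℕ → A) (m n q : ℕ) : A :=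
  η * (regularPart Θ V m n q - φ₁ m n q) + leibniz Θ.d₁ V m n q

lemma leibniz_add_mul {S : Type*} [CommRing S] (η : S) (w w' g : ℕ → ℕ → ℕ → S) (m n q : ℕ) :
    leibniz (fun i j k => w i j k + η * w' i j k) g m n q =
      leibniz w g m n q + η * leibniz w' g m n q := by
  simp only [leibniz, Finset.mul_sum, ← Finset.sum_add_distrib]
  refine Finset.sum_congr rfl fun i _ => Finset.sum_congr rfl fun j _ =>
    Finset.sum_congr rfl fun k _ => by ring

/-- No assumption on `V` is needed, because `historyJet` is defined as the right-hand side that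
makes `V` a solution. It contains no division by `η`, so it makes sense in any algebra. -/
lemma solvesJet_scaled {S : Type*} [CommRing S] (Θ : SplitJets S) (η : S)
    (V φ₁ : ℕ → ℕ → ℕ → S) (m n q : ℕ) :
    SolvesJet (Θ.scaled.map (evalRingHom η)) (fun i j k => η ^ (i + j + k) * V i j k)
      (fun i j k => η ^ (i + j + k + 1) * (η * φ₁ i j k + historyJet Θ η V φ₁ i j k)) m n q := by
  have h1 := leibniz_scale η Θ.a (fun i j k => V (i + 1) j k) 1 1 m n q
  have h2 := leibniz_scale η Θ.b (fun i j k => V i (j + 1) k) 1 1 m n q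
  have h3 := leibniz_scale η Θ.c (fun i j k => V i j (k + 1)) 1 1 m n q
  have h4 := leibniz_scale η (fun i j k => Θ.d₁ i j k + η * Θ.d₂ i j k) V 1 0 m n q
  rw [leibniz_add_mul] at h4
  have e1 : (fun i j k => η ^ (i + 1 + j + k) * V (i + 1) j k) =
      fun i j k => η ^ (i + j + k + 1) * V (i + 1) j k := by
    funext i j k; congr 2; omega
  have e2 : (fun i j k => η ^ (i + (j + 1) + k) * V i (j + 1) k) =
      fun i j k => η ^ (i + j + k + 1) * V i (j + 1) k := by
    funext i j k; congr 2; omega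
  have hK : Θ.scaled.map (evalRingHom η) =
      ⟨fun i j k => η ^ (i + j + k + 1) * Θ.a i j k, fun i j k => η ^ (i + j + k + 1) * Θ.b i j k,
        fun i j k => η ^ (i + j + k + 1) * Θ.c i j k,
        fun i j k => η ^ (i + j + k + 1) * (Θ.d₁ i j k + η * Θ.d₂ i j k)⟩ := by
    simp only [SplitJets.scaled, CoeffJets.map, coe_evalRingHom, eval_mul, eval_pow, eval_X,
      eval_C, eval_add]
  simp only [add_zero] at h4
  unfold SolvesJet lowerOrder
  rw [hK]
  simp only
  rw [e1, e2, h1, h2, h4]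
  have h3' : leibniz (fun i j k => η ^ (i + j + k + 1) * Θ.c i j k)
      (fun i j k => η ^ (i + j + (k + 1)) * V i j (k + 1)) m n q =
      η ^ (m + n + q + 1 + 1) * leibniz Θ.c (fun i j k => V i j (k + 1)) m n q := h3
  rw [h3']
  simp only [historyJet, regularPart]
  ring

lemma eval_stencilSum (η : A) (c : SignType → SignType → SignType → Fin 6 → A)
    (V : ℕ → ℕ → ℕ → A[X]) :
    (stencilSum c V).eval η = ∑ i, ∑ j, ∑ k, (stencilPoly c i j k).eval η *
      expansion (fun m n q => (V m n q).eval η) i j k := by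
  have h : ∀ i j k, (expansion V i j k).eval η = expansion (fun m n q => (V m n q).eval η) i j k := by
    intro i j k
    simp only [expansion, eval_finsetSum, eval_smul]
  simp only [stencilSum, eval_finsetSum, eval_mul, h]

lemma expansion_sum {ι : Type*} (s : Finset ι) (x : ι → A) (V : ι → ℕ → ℕ → ℕ → A)
    (i j k : SignType) :
    expansion (fun m n q => ∑ e ∈ s, x e * V e m n q) i j k =
      ∑ e ∈ s, x e * expansion (V e) i j k := by
  simp only [expansion, Finset.smul_sum, Finset.mul_sum, mul_smul_comm]
  exact Finset.sum_comm

/-- The stencil applied to the Taylor polynomial of a solution. -/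
lemma sum_stencil_mul_expansion (Θ : SplitJets A) (η : A) (V φ₁ : ℕ → ℕ → ℕ → A)
    (c : SignType → SignType → SignType → Fin 6 → A) :
    ∑ i, ∑ j, ∑ k, (stencilPoly c i j k).eval η *
        expansion (fun m n q => η ^ (m + n + q) * V m n q) i j k =
      ∑ e ∈ Lam51, η ^ (e.1 + e.2.1 + e.2.2) * V e.1 e.2.1 e.2.2 *
        (stencilSum c (fundamentalU Θ.scaled e)).eval η
      + η * (sourcePolynomial c Θ φ₁ (historyJet Θ η V φ₁)).eval η := by
  set K := Θ.scaled.map (evalRingHom η) with hK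
  have hU : ∀ e m n q, (fundamentalU Θ.scaled e m n q).eval η = fundamentalU K e m n q := by
    intro e m n q
    rw [← coe_evalRingHom, fundamentalU, map_eliminate]
    simp only [map_single, map_zero]
    rfl
  have hF : ∀ e m n q, (fundamentalF Θ.scaled e m n q).eval η = fundamentalF K e m n q := by
    intro e m n q
    rw [← coe_evalRingHom, fundamentalF, map_eliminate]
    simp only [map_single, map_zero]
    rfl
  have hexp : ∀ i j k, expansion (fun m n q => η ^ (m + n + q) * V m n q) i j k =
      ∑ e ∈ Lam51, η ^ (e.1 + e.2.1 + e.2.2) * V e.1 e.2.1 e.2.2 *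
        expansion (fundamentalU K e) i j k
      + ∑ e ∈ degLE 3, η ^ (e.1 + e.2.1 + e.2.2 + 1) * (η * φ₁ e.1 e.2.1 e.2.2
        + historyJet Θ η V φ₁ e.1 e.2.1 e.2.2) * expansion (fundamentalF K e) i j k := by
    intro i j k
    rw [← expansion_sum Lam51 (fun e => η ^ (e.1 + e.2.1 + e.2.2) * V e.1 e.2.1 e.2.2)
      (fundamentalU K), ← expansion_sum (degLE 3) (fun e => η ^ (e.1 + e.2.1 + e.2.2 + 1) *
        (η * φ₁ e.1 e.2.1 e.2.2 + historyJet Θ η V φ₁ e.1 e.2.1 e.2.2)) (fundamentalF K)]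
    simp only [expansion, ← Finset.sum_add_distrib, ← smul_add]
    refine Finset.sum_congr rfl fun f hf => ?_
    congr 1
    exact eq_sum_fundamental (fun m n q _ => solvesJet_scaled Θ η V φ₁ m n q) _ _ _
      (mem_degLE.1 hf)
  have hdist : ∀ (s : Finset (ℕ × ℕ × ℕ)) (x : ℕ × ℕ × ℕ → A)
      (W : ℕ × ℕ × ℕ → SignType → SignType → SignType → A),
      ∑ i, ∑ j, ∑ k, (stencilPoly c i j k).eval η * ∑ e ∈ s, x e * W e i j k =
        ∑ e ∈ s, x e * ∑ i, ∑ j, ∑ k, (stencilPoly c i j k).eval η * W e i j k := by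
    intro s x W
    simp only [Finset.mul_sum]
    conv_rhs => rw [Finset.sum_comm]
    refine Finset.sum_congr rfl fun i _ => ?_
    conv_rhs => rw [Finset.sum_comm]
    refine Finset.sum_congr rfl fun j _ => ?_
    conv_rhs => rw [Finset.sum_comm]
    refine Finset.sum_congr rfl fun k _ => Finset.sum_congr rfl fun e _ => by ring
  simp only [hexp, mul_add, Finset.sum_add_distrib, sourcePolynomial, eval_finsetSum, eval_mul,
    eval_add, eval_pow, eval_X, eval_C, eval_stencilSum, hU, hF]
  rw [hdist Lam51]
  congr 1
  have h2 := hdist (degLE 3) (fun e => η ^ (e.1 + e.2.1 + e.2.2 + 1) *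
        (η * φ₁ e.1 e.2.1 e.2.2 + historyJet Θ η V φ₁ e.1 e.2.1 e.2.2))
    (fun e => expansion (fundamentalF K e))
  simp only [mul_add] at h2
  rw [h2, Finset.mul_sum]
  refine Finset.sum_congr rfl fun e _ => ?_
  ring

/-- The truncation error on the Taylor polynomial of a solution is of the order `h ^ 6`, before
division by `h ^ 2`. -/
lemma exists_truncation_error {c : SignType → SignType → SignType → Fin 6 → A} {Θ : SplitJets A}
    (hc : ScaledAdmissible c Θ) (η : A) (V φ₁ : ℕ → ℕ → ℕ → A) :
    ∃ y : A, ∑ i, ∑ j, ∑ k, (stencilPoly c i j k).eval η *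
        expansion (fun m n q => η ^ (m + n + q) * V m n q) i j k =
      η * ∑ s ∈ Finset.range 5,
        (sourcePolynomial c Θ φ₁ (historyJet Θ η V φ₁)).coeff s * η ^ s + η ^ 6 * y := by
  have h1 : η ^ 6 ∣ ∑ e ∈ Lam51, η ^ (e.1 + e.2.1 + e.2.2) * V e.1 e.2.1 e.2.2 *
        (stencilSum c (fundamentalU Θ.scaled e)).eval η := by
    refine Finset.dvd_sum fun e he => ?_
    -- The missing `6 - |e|` powers of `h` come from the order conditions; the other `|e|` come from
    -- the stretching.
    have hdvd : (X : A[X]) ^ (6 - (e.1 + e.2.1 + e.2.2)) ∣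
        stencilSum c (fundamentalU Θ.scaled e) :=
      X_pow_dvd_iff.2 fun s hs => hc.order e he s (by omega)
    obtain ⟨Q, hQ⟩ := hdvd
    have h6 : 6 = e.1 + e.2.1 + e.2.2 + (6 - (e.1 + e.2.1 + e.2.2)) := by
      have := (mem_Lam51.1 he).2
      omega
    refine ⟨V e.1 e.2.1 e.2.2 * Q.eval η, ?_⟩
    conv_rhs => rw [h6, pow_add]
    rw [hQ, eval_mul, eval_pow, eval_X]
    ring
  set S := sourcePolynomial c Θ φ₁ (historyJet Θ η V φ₁) with hS
  -- The terms dropped from `S` start at `h ^ 5`; the factor `η` in front makes them `O(h⁶)`.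
  have h2 : (X : A[X]) ^ 5 ∣ S - ∑ s ∈ Finset.range 5, C (S.coeff s) * X ^ s := by
    refine X_pow_dvd_iff.2 fun s hs => ?_
    simp [finsetSum_coeff, coeff_X_pow, hs]
  obtain ⟨y, hy⟩ := h1
  obtain ⟨Q, hQ⟩ := h2
  refine ⟨y + Q.eval η, ?_⟩
  rw [sum_stencil_mul_expansion Θ η V φ₁ c, hy, ← hS]
  have h3 := congrArg (eval η) hQ
  simp only [eval_sub, eval_mul, eval_finsetSum, eval_C, eval_pow, eval_X] at h3
  linear_combination η * h3

end Consistency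

/-! ### Uniformity -/

section Uniformity

open Polynomial

/-- The algebra of bounded real functions. -/
def boundedFunctions (Ω : Type*) : Subalgebra ℝ (Ω → ℝ) where
  carrier := {f | ∃ B, ∀ ξ, |f ξ| ≤ B}
  mul_mem' := by
    rintro f g ⟨B, hB⟩ ⟨B', hB'⟩
    refine ⟨B * B', fun ξ => ?_⟩
    rw [Pi.mul_apply, abs_mul]
    exact mul_le_mul (hB ξ) (hB' ξ) (abs_nonneg _) ((abs_nonneg _).trans (hB ξ))
  add_mem' := by
    rintro f g ⟨B, hB⟩ ⟨B', hB'⟩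
    exact ⟨B + B', fun ξ => (abs_add_le _ _).trans (add_le_add (hB ξ) (hB' ξ))⟩
  algebraMap_mem' x := ⟨|x|, fun _ => le_rfl⟩

/-- Evaluation of bounded functions at a point. -/
def evalAt {Ω : Type*} (ξ : Ω) : boundedFunctions Ω →ₐ[ℝ] ℝ :=
  (Pi.evalAlgHom ℝ (fun _ : Ω => ℝ) ξ).comp (boundedFunctions Ω).val

/-- A grid point together with known levels and a solution of the semi-discrete equation. -/
structure GridSolution (D : Data) (meth : TimeMethod) (l₁ l₂ T r M : ℝ) where
  h : ℝ
  t : ℝ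
  P : Space
  v : Space → ℝ
  w : ℕ → Space → ℝ
  h_pos : 0 < h
  h_le : h ≤ l₂ - l₁
  t_mem : t ∈ Set.Icc 0 T
  P_mem : P ∈ openBox l₁ l₂
  neighbour_mem : ∀ i j k : SignType, P + ((i : ℝ) * h, (j : ℝ) * h, (k : ℝ) * h) ∈ closedBox l₁ l₂
  smooth_v : ContDiffOn ℝ ∞ v (closedBox l₁ l₂)
  smooth_w : ∀ s, ContDiffOn ℝ ∞ (w s) (closedBox l₁ l₂)
  bound : ∀ m₁ m₂ m₃ : ℕ, m₁ + m₂ + m₃ ≤ 6 → ∀ p ∈ openBox l₁ l₂, |pd m₁ m₂ m₃ v p| ≤ M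
  solves : SolvesSemidiscrete D meth l₁ l₂ (r * h) t v w

variable {D : Data} {meth : TimeMethod} {l₁ l₂ T r M : ℝ}

lemma abs_sign_le_one (i : SignType) : |(i : ℝ)| ≤ 1 := by cases i <;> simp

/-- All data are collected into bounded functions of the configuration, the stencil is constructed
over their algebra, and evaluation at one configuration gives the real scheme. Boundedness of `E` is
then the uniform estimate. -/
lemma exists_error_function (hl : l₁ < l₂) (hT : 0 < T) (hr : 0 < r) (hD : D.Regular l₁ l₂ T) :
    ∃ E : boundedFunctions (GridSolution D meth l₁ l₂ T r M),
      ∀ (ξ : GridSolution D meth l₁ l₂ T r M) (c : Stencil),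
        c.Admissible (D.jets meth r ξ.t ξ.P) →
        c.lhsValue ξ.h ξ.v ξ.P
          - c.F (D.jets meth r ξ.t ξ.P) r ξ.h (D.f₁ ξ.t) (D.f₂ meth ξ.t ξ.w) ξ.P =
        ξ.h ^ 4 * evalAt ξ E := by
  set Ω := GridSolution D meth l₁ l₂ T r M with hΩ
  have hbounded : ∀ {g : ℝ → Space → ℝ}, ExtendsSmoothly l₁ l₂ T g → ∀ i j k : ℕ,
      (fun ξ : Ω => pd i j k (g ξ.t) ξ.P) ∈ boundedFunctions Ω := by
    intro g hg i j k
    obtain ⟨B, hB⟩ := (hg.pd hl hT i j k).exists_bound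
    exact ⟨B, fun ξ => hB _ ξ.t_mem _ ξ.P_mem⟩
  have hd₁ : ∀ i j k : ℕ, (fun ξ : Ω => pd i j k (D.d₁ meth ξ.t) ξ.P / r) ∈ boundedFunctions Ω := by
    intro i j k
    obtain ⟨B, hB⟩ := hbounded (extendsSmoothly_d₁ hD meth) i j k
    refine ⟨B / r, fun ξ => ?_⟩
    rw [abs_div, abs_of_pos hr]
    exact div_le_div_of_nonneg_right (hB ξ) hr.le
  let Θ : SplitJets (boundedFunctions Ω) :=
    { a := fun i j k => ⟨_, hbounded (extendsSmoothly_a hl hT hD) i j k⟩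
      b := fun i j k => ⟨_, hbounded (extendsSmoothly_b hl hT hD) i j k⟩
      c := fun i j k => ⟨_, hbounded (extendsSmoothly_c hl hT hD) i j k⟩
      d₁ := fun i j k => ⟨_, hd₁ i j k⟩
      d₂ := fun i j k => ⟨_, hbounded (extendsSmoothly_d₂ hD) i j k⟩ }
  let φ₁ : ℕ → ℕ → ℕ → boundedFunctions Ω :=
    fun i j k => ⟨_, hbounded (extendsSmoothly_f₁ hD) i j k⟩
  let η : boundedFunctions Ω :=
    ⟨fun ξ => ξ.h, l₂ - l₁, fun ξ => by rw [abs_of_pos ξ.h_pos]; exact ξ.h_le⟩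
  -- Derivatives of order above six are not controlled and are replaced by zero; the expansion and
  -- the source terms use only orders up to five.
  let V : ℕ → ℕ → ℕ → boundedFunctions Ω := fun i j k =>
    ⟨fun ξ => if i + j + k ≤ 6 then pd i j k ξ.v ξ.P else 0, |M|, fun ξ => by
      split_ifs with h6
      · exact (ξ.bound i j k h6 _ ξ.P_mem).trans (le_abs_self M)
      · simp⟩
  -- The Taylor remainders divided by `h⁶`.
  let ρ : SignType → SignType → SignType → boundedFunctions Ω := fun i j k =>
    ⟨fun ξ => (ξ.v (ξ.P + ((i : ℝ) * ξ.h, (j : ℝ) * ξ.h, (k : ℝ) * ξ.h))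
        - taylorPoly5 ξ.v ξ.P ((i : ℝ) * ξ.h, (j : ℝ) * ξ.h, (k : ℝ) * ξ.h)) / ξ.h ^ 6,
      43 * M, fun ξ => by
        have hle : ∀ i : SignType, |(i : ℝ) * ξ.h| ≤ ξ.h := fun i => by
          rw [abs_mul, abs_of_pos ξ.h_pos]
          exact mul_le_of_le_one_left ξ.h_pos.le (abs_sign_le_one i)
        have h6 : 0 < ξ.h ^ 6 := pow_pos ξ.h_pos 6
        rw [abs_div, abs_of_pos h6, div_le_iff₀ h6]
        refine (abs_sub_taylorPoly5_le ξ.smooth_v ξ.bound ξ.P_mem (ξ.neighbour_mem i j k)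
          (hle i) (hle j) (hle k)).trans (by rw [mul_assoc])⟩
  obtain ⟨c, hc⟩ := exists_scaledAdmissible Θ
  obtain ⟨y, hy⟩ := exists_truncation_error hc η V φ₁
  refine ⟨y + ∑ i, ∑ j, ∑ k, (stencilPoly c i j k).eval η * ρ i j k, fun ξ c' hc' => ?_⟩
  -- By uniqueness any admissible real stencil is the value of the stencil with bounded
  -- coefficients, so its coefficients are bounded uniformly.
  have hcξ : c' = fun i j k p => evalAt ξ (c i j k p) :=
    (admissible_iff.1 hc').unique (hc.map (evalAt ξ))
  have hh : ξ.h ≠ 0 := ξ.h_pos.ne'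
  have hη : evalAt ξ η = ξ.h := rfl
  -- the derivatives of the known levels
  have hf₂ : ∀ e ∈ degLE 3, evalAt ξ (historyJet Θ η V φ₁ e.1 e.2.1 e.2.2) =
      pd e.1 e.2.1 e.2.2 (D.f₂ meth ξ.t ξ.w) ξ.P / r := by
    rintro ⟨m, n, q⟩ he
    have he3 : m + n + q ≤ 3 := mem_degLE.1 he
    have hV : ∀ i j k, i + j + k ≤ 6 → evalAt ξ (V i j k) = pd i j k ξ.v ξ.P :=
      fun i j k h => if_pos h
    have hmap := fun (w g : ℕ → ℕ → ℕ → boundedFunctions Ω) =>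
      map_leibniz (evalAt ξ : boundedFunctions Ω →+* ℝ) w g m n q
    simp only [RingHom.coe_coe] at hmap
    have hpde := ξ.solves.pd_eq hl hT hD (mul_pos hr ξ.h_pos).ne' ξ.t_mem ξ.smooth_v ξ.smooth_w
      m n q ξ.P_mem
    have l1 : evalAt ξ (leibniz Θ.a (fun i j k => V (i + 1) j k) m n q) =
        leibniz (fun i j k => pd i j k (D.a ξ.t) ξ.P)
          (fun i j k => pd (i + 1) j k ξ.v ξ.P) m n q :=
      (hmap _ _).trans (leibniz_congr fun i j k hi hj hk => hV _ _ _ (by omega))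
    have l2 : evalAt ξ (leibniz Θ.b (fun i j k => V i (j + 1) k) m n q) =
        leibniz (fun i j k => pd i j k (D.b ξ.t) ξ.P)
          (fun i j k => pd i (j + 1) k ξ.v ξ.P) m n q :=
      (hmap _ _).trans (leibniz_congr fun i j k hi hj hk => hV _ _ _ (by omega))
    have l3 : evalAt ξ (leibniz Θ.c (fun i j k => V i j (k + 1)) m n q) =
        leibniz (fun i j k => pd i j k (D.c ξ.t) ξ.P)
          (fun i j k => pd i j (k + 1) ξ.v ξ.P) m n q :=
      (hmap _ _).trans (leibniz_congr fun i j k hi hj hk => hV _ _ _ (by omega))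
    have l4 : evalAt ξ (leibniz Θ.d₂ V m n q) =
        leibniz (fun i j k => pd i j k (D.d₂ ξ.t) ξ.P) (fun i j k => pd i j k ξ.v ξ.P) m n q :=
      (hmap _ _).trans (leibniz_congr fun i j k hi hj hk => hV _ _ _ (by omega))
    have l5 : evalAt ξ (leibniz Θ.d₁ V m n q) =
        leibniz (fun i j k => pd i j k (D.d₁ meth ξ.t) ξ.P)
          (fun i j k => pd i j k ξ.v ξ.P) m n q / r := by
      refine ((hmap _ _).trans (leibniz_congr (g' := fun i j k => pd i j k ξ.v ξ.P)
        fun i j k hi hj hk => hV _ _ _ (by omega))).trans ?_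
      show leibniz (fun i j k => pd i j k (D.d₁ meth ξ.t) ξ.P / r) _ m n q = _
      simp only [leibniz, Finset.sum_div]
      refine Finset.sum_congr rfl fun i _ => Finset.sum_congr rfl fun j _ =>
        Finset.sum_congr rfl fun k _ => by ring
    have hφ : evalAt ξ (φ₁ m n q) = pd m n q (D.f₁ ξ.t) ξ.P := rfl
    simp only [historyJet, regularPart, map_add, map_mul, map_sub, l1, l2, l3, l4, l5, hφ, hη]
    rw [hV _ _ _ (by omega), hV _ _ _ (by omega), hV _ _ _ (by omega)]
    field_simp
    linear_combination hpde
  -- evaluation of the expansion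
  have hpoly : ∀ i j k, evalAt ξ ((stencilPoly c i j k).eval η) =
      ∑ e : Fin 6, c' i j k e * ξ.h ^ (e : ℕ) := by
    intro i j k
    simp only [stencilPoly, eval_finsetSum, eval_mul, eval_C, eval_pow, eval_X, map_sum, map_mul,
      map_pow, hη, hcξ]
  have hexp : ∀ i j k, evalAt ξ (expansion (fun m n q => η ^ (m + n + q) * V m n q) i j k) =
      taylorPoly5 ξ.v ξ.P ((i : ℝ) * ξ.h, (j : ℝ) * ξ.h, (k : ℝ) * ξ.h) := by
    intro i j k
    rw [map_expansion]
    refine Finset.sum_congr rfl fun f hf => ?_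
    have hV : evalAt ξ (V f.1 f.2.1 f.2.2) = pd f.1 f.2.1 f.2.2 ξ.v ξ.P :=
      if_pos ((mem_degLE.1 hf).trans (by norm_num))
    simp only [map_mul, map_pow, hη, hV, taylorWeight, smul_eq_mul]
    ring
  have hv : ∀ i j k : SignType, ξ.v (ξ.P + ((i : ℝ) * ξ.h, (j : ℝ) * ξ.h, (k : ℝ) * ξ.h)) =
      taylorPoly5 ξ.v ξ.P ((i : ℝ) * ξ.h, (j : ℝ) * ξ.h, (k : ℝ) * ξ.h)
        + ξ.h ^ 6 * evalAt ξ (ρ i j k) := by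
    intro i j k
    have : evalAt ξ (ρ i j k) = (ξ.v (ξ.P + ((i : ℝ) * ξ.h, (j : ℝ) * ξ.h, (k : ℝ) * ξ.h))
        - taylorPoly5 ξ.v ξ.P ((i : ℝ) * ξ.h, (j : ℝ) * ξ.h, (k : ℝ) * ξ.h)) / ξ.h ^ 6 := rfl
    rw [this]
    field_simp
    ring
  have hsource : (sourcePolynomial c Θ φ₁ (historyJet Θ η V φ₁)).map
      (evalAt ξ : boundedFunctions Ω →+* ℝ) = sourcePolynomial c' (D.splitJets meth r ξ.t ξ.P)
        (fun m n q => pd m n q (D.f₁ ξ.t) ξ.P)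
        (fun m n q => pd m n q (D.f₂ meth ξ.t ξ.w) ξ.P / r) := by
    rw [map_sourcePolynomial, hcξ]
    refine Finset.sum_congr rfl fun e he => ?_
    have he' := hf₂ e he
    simp only [he']
    rfl
  have hF : ξ.h * c'.F (D.jets meth r ξ.t ξ.P) r ξ.h (D.f₁ ξ.t) (D.f₂ meth ξ.t ξ.w) ξ.P =
      ∑ s ∈ Finset.range 5,
        evalAt ξ ((sourcePolynomial c Θ φ₁ (historyJet Θ η V φ₁)).coeff s) * ξ.h ^ s := by
    rw [jets_eq_toJets, Stencil.F, sourcePoly_eq_toLaurent, mul_valueTrunc3 _ hh, ← hsource]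
    exact Finset.sum_congr rfl fun s _ => by rw [coeff_map, RingHom.coe_coe]
  have hy' := congrArg (evalAt ξ) hy
  simp only [map_add, map_mul, map_pow, map_sum, hη, hpoly, hexp] at hy'
  have hlhs : ξ.h ^ 2 * c'.lhsValue ξ.h ξ.v ξ.P = ∑ i, ∑ j, ∑ k,
      (∑ e : Fin 6, c' i j k e * ξ.h ^ (e : ℕ)) *
        taylorPoly5 ξ.v ξ.P ((i : ℝ) * ξ.h, (j : ℝ) * ξ.h, (k : ℝ) * ξ.h)
      + ξ.h ^ 6 * ∑ i, ∑ j, ∑ k,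
        (∑ e : Fin 6, c' i j k e * ξ.h ^ (e : ℕ)) * evalAt ξ (ρ i j k) := by
    unfold Stencil.lhsValue
    rw [← mul_assoc, mul_one_div_cancel (pow_ne_zero 2 hh), one_mul]
    simp only [hv, mul_add, Finset.sum_add_distrib, Finset.mul_sum (a := ξ.h ^ 6)]
    congr 1
    refine Finset.sum_congr rfl fun i _ => Finset.sum_congr rfl fun j _ =>
      Finset.sum_congr rfl fun k _ => by ring
  -- After multiplication by `h²` the stencil on the Taylor polynomials, its truncation error and
  -- the remainders add up to `h⁶` times the value of `E`.
  refine mul_left_cancel₀ (pow_ne_zero 2 hh) ?_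
  simp only [map_add, map_mul, map_sum, hpoly]
  linear_combination hlhs + hy' - ξ.h * hF

lemma mem_Icc_neighbour {h x : ℝ} {N i : ℕ} (hh : 0 < h) (hN : N * h = l₂ - l₁) (hi : 0 < i)
    (hiN : i < N) (hx : x = l₁ + i * h) (s : SignType) :
    x ∈ Set.Ioo l₁ l₂ ∧ x + s * h ∈ Set.Icc l₁ l₂ := by
  have h1 : (1 : ℝ) ≤ i := by exact_mod_cast hi
  have h2 : (i : ℝ) + 1 ≤ N := by exact_mod_cast hiN
  have h3 := mul_le_mul_of_nonneg_right h1 hh.le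
  have h4 := mul_le_mul_of_nonneg_right h2 hh.le
  have h5 := abs_le.1 (abs_sign_le_one s)
  have h6 := mul_le_mul_of_nonneg_right h5.1 hh.le
  have h7 := mul_le_mul_of_nonneg_right h5.2 hh.le
  subst hx
  exact ⟨⟨by linarith, by linarith⟩, ⟨by linarith, by linarith⟩⟩

lemma level_nonneg (meth : TimeMethod) : 0 ≤ meth.level := by
  cases meth <;> norm_num [TimeMethod.level]

end Uniformity

end CompactFDM

end

theorem mainTheorem4 (meth : CompactFDM.TimeMethod) (l₁ l₂ T r : ℝ)
    (hl : l₁ < l₂) (hT : 0 < T) (hr : 0 < r)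
    (D : CompactFDM.Data) (hD : D.Regular l₁ l₂ T) :
    (∀ t ∈ Set.Icc 0 T, ∀ p ∈ CompactFDM.openBox l₁ l₂,
      ∃! c : CompactFDM.Stencil, c.Admissible (D.jets meth r t p)) ∧
    (∀ M : ℝ, ∃ K : ℝ, ∀ (N i j k n : ℕ) (h t : ℝ) (P : CompactFDM.Space),
      0 < i → i < N → 0 < j → j < N → 0 < k → k < N →
      h = (l₂ - l₁) / N → P = CompactFDM.gridPoint l₁ h i j k →
      t = (n + meth.level) * (r * h) → t ≤ T →
      ∀ (v : CompactFDM.Space → ℝ) (w : ℕ → CompactFDM.Space → ℝ),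
        ContDiffOn ℝ ∞ v (CompactFDM.closedBox l₁ l₂) →
        (∀ s, ContDiffOn ℝ ∞ (w s) (CompactFDM.closedBox l₁ l₂)) →
        (∀ m₁ m₂ m₃ : ℕ, m₁ + m₂ + m₃ ≤ 6 → ∀ p ∈ CompactFDM.openBox l₁ l₂,
          |CompactFDM.pd m₁ m₂ m₃ v p| ≤ M) →
        CompactFDM.SolvesSemidiscrete D meth l₁ l₂ (r * h) t v w →
        ∀ c : CompactFDM.Stencil, c.Admissible (D.jets meth r t P) →
          |c.lhsValue h v P - c.F (D.jets meth r t P) r h (D.f₁ t) (D.f₂ meth t w) P|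
            ≤ K * h ^ 4) := by
  refine ⟨fun t _ p _ => CompactFDM.existsUnique_admissible (D.splitJets meth r t p), fun M => ?_⟩
  obtain ⟨E, hE⟩ := CompactFDM.exists_error_function (meth := meth) (M := M) hl hT hr hD
  -- Any bound of the error function serves as the constant.
  obtain ⟨K, hK⟩ := E.2
  refine ⟨K, fun N i j k n h t P hi hiN hj hjN hk hkN hh hP ht htT v w hv hw hM hsol c hc => ?_⟩
  have hN : (1 : ℝ) ≤ N := by exact_mod_cast hi.trans hiN
  have hN0 : (0 : ℝ) < N := one_pos.trans_le hN
  have hpos : 0 < h := by rw [hh]; exact div_pos (sub_pos.2 hl) hN0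
  have hNh : N * h = l₂ - l₁ := by rw [hh]; field_simp
  have hle : h ≤ l₂ - l₁ := by rw [← hNh]; exact le_mul_of_one_le_left hpos.le hN
  have hx := CompactFDM.mem_Icc_neighbour hpos hNh hi hiN (congrArg Prod.fst hP)
  have hy := CompactFDM.mem_Icc_neighbour hpos hNh hj hjN (congrArg (fun p => p.2.1) hP)
  have hz := CompactFDM.mem_Icc_neighbour hpos hNh hk hkN (congrArg (fun p => p.2.2) hP)
  have ht0 : 0 ≤ t := by
    rw [ht]
    exact mul_nonneg (add_nonneg n.cast_nonneg (CompactFDM.level_nonneg meth))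
      (mul_pos hr hpos).le
  have hξ := hE ⟨h, t, P, v, w, hpos, hle, ⟨ht0, htT⟩, ⟨(hx 0).1, (hy 0).1, (hz 0).1⟩,
    fun i j k => ⟨(hx i).2, (hy j).2, (hz k).2⟩, hv, hw, hM, hsol⟩ c hc
  simp only at hξ
  rw [hξ, abs_mul, abs_of_pos (pow_pos hpos 4), mul_comm]
  exact mul_le_mul_of_nonneg_right (hK _) (pow_pos hpos 4).le
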